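/- Let $\Omega\subset\mathbb R^2$ be open (bounded or unbounded) with compact smooth boundary: $\partial\Omega$ is a disjoint union of finitely many $C^\infty$ regular simple closed curves, and $\Omega$ lies locally on exactly one side of $\partial\Omega$. Let $\nu$ be the unit normal on $\partial\Omega$ pointing out of $\Omega$ and let $\mu$ be a $C^\infty$ density on $\partial\Omega$. For $\delta>0$ the local double layer heat potential is $$\mathcal D_L[\mu](x)=\int_0^{\delta}\int_{\partial\Omega}\frac{\partial}{\partial\nu_{x'}}\frac{e^{-\|x-x'\|^2/4t}}{4\pi t}\,\mu(x')\,ds_{x'}\,dt .$$ Put $\mathrm{sgn}(x)=-1,0,1$ for $x\in\Omega$, $x\in\partial\Omega$, $x\notin\overline\Omega$, respectively. For $b\in\partial\Omega$ let $\tau_b$ be a unit tangent vector and $\nu_b=\nu(b)$. Near $b$ the boundary is a graph over the tangent line, $\xi\mapsto b+\xi\tau_b+\gamma(\xi)\nu_b$ with $\gamma$ smooth near $0$ and $\gamma(0)=0$, and $\mu(\xi)=\mu(b+\xi\tau_b+\gamma(\xi)\nu_b)$ is smooth near $\xi=0$. Write $\gamma_b^{(k)}$, $\mu_b^{(k)}$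 for the $k$-th derivatives at $\xi=0$ of these two functions of $\xi$, $\mu_b=\mu(b)$, and $\kappa_b$ for the signed curvature of $\partial\Omega$ at $b$ with respect to $\nu_b$ (so $\kappa_b=\gamma''(0)$, which is $-1/R$ for a disc of radius $R$). Let $\mathrm{erfc}(a)=\frac{2}{\sqrt\pi}\int_a^\infty e^{-t^2}dt$. Then the time integral defining $\mathcal D_L[\mu](x)$ converges for every $x\in\mathbb R^2$ and $\delta>0$, and the following hold. (i) For every $x\in\mathbb R^2$ with closest boundary point $b$, writing $r=\|x-b\|$ (so $x=b+\mathrm{sgn}(x)\,r\,\nu_b$) and $c=r/\sqrt\delta$, $$\begin{aligned} \mathcal D_L[\mu](x)={}&\mathrm{sgn}(x)\frac{\mu_b}{2}\mathrm{erfc}\!\left(\tfrac c2\right)+\sqrt\delta\,\frac{\kappa_b\mu_b}{2\sqrt\pi}e^{-c^2/4} +\delta\,\mathrm{sgn}(x)\left[\frac{3c\kappa_b^2\mu_b}{8\sqrt\pi}e^{-c^2/4}+\frac{c\mu_b''}{4}\left(\frac{2e^{-c^2/4}}{\sqrt\pi}-c\,\mathrm{erfc}\!\left(\tfrac c2\right)\right)\right]\\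 &+\delta^{3/2}\frac{5(c^2-2)\kappa_b^3\mu_b}{16\sqrt\pi}e^{-c^2/4}+\delta^{3/2}\frac{\gamma_b^{(4)}\mu_b}{4\sqrt\pi}e^{-c^2/4}\\ &+\delta^{3/2}\frac{\kappa_b\mu_b''}{4}\left(\frac{2(c^2+1)e^{-c^2/4}}{\sqrt\pi}-c^3\mathrm{erfc}\!\left(\tfrac c2\right)\right)+\delta^{3/2}\frac{\gamma_b^{(3)}\mu_b'}{12}\left(\frac{2(c^2+4)e^{-c^2/4}}{\sqrt\pi}-c^3\mathrm{erfc}\!\left(\tfrac c2\right)\right)\\ &+\delta^2\,\mathrm{sgn}(x)\left[\frac{35c\kappa_b^4\mu_b(c^2-6)}{128\sqrt\pi}e^{-c^2/4}+\frac{5c(\gamma_b^{(3)})^2\mu_b}{12\sqrt\pi}e^{-c^2/4}+\frac{5c\kappa_b\gamma_b^{(4)}\mu_b}{8\sqrt\pi}e^{-c^2/4}\right]\\ &+\delta^2\,\mathrm{sgn}(x)\,5c\left[\frac{\kappa_b^2\mu_b''}{16}\left(\frac{2(c^2+1)e^{-c^2/4}}{\sqrt\pi}-c^3\mathrm{erfc}\!\left(\tfrac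 c2\right)\right)+\frac{\kappa_b\gamma_b^{(3)}\mu_b'}{24}\left(\frac{2(c^2+4)e^{-c^2/4}}{\sqrt\pi}-c^3\mathrm{erfc}\!\left(\tfrac c2\right)\right)\right]\\ &+\delta^2\,\mathrm{sgn}(x)\frac{c\mu_b^{(4)}}{48}\left(c^3\mathrm{erfc}\!\left(\tfrac c2\right)-\frac{2(c^2-2)e^{-c^2/4}}{\sqrt\pi}\right)+O(\delta^{5/2})\qquad(\delta\to0^+), \end{aligned}$$ where the $O(\delta^{5/2})$ is uniform in $x$: there are $C,\delta_0>0$ depending only on $\Omega$ and $\mu$ such that for all $0<\delta\le\delta_0$, all $x\in\mathbb R^2$ and every boundary point $b$ closest to $x$ the error is at most $C\delta^{5/2}$ in absolute value. (ii) For every $\delta>0$ and $b\in\partial\Omega$, $$\lim_{r\to0^+}\mathcal D_L[\mu](b\pm r\nu_b)=\mathcal D_L[\mu](b)\pm\tfrac12\mu(b).$$ -/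

import Mathlib

open Real Set Filter Topology MeasureTheory
open scoped ContDiff

noncomputable section

namespace HeatLayer

/-- The Euclidean plane. -/
abbrev Plane : Type := EuclideanSpace ℝ (Fin 2)

/-- The complementary error function. -/
def erfc (a : ℝ) : ℝ := 2 / √π * ∫ t in Ioi a, exp (-t ^ 2)

/-- The unit tangent of a parametrized plane curve. -/
def unitTangent (z : ℝ → Plane) (s : ℝ) : Plane := ‖deriv z s‖⁻¹ • deriv z s

/-- The unit normal to the right of the direction of travel. -/
def unitNormal (z : ℝ → Plane) (s : ℝ) : Plane :=
  !₂[unitTangent z s 1, -unitTangent z s 0]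

/-- The signed curvature, taken with respect to `unitNormal`: positive where the curve bends
towards that normal, and equal to `-1 / R` on a circle of radius `R` traversed
counterclockwise. -/
def curvature (z : ℝ → Plane) (s : ℝ) : ℝ :=
  inner ℝ (iteratedDeriv 2 z s) (unitNormal z s) / ‖deriv z s‖ ^ 2

/-- `Ω` is a plane open set with compact smooth boundary: its boundary is the disjoint union of
finitely many regular smooth simple closed curves `z i`, each of period one, and `Ω` lies on
exactly one side of its boundary. The curves are oriented so that `unitNormal (z i)` points
out of `Ω`. Bounded and unbounded `Ω` (interior and exterior domains) are both allowed. -/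
structure IsSmoothBoundary {ι : Type*} (Ω : Set Plane) (z : ι → ℝ → Plane) : Prop where
  isOpen : IsOpen Ω
  smooth : ∀ i, ContDiff ℝ ∞ (z i)
  periodic : ∀ i, Function.Periodic (z i) 1
  regular : ∀ i s, deriv (z i) s ≠ 0
  simple : ∀ i j, ∀ s ∈ Ico (0 : ℝ) 1, ∀ t ∈ Ico (0 : ℝ) 1, z i s = z j t → i = j ∧ s = t
  frontier_eq : frontier Ω = ⋃ i, range (z i)
  inside : ∀ i s, ∀ᶠ h in 𝓝[>] (0 : ℝ), z i s - h • unitNormal (z i) s ∈ Ω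
  outside : ∀ i s, ∀ᶠ h in 𝓝[>] (0 : ℝ), z i s + h • unitNormal (z i) s ∉ closure Ω

/-- The heat kernel of the plane. -/
def heatKernel (t : ℝ) (y : Plane) : ℝ := exp (-‖y‖ ^ 2 / (4 * t)) / (4 * π * t)

/-- The integral over the boundary (with respect to arc length) of `μ` times the derivative, in
the normal direction at the boundary point `x'`, of `x' ↦ heatKernel t (x - x')`. -/
def doubleLayerAt {ι : Type*} [Fintype ι] (z : ι → ℝ → Plane) (μ : Plane → ℝ) (x : Plane)
    (t : ℝ) : ℝ :=
  ∑ i, ∫ s in (0 : ℝ)..1,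
    fderiv ℝ (fun x' => heatKernel t (x - x')) (z i s) (unitNormal (z i) s) *
      μ (z i s) * ‖deriv (z i) s‖

/-- The local double layer heat potential with short-time cutoff `δ`. -/
def localDoubleLayer {ι : Type*} [Fintype ι] (z : ι → ℝ → Plane) (μ : Plane → ℝ) (δ : ℝ)
    (x : Plane) : ℝ :=
  ∫ t in (0 : ℝ)..δ, doubleLayerAt z μ x t

open Classical in
/-- The side of the boundary of the open set `Ω` on which a point lies, counted along the
outward normal. -/
def sideSign (Ω : Set Plane) (x : Plane) : ℝ :=
  if x ∈ Ω then -1 else if x ∈ frontier Ω then 0 else 1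

/-- The tangent line parametrization at the point `z s` of the boundary of `Ω`: close to that
point, `ξ ↦ z s + ξ τ + γ(ξ) ν`, with `τ` the unit tangent and `ν` the unit normal at `z s`, runs
through the boundary, and `m(ξ)` is the value of the density `μ` along it. -/
structure IsTangentParam (Ω : Set Plane) (z : ℝ → Plane) (s : ℝ) (μ : Plane → ℝ)
    (γ m : ℝ → ℝ) : Prop where
  smooth_graph : ContDiffAt ℝ ∞ γ 0
  smooth_density : ContDiffAt ℝ ∞ m 0
  graph_zero : γ 0 = 0
  mem_boundary : ∀ᶠ ξ in 𝓝 (0 : ℝ),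
    z s + ξ • unitTangent z s + γ ξ • unitNormal z s ∈ frontier Ω
  density_eq : ∀ᶠ ξ in 𝓝 (0 : ℝ),
    m ξ = μ (z s + ξ • unitTangent z s + γ ξ • unitNormal z s)

/-- The explicit part of the expansion, with `σ` the side of the target, `c` its scaled distance
to the boundary, `κ` the curvature, `γ₃`, `γ₄` the third and fourth derivatives of the boundary
curve and `m₀`, `m₁`, `m₂`, `m₄` the derivatives of the density of orders `0`, `1`, `2`, `4`. -/
def doubleLayerExpansion (δ σ c κ γ₃ γ₄ m₀ m₁ m₂ m₄ : ℝ) : ℝ :=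
  σ * (m₀ / 2) * erfc (c / 2)
  + √δ * (κ * m₀ / (2 * √π)) * exp (-c ^ 2 / 4)
  + δ * σ * (3 * c * κ ^ 2 * m₀ / (8 * √π) * exp (-c ^ 2 / 4)
      + c * m₂ / 4 * (2 * exp (-c ^ 2 / 4) / √π - c * erfc (c / 2)))
  + δ ^ (3 / 2 : ℝ) * (5 * (c ^ 2 - 2) * κ ^ 3 * m₀ / (16 * √π)) * exp (-c ^ 2 / 4)
  + δ ^ (3 / 2 : ℝ) * (γ₄ * m₀ / (4 * √π)) * exp (-c ^ 2 / 4)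
  + δ ^ (3 / 2 : ℝ) * (κ * m₂ / 4)
      * (2 * (c ^ 2 + 1) * exp (-c ^ 2 / 4) / √π - c ^ 3 * erfc (c / 2))
  + δ ^ (3 / 2 : ℝ) * (γ₃ * m₁ / 12)
      * (2 * exp (-c ^ 2 / 4) * (c ^ 2 + 4) / √π - c ^ 3 * erfc (c / 2))
  + δ ^ 2 * σ * (35 * c * κ ^ 4 * m₀ * (c ^ 2 - 6) / (128 * √π) * exp (-c ^ 2 / 4)
      + 5 * c * γ₃ ^ 2 * m₀ / (12 * √π) * exp (-c ^ 2 / 4)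
      + 5 * c * κ * γ₄ * m₀ / (8 * √π) * exp (-c ^ 2 / 4))
  + δ ^ 2 * σ * (5 * c)
      * (κ ^ 2 * m₂ / 16
          * (2 * (c ^ 2 + 1) * exp (-c ^ 2 / 4) / √π - c ^ 3 * erfc (c / 2))
        + κ * γ₃ * m₁ / 24
          * (2 * (c ^ 2 + 4) * exp (-c ^ 2 / 4) / √π - c ^ 3 * erfc (c / 2)))
  + δ ^ 2 * σ * (c * m₄ / 48)
      * (c ^ 3 * erfc (c / 2) - 2 * (c ^ 2 - 2) * exp (-c ^ 2 / 4) / √π)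

end HeatLayer

end

open HeatLayer

noncomputable section

namespace HeatLayer

/-! The boundary integral is expanded at a fixed time t = s² with error O(s³), uniformly in the
target. Integrating O(t^(3/2)) over (0, δ) gives O(δ^(5/2)), and the expanded integrand has an
explicit antiderivative.

A target x lies on the normal line through a closest boundary point, at a signed distance ρ. In the
tangent frame there, with tangential coordinate X and boundary height η, the kernel is an algebraic
expression divided by s⁴, times the Gaussian exp(-(X² + (ρ - η)²)/(4s²)). Under the parabolic
scaling X = s y, ρ = s w, the exponent is -(y² + w²)/4 plus the phase (2ρη - η²)/(4s²). This phase
is small in s at fixed y and w because η vanishes to second order. Multiplying Taylor expansions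
(`Approx`) replaces everything except the Gaussian by s times the polynomial `ArcJet.profile`, with
error O(s⁶) (`abs_sub_profile_le`). Division by s⁴ and dX = s dy turn this into O(s³). On a short
arc with small ρ the phase is at most y²/8, so half of the Gaussian in y survives, and the Gaussian
in w absorbs all powers of w. This makes the bound uniform in ρ (`exists_arc_bound`).

Integrating in y kills the odd powers. What remains is `ArcJet.model`, which involves neither the
fifth derivative of the curve nor the third derivative of the density. Up to the time substitution,
the closed formula is an antiderivative of the model (`hasDerivAt_blockExpansion`) that vanishes at
time zero (`tendsto_blockExpansion`), so `ArcJet.integral_model` is exact.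

The constants do not depend on the base point because all Taylor data are jointly continuous on a
compact parameter set (`exists_arcControl`). Pieces of the boundary away from the base point
contribute O(s³), and for targets far from the boundary the potential and the model are each O(s³)
(`exists_model_approx`).

For the jump relation, the inner integral minus the model is dominated in time uniformly up to the
boundary, so its time integral is continuous along the normal. The jump is thus that of the closed
formula, where it comes from the leading erfc term alone. -/

/-- `x` agrees with the polynomial `a₀ + a₁ s + ⋯ + a₄ s ^ 4` up to an error `F s ^ 5`, and the
coefficients are bounded by `F`. -/
structure Approx (s F x a₀ a₁ a₂ a₃ a₄ : ℝ) : Prop where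
  c₀ : |a₀| ≤ F
  c₁ : |a₁| ≤ F
  c₂ : |a₂| ≤ F
  c₃ : |a₃| ≤ F
  c₄ : |a₄| ≤ F
  err : |x - (a₀ + a₁ * s + a₂ * s ^ 2 + a₃ * s ^ 3 + a₄ * s ^ 4)| ≤ F * s ^ 5

/-! ### Arithmetic of expansions in s truncated after s⁴. -/

namespace Approx

variable {s F G x y a₀ a₁ a₂ a₃ a₄ b₀ b₁ b₂ b₃ b₄ : ℝ}

lemma nonneg (h : Approx s F x a₀ a₁ a₂ a₃ a₄) : 0 ≤ F := (abs_nonneg _).trans h.c₀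

lemma mono (h : Approx s F x a₀ a₁ a₂ a₃ a₄) (hs : 0 ≤ s) (hF : F ≤ G) :
    Approx s G x a₀ a₁ a₂ a₃ a₄ :=
  ⟨h.c₀.trans hF, h.c₁.trans hF, h.c₂.trans hF, h.c₃.trans hF, h.c₄.trans hF,
    h.err.trans (by gcongr)⟩

lemma congr (h : Approx s F x a₀ a₁ a₂ a₃ a₄) (hx : x = y) (h₀ : a₀ = b₀) (h₁ : a₁ = b₁)
    (h₂ : a₂ = b₂) (h₃ : a₃ = b₃) (h₄ : a₄ = b₄) : Approx s F y b₀ b₁ b₂ b₃ b₄ := by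
  subst hx h₀ h₁ h₂ h₃ h₄; exact h

lemma const (hs : 0 ≤ s) (hx : |x| ≤ F) : Approx s F x x 0 0 0 0 := by
  have hF : 0 ≤ F := (abs_nonneg x).trans hx
  refine ⟨hx, ?_, ?_, ?_, ?_, ?_⟩ <;> simp [hF]
  positivity

lemma add (h : Approx s F x a₀ a₁ a₂ a₃ a₄) (h' : Approx s G y b₀ b₁ b₂ b₃ b₄) :
    Approx s (F + G) (x + y) (a₀ + b₀) (a₁ + b₁) (a₂ + b₂) (a₃ + b₃) (a₄ + b₄) := by
  refine ⟨(abs_add_le _ _).trans (add_le_add h.c₀ h'.c₀),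
    (abs_add_le _ _).trans (add_le_add h.c₁ h'.c₁), (abs_add_le _ _).trans (add_le_add h.c₂ h'.c₂),
    (abs_add_le _ _).trans (add_le_add h.c₃ h'.c₃), (abs_add_le _ _).trans (add_le_add h.c₄ h'.c₄),
    ?_⟩
  refine le_trans ?_ (((abs_add_le _ _).trans (add_le_add h.err h'.err)).trans_eq (by ring))
  exact le_of_eq (by congr 1; ring)

lemma smul (h : Approx s F x a₀ a₁ a₂ a₃ a₄) (c : ℝ) :
    Approx s (|c| * F) (c * x) (c * a₀) (c * a₁) (c * a₂) (c * a₃) (c * a₄) := by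
  have key : ∀ {a : ℝ}, |a| ≤ F → |c * a| ≤ |c| * F := fun {a} ha => by
    rw [abs_mul]; gcongr
  refine ⟨key h.c₀, key h.c₁, key h.c₂, key h.c₃, key h.c₄, ?_⟩
  have := mul_le_mul_of_nonneg_left h.err (abs_nonneg c)
  rw [← abs_mul] at this
  refine le_trans (le_of_eq ?_) (this.trans_eq (by ring))
  congr 1; ring

lemma abs_poly_le (h : Approx s F x a₀ a₁ a₂ a₃ a₄) (hs : 0 ≤ s) (hs1 : s ≤ 1) :
    |a₀ + a₁ * s + a₂ * s ^ 2 + a₃ * s ^ 3 + a₄ * s ^ 4| ≤ 5 * F := by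
  have key : ∀ (a : ℝ) (n : ℕ), |a| ≤ F → |a * s ^ n| ≤ F := fun a n ha => by
    rw [abs_mul, abs_pow, abs_of_nonneg hs]
    exact (mul_le_of_le_one_right (abs_nonneg a) (pow_le_one₀ hs hs1)).trans ha
  have k1 := key _ 1 h.c₁
  rw [pow_one] at k1
  calc _ ≤ |a₀| + |a₁ * s| + |a₂ * s ^ 2| + |a₃ * s ^ 3| + |a₄ * s ^ 4| := by
        refine (abs_add_le _ _).trans (add_le_add_left ?_ _)
        refine (abs_add_le _ _).trans (add_le_add_left ?_ _)
        refine (abs_add_le _ _).trans (add_le_add_left ?_ _)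
        exact abs_add_le _ _
    _ ≤ F + F + F + F + F := by
        gcongr
        exacts [h.c₀, key _ 2 h.c₂, key _ 3 h.c₃, key _ 4 h.c₄]
    _ = 5 * F := by ring

lemma abs_le (h : Approx s F x a₀ a₁ a₂ a₃ a₄) (hs : 0 ≤ s) (hs1 : s ≤ 1) : |x| ≤ 6 * F := by
  have h1 := h.abs_poly_le hs hs1
  have h2 : F * s ^ 5 ≤ F := mul_le_of_le_one_right h.nonneg (pow_le_one₀ hs hs1)
  have h3 := abs_add_le (x - (a₀ + a₁ * s + a₂ * s ^ 2 + a₃ * s ^ 3 + a₄ * s ^ 4))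
    (a₀ + a₁ * s + a₂ * s ^ 2 + a₃ * s ^ 3 + a₄ * s ^ 4)
  rw [sub_add_cancel] at h3
  linarith [h.err]

/-- With p and q the two polynomials, the error is (x - p) y + p (y - q) plus the part of p q of
degree at least five. These three terms contribute 6, 5 and 10 times F G s⁵, whence the constant 21.
-/
lemma mul (h : Approx s F x a₀ a₁ a₂ a₃ a₄) (h' : Approx s G y b₀ b₁ b₂ b₃ b₄)
    (hs : 0 ≤ s) (hs1 : s ≤ 1) :
    Approx s (21 * F * G) (x * y) (a₀ * b₀) (a₀ * b₁ + a₁ * b₀) (a₀ * b₂ + a₁ * b₁ + a₂ * b₀)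
      (a₀ * b₃ + a₁ * b₂ + a₂ * b₁ + a₃ * b₀)
      (a₀ * b₄ + a₁ * b₃ + a₂ * b₂ + a₃ * b₁ + a₄ * b₀) := by
  have hF := h.nonneg
  have hG := h'.nonneg
  have hFG : 0 ≤ F * G := mul_nonneg hF hG
  have key : ∀ {a b : ℝ}, |a| ≤ F → |b| ≤ G → |a * b| ≤ F * G := fun {a b} ha hb => by
    rw [abs_mul]; gcongr
  obtain ⟨h0, h1, h2, h3, h4, h5⟩ := h
  have hx : Approx s F x a₀ a₁ a₂ a₃ a₄ := ⟨h0, h1, h2, h3, h4, h5⟩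
  obtain ⟨g0, g1, g2, g3, g4, g5⟩ := h'
  have hy : Approx s G y b₀ b₁ b₂ b₃ b₄ := ⟨g0, g1, g2, g3, g4, g5⟩
  have k00 := _root_.abs_le.1 (key h0 g0)
  have k01 := _root_.abs_le.1 (key h0 g1)
  have k02 := _root_.abs_le.1 (key h0 g2)
  have k03 := _root_.abs_le.1 (key h0 g3)
  have k04 := _root_.abs_le.1 (key h0 g4)
  have k10 := _root_.abs_le.1 (key h1 g0)
  have k11 := _root_.abs_le.1 (key h1 g1)
  have k12 := _root_.abs_le.1 (key h1 g2)
  have k13 := _root_.abs_le.1 (key h1 g3)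
  have k20 := _root_.abs_le.1 (key h2 g0)
  have k21 := _root_.abs_le.1 (key h2 g1)
  have k22 := _root_.abs_le.1 (key h2 g2)
  have k30 := _root_.abs_le.1 (key h3 g0)
  have k31 := _root_.abs_le.1 (key h3 g1)
  have k40 := _root_.abs_le.1 (key h4 g0)
  refine ⟨?_, ?_, ?_, ?_, ?_, ?_⟩
  · rw [_root_.abs_le, show 21 * F * G = 21 * (F * G) by ring]; constructor <;> linarith
  · rw [_root_.abs_le, show 21 * F * G = 21 * (F * G) by ring]; constructor <;> linarith
  · rw [_root_.abs_le, show 21 * F * G = 21 * (F * G) by ring]; constructor <;> linarith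
  · rw [_root_.abs_le, show 21 * F * G = 21 * (F * G) by ring]; constructor <;> linarith
  · rw [_root_.abs_le, show 21 * F * G = 21 * (F * G) by ring]; constructor <;> linarith
  · set p := a₀ + a₁ * s + a₂ * s ^ 2 + a₃ * s ^ 3 + a₄ * s ^ 4 with hp
    set q := b₀ + b₁ * s + b₂ * s ^ 2 + b₃ * s ^ 3 + b₄ * s ^ 4 with hq
    have e1 : |(x - p) * y| ≤ F * s ^ 5 * (6 * G) := by
      rw [abs_mul]; gcongr; exact hy.abs_le hs hs1
    have e2 : |p * (y - q)| ≤ 5 * F * (G * s ^ 5) := by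
      rw [abs_mul]; gcongr; exact hx.abs_poly_le hs hs1
    have hc : ∀ (c : ℝ) (n : ℕ) (k : ℝ), |c| ≤ k * (F * G) → |c * s ^ n| ≤ k * (F * G) := by
      intro c n k hc
      rw [abs_mul, abs_pow, abs_of_nonneg hs]
      exact (mul_le_of_le_one_right (abs_nonneg c) (pow_le_one₀ hs hs1)).trans hc
    have e3 : |(a₁ * b₄ + a₂ * b₃ + a₃ * b₂ + a₄ * b₁ + (a₂ * b₄ + a₃ * b₃ + a₄ * b₂) * s ^ 1
        + (a₃ * b₄ + a₄ * b₃) * s ^ 2 + a₄ * b₄ * s ^ 3)| ≤ 10 * (F * G) := by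
      have m14 := _root_.abs_le.1 (key h1 g4)
      have m23 := _root_.abs_le.1 (key h2 g3)
      have m32 := _root_.abs_le.1 (key h3 g2)
      have m41 := _root_.abs_le.1 (key h4 g1)
      have m24 := _root_.abs_le.1 (key h2 g4)
      have m33 := _root_.abs_le.1 (key h3 g3)
      have m42 := _root_.abs_le.1 (key h4 g2)
      have m34 := _root_.abs_le.1 (key h3 g4)
      have m43 := _root_.abs_le.1 (key h4 g3)
      have m44 := key h4 g4
      have n1 := hc (a₂ * b₄ + a₃ * b₃ + a₄ * b₂) 1 3 (by rw [_root_.abs_le]; constructor <;> linarith)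
      have n2 := hc (a₃ * b₄ + a₄ * b₃) 2 2 (by rw [_root_.abs_le]; constructor <;> linarith)
      have n3 := hc (a₄ * b₄) 3 1 (by linarith)
      rw [_root_.abs_le] at n1 n2 n3 ⊢
      constructor <;> linarith
    have e4 : |s ^ 5 * (a₁ * b₄ + a₂ * b₃ + a₃ * b₂ + a₄ * b₁ +
        (a₂ * b₄ + a₃ * b₃ + a₄ * b₂) * s ^ 1
        + (a₃ * b₄ + a₄ * b₃) * s ^ 2 + a₄ * b₄ * s ^ 3)| ≤ s ^ 5 * (10 * (F * G)) := by
      rw [abs_mul, abs_of_nonneg (pow_nonneg hs 5)]; gcongr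
    calc _ = |(x - p) * y + p * (y - q) + s ^ 5 * (a₁ * b₄ + a₂ * b₃ + a₃ * b₂ + a₄ * b₁ +
        (a₂ * b₄ + a₃ * b₃ + a₄ * b₂) * s ^ 1
        + (a₃ * b₄ + a₄ * b₃) * s ^ 2 + a₄ * b₄ * s ^ 3)| := by
          congr 1; rw [hp, hq]; ring
      _ ≤ F * s ^ 5 * (6 * G) + 5 * F * (G * s ^ 5) + s ^ 5 * (10 * (F * G)) :=
          (abs_add_le _ _).trans (add_le_add ((abs_add_le _ _).trans (add_le_add e1 e2)) e4)
      _ = 21 * F * G * s ^ 5 := by ring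

/-- The exponential polynomial of order four of a quantity without constant term. -/
lemma exp_taylor (h : Approx s F x 0 a₁ a₂ a₃ a₄) (hs : 0 ≤ s) (hs1 : s ≤ 1) (hF : 1 ≤ F) :
    Approx s (500 * F ^ 5) (1 + x + 1 / 2 * (x * x) + 1 / 6 * (x * x * x)
      + 1 / 24 * (x * x * x * x)) 1 a₁ (a₂ + a₁ ^ 2 / 2)
      (a₃ + a₁ * a₂ + a₁ ^ 3 / 6)
      (a₄ + a₁ * a₃ + a₂ ^ 2 / 2 + a₁ ^ 2 * a₂ / 2 + a₁ ^ 4 / 24) := by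
  have hF0 : (0:ℝ) ≤ F := by linarith
  have h2 := h.mul h hs hs1
  have h3 := h2.mul h hs hs1
  have h4 := h3.mul h hs hs1
  have hT := ((((const (x := 1) (F := 1) hs (by simp)).add h).add (h2.smul (1/2))).add
    (h3.smul (1/6))).add (h4.smul (1/24))
  have habs : ∀ q : ℝ, 0 < q → |1 / q| = 1 / q := fun q hq => abs_of_nonneg (by positivity)
  rw [habs 2 (by norm_num), habs 6 (by norm_num), habs 24 (by norm_num)] at hT
  have hpow : ∀ n ≤ 5, F ^ n ≤ F ^ 5 := fun n hn => pow_le_pow_right₀ hF hn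
  have p0 := hpow 0 (by norm_num)
  have p1 := hpow 1 (by norm_num)
  have p2 := hpow 2 (by norm_num)
  have p3 := hpow 3 (by norm_num)
  have p4 := hpow 4 (by norm_num)
  have hT' := hT.mono (G := 500 * F ^ 5) hs (by ring_nf at *; linarith)
  exact hT'.congr rfl (by ring) (by ring) (by ring) (by ring) (by ring)

/-- The exponential of a quantity without constant term. -/
lemma exp (h : Approx s F x 0 a₁ a₂ a₃ a₄) (hs : 0 ≤ s) (hs1 : s ≤ 1) (hF : 1 ≤ F)
    (hx : |x| ≤ y) :
    Approx s (30000 * F ^ 5 * Real.exp y) (Real.exp x) 1 a₁ (a₂ + a₁ ^ 2 / 2)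
      (a₃ + a₁ * a₂ + a₁ ^ 3 / 6)
      (a₄ + a₁ * a₃ + a₂ ^ 2 / 2 + a₁ ^ 2 * a₂ / 2 + a₁ ^ 4 / 24) := by
  have hF0 : (0:ℝ) ≤ F := by linarith
  have hey : 1 ≤ Real.exp y := Real.one_le_exp ((abs_nonneg x).trans hx)
  have hle : ∀ {k : ℝ}, k ≤ 500 * F ^ 5 → k ≤ 30000 * F ^ 5 * Real.exp y := fun {k} hk => by
    have : (0:ℝ) ≤ F ^ 5 := by positivity
    nlinarith
  have hT2 := h.exp_taylor hs hs1 hF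
  refine ⟨hle hT2.c₀, hle hT2.c₁, hle hT2.c₂, hle hT2.c₃, hle hT2.c₄, ?_⟩
  have hr : |Real.exp x - (1 + x + 1 / 2 * (x * x) + 1 / 6 * (x * x * x)
      + 1 / 24 * (x * x * x * x))| ≤ |x| ^ 5 * Real.exp y := by
    have h0 := Complex.norm_exp_sub_sum_le_norm_mul_exp (x : ℂ) 5
    have h1 : Complex.exp (x : ℂ) - ∑ m ∈ Finset.range 5, (x : ℂ) ^ m / (m.factorial : ℂ) =
        ((Real.exp x - (1 + x + 1 / 2 * (x * x) + 1 / 6 * (x * x * x)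
      + 1 / 24 * (x * x * x * x)) : ℝ) : ℂ) := by
      simp [Finset.sum_range_succ, Nat.factorial]
      ring
    rw [h1, Complex.norm_real, Complex.norm_real, Real.norm_eq_abs, Real.norm_eq_abs] at h0
    refine h0.trans ?_
    gcongr
  -- The constant term is zero, so x = O(s) and the fifth-order remainder of the exponential is
  -- O(s⁵).
  have hx5 : |x| ≤ 5 * F * s := by
    have e1 := h.err
    have hl : |a₁ * s + a₂ * s ^ 2 + a₃ * s ^ 3 + a₄ * s ^ 4| ≤ 4 * F * s := by
      have hb : ∀ (a : ℝ) (n : ℕ), |a| ≤ F → |a * s ^ (n + 1)| ≤ F * s := fun a n ha => by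
        rw [abs_mul, abs_pow, abs_of_nonneg hs, pow_succ]
        exact mul_le_mul ha (mul_le_of_le_one_left hs (pow_le_one₀ hs hs1)) (by positivity) hF0
      have q1 := _root_.abs_le.1 (hb a₁ 0 h.c₁)
      have q2 := _root_.abs_le.1 (hb a₂ 1 h.c₂)
      have q3 := _root_.abs_le.1 (hb a₃ 2 h.c₃)
      have q4 := _root_.abs_le.1 (hb a₄ 3 h.c₄)
      norm_num at q1 q2 q3 q4
      rw [_root_.abs_le]; constructor <;> linarith
    have hs5 : F * s ^ 5 ≤ F * s := by
      gcongr
      calc s ^ 5 = s ^ 4 * s := by ring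
        _ ≤ 1 * s := by gcongr; exact pow_le_one₀ hs hs1
        _ = s := one_mul s
    rw [_root_.abs_le] at *
    constructor <;> linarith
  have hx6 : |x| ^ 5 ≤ 3125 * F ^ 5 * s ^ 5 :=
    (pow_le_pow_left₀ (abs_nonneg x) hx5 5).trans_eq (by ring)
  have e2 := hT2.err
  have e3 : |x| ^ 5 * Real.exp y ≤ 3125 * F ^ 5 * s ^ 5 * Real.exp y := by gcongr
  have e4 : 500 * F ^ 5 * s ^ 5 ≤ 500 * F ^ 5 * s ^ 5 * Real.exp y :=
    le_mul_of_one_le_right (by positivity) hey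
  have e5 : 0 ≤ F ^ 5 * s ^ 5 * Real.exp y := by positivity
  have := (abs_sub_le (Real.exp x) (1 + x + 1 / 2 * (x * x) + 1 / 6 * (x * x * x)
      + 1 / 24 * (x * x * x * x)) _).trans (add_le_add hr e2)
  refine this.trans ?_
  linarith

end Approx

/-! ### Taylor data and the integrand in parabolic scaling. -/

/-- Taylor data of a boundary curve and a density at a boundary point. -/
structure ArcJet where
  (κ k₃ k₄ k₅ m₀ m₁ m₂ m₃ m₄ : ℝ)

namespace ArcJet

variable (J : ArcJet)

/-- All the entries are bounded by `C`. -/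
def BoundedBy (C : ℝ) : Prop :=
  |J.κ| ≤ C ∧ |J.k₃| ≤ C ∧ |J.k₄| ≤ C ∧ |J.k₅| ≤ C ∧
    |J.m₀| ≤ C ∧ |J.m₁| ≤ C ∧ |J.m₂| ≤ C ∧ |J.m₃| ≤ C ∧ |J.m₄| ≤ C

/-- The Taylor polynomial of the boundary curve. -/
def curve (x : ℝ) : ℝ := J.κ * x ^ 2 / 2 + J.k₃ * x ^ 3 / 6 + J.k₄ * x ^ 4 / 24 + J.k₅ * x ^ 5 / 120

/-- The derivative of the Taylor polynomial of the boundary curve. -/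
def slope (x : ℝ) : ℝ := J.κ * x + J.k₃ * x ^ 2 / 2 + J.k₄ * x ^ 3 / 6 + J.k₅ * x ^ 4 / 24

/-- The Taylor polynomial of the density. -/
def density (x : ℝ) : ℝ :=
  J.m₀ + J.m₁ * x + J.m₂ * x ^ 2 / 2 + J.m₃ * x ^ 3 / 6 + J.m₄ * x ^ 4 / 24

/-- Coefficient of `y ^ 1` in `profile`. -/
def q₁ (s w : ℝ) : ℝ := s * (w * J.m₁)
/-- Coefficient of `y ^ 2` in `profile`. -/
def q₂ (s w : ℝ) : ℝ :=
  s * (1 / 2 * J.κ * J.m₀ + 1 / 4 * w ^ 2 * J.κ * J.m₀) + s ^ 2 * (1 / 2 * w * J.m₂)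
/-- Coefficient of `y ^ 3` in `profile`. -/
def q₃ (s w : ℝ) : ℝ :=
  s ^ 2 * (1 / 3 * J.k₃ * J.m₀ + 1 / 2 * J.κ * J.m₁ + 1 / 12 * w ^ 2 * J.k₃ * J.m₀
    + 1 / 4 * w ^ 2 * J.κ * J.m₁) + s ^ 3 * (1 / 6 * w * J.m₃)
/-- Coefficient of `y ^ 4` in `profile`. -/
def q₄ (s w : ℝ) : ℝ :=
  s ^ 2 * (1 / 16 * w * J.κ ^ 2 * J.m₀ + 1 / 32 * w ^ 3 * J.κ ^ 2 * J.m₀)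
  + s ^ 3 * (1 / 8 * J.k₄ * J.m₀ + 1 / 3 * J.k₃ * J.m₁ + 1 / 4 * J.κ * J.m₂
    + 1 / 48 * w ^ 2 * J.k₄ * J.m₀ + 1 / 12 * w ^ 2 * J.k₃ * J.m₁ + 1 / 8 * w ^ 2 * J.κ * J.m₂)
  + s ^ 4 * (1 / 24 * w * J.m₄)
/-- Coefficient of `y ^ 5` in `profile`. -/
def q₅ (s w : ℝ) : ℝ :=
  s ^ 3 * (1 / 12 * w * J.κ * J.k₃ * J.m₀ + 1 / 16 * w * J.κ ^ 2 * J.m₁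
    + 1 / 48 * w ^ 3 * J.κ * J.k₃ * J.m₀ + 1 / 32 * w ^ 3 * J.κ ^ 2 * J.m₁)
  + s ^ 4 * (1 / 30 * J.k₅ * J.m₀ + 1 / 8 * J.k₄ * J.m₁ + 1 / 6 * J.k₃ * J.m₂ + 1 / 12 * J.κ * J.m₃
    + 1 / 240 * w ^ 2 * J.k₅ * J.m₀ + 1 / 48 * w ^ 2 * J.k₄ * J.m₁ + 1 / 24 * w ^ 2 * J.k₃ * J.m₂
    + 1 / 24 * w ^ 2 * J.κ * J.m₃)
/-- Coefficient of `y ^ 6` in `profile`. -/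
def q₆ (s w : ℝ) : ℝ :=
  s ^ 3 * ((-1 / 32) * J.κ ^ 3 * J.m₀ + 1 / 384 * w ^ 4 * J.κ ^ 3 * J.m₀)
  + s ^ 4 * (1 / 48 * w * J.k₃ ^ 2 * J.m₀ + 1 / 32 * w * J.κ * J.k₄ * J.m₀
    + 1 / 12 * w * J.κ * J.k₃ * J.m₁ + 1 / 32 * w * J.κ ^ 2 * J.m₂
    + 1 / 288 * w ^ 3 * J.k₃ ^ 2 * J.m₀ + 1 / 192 * w ^ 3 * J.κ * J.k₄ * J.m₀
    + 1 / 48 * w ^ 3 * J.κ * J.k₃ * J.m₁ + 1 / 64 * w ^ 3 * J.κ ^ 2 * J.m₂)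
/-- Coefficient of `y ^ 7` in `profile`. -/
def q₇ (s w : ℝ) : ℝ :=
  s ^ 4 * ((-1 / 24) * J.κ ^ 2 * J.k₃ * J.m₀ + (-1 / 32) * J.κ ^ 3 * J.m₁
    + 1 / 192 * w ^ 2 * J.κ ^ 2 * J.k₃ * J.m₀ + 1 / 384 * w ^ 4 * J.κ ^ 2 * J.k₃ * J.m₀
    + 1 / 384 * w ^ 4 * J.κ ^ 3 * J.m₁)
/-- Coefficient of `y ^ 8` in `profile`. -/
def q₈ (s w : ℝ) : ℝ :=
  s ^ 4 * ((-3 / 512) * w * J.κ ^ 4 * J.m₀ + (-1 / 1536) * w ^ 3 * J.κ ^ 4 * J.m₀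
    + 1 / 6144 * w ^ 5 * J.κ ^ 4 * J.m₀)

/-- The integrand of the double layer heat potential along the boundary in parabolic scaling
(`ξ = s y`, signed distance `s w`, `s = √t`), without its Gaussian factor and its terms of order
five and higher in `s`. -/
def profile (s w y : ℝ) : ℝ :=
  w * J.m₀ + J.q₁ s w * y + J.q₂ s w * y ^ 2 + J.q₃ s w * y ^ 3 + J.q₄ s w * y ^ 4
    + J.q₅ s w * y ^ 5 + J.q₆ s w * y ^ 6 + J.q₇ s w * y ^ 7 + J.q₈ s w * y ^ 8

end ArcJet

/-- The factors of the integrand in parabolic scaling. -/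
lemma approx_factors {C : ℝ} (hC : 1 ≤ C) {J : ArcJet} (hJ : J.BoundedBy C) {s w y : ℝ}
    (hs0 : 0 < s) (hs1 : s ≤ 1) {η θ g : ℝ} (hη : |η - J.curve (s * y)| ≤ C * |s * y| ^ 6)
    (hθ : |θ - J.slope (s * y)| ≤ C * |s * y| ^ 5)
    (hg : |g - J.density (s * y)| ≤ C * |s * y| ^ 5) :
    1 ≤ C * (1 + |y| + |w|) ^ 6 ∧
    Approx s (3 * (C * (1 + |y| + |w|) ^ 6) ^ 2) (w - η / s + y * θ) w
      (-(J.κ * y ^ 2 / 2) + y * (J.κ * y))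
      (-(J.k₃ * y ^ 3 / 6) + y * (J.k₃ * y ^ 2 / 2)) (-(J.k₄ * y ^ 4 / 24) + y * (J.k₄ * y ^ 3 / 6))
      (-(J.k₅ * y ^ 5 / 120) + y * (J.k₅ * y ^ 4 / 24)) ∧
    Approx s (C * (1 + |y| + |w|) ^ 6) g J.m₀ (J.m₁ * y) (J.m₂ * y ^ 2 / 2) (J.m₃ * y ^ 3 / 6)
      (J.m₄ * y ^ 4 / 24) ∧
    Approx s (6 * (C * (1 + |y| + |w|) ^ 6) ^ 2) ((2 * (s * w) * η - η ^ 2) / (4 * s ^ 2)) 0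
      (w * (J.κ * y ^ 2 / 2) / 2)
      (w * (J.k₃ * y ^ 3 / 6) / 2 - (J.κ * y ^ 2 / 2) ^ 2 / 4)
      (w * (J.k₄ * y ^ 4 / 24) / 2 - J.κ * y ^ 2 / 2 * (J.k₃ * y ^ 3 / 6) / 2)
      (w * (J.k₅ * y ^ 5 / 120) / 2
        - (J.κ * y ^ 2 / 2 * (J.k₄ * y ^ 4 / 24) * 2 + (J.k₃ * y ^ 3 / 6) ^ 2) / 4) := by
  obtain ⟨hκ, hk3, hk4, hk5, hm0, hm1, hm2, hm3, hm4⟩ := hJ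
  have hs := hs0.le
  obtain ⟨W, hW⟩ : ∃ W, W = 1 + |y| + |w| := ⟨_, rfl⟩
  rw [← hW]
  have hy0 := abs_nonneg y
  have hw0 := abs_nonneg w
  have hW1 : 1 ≤ W := by rw [hW]; linarith
  have hyW : |y| ≤ W := by rw [hW]; linarith
  have hwW : |w| ≤ W := by rw [hW]; linarith
  obtain ⟨B, hB⟩ : ∃ B, B = C * W ^ 6 := ⟨_, rfl⟩
  rw [← hB]
  have hpow : ∀ n ≤ 6, |y| ^ n ≤ W ^ 6 := fun n hn =>
    (pow_le_pow_left₀ hy0 hyW n).trans (pow_le_pow_right₀ hW1 hn)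
  have hW6 : 1 ≤ W ^ 6 := one_le_pow₀ hW1
  have hWB : W ≤ B := by
    calc W = 1 * W ^ 1 := by ring
      _ ≤ B := by rw [hB]; gcongr; norm_num
  have hB1 : 1 ≤ B := hW1.trans hWB
  have hcoef : ∀ (k d : ℝ) (n : ℕ), |k| ≤ C → n ≤ 6 → 1 ≤ d → |k * y ^ n / d| ≤ B := by
    intro k d n hk hn hd
    rw [abs_div, abs_mul, abs_pow, abs_of_nonneg (by linarith : (0:ℝ) ≤ d)]
    calc |k| * |y| ^ n / d ≤ |k| * |y| ^ n := div_le_self (by positivity) hd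
      _ ≤ B := by rw [hB]; gcongr; exact hpow n hn
  have hB0 : 0 ≤ B := by linarith
  have hsy : ∀ n, |s * y| ^ n = s ^ n * |y| ^ n := fun n => by
    rw [abs_mul, abs_of_pos hs0, mul_pow]
  -- the curve
  have A1 : Approx s B (η / s) 0 (J.κ * y ^ 2 / 2) (J.k₃ * y ^ 3 / 6) (J.k₄ * y ^ 4 / 24)
      (J.k₅ * y ^ 5 / 120) := by
    refine ⟨by simpa using hB0, hcoef _ _ _ hκ (by norm_num) (by norm_num),
      hcoef _ _ _ hk3 (by norm_num) (by norm_num), hcoef _ _ _ hk4 (by norm_num) (by norm_num),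
      hcoef _ _ _ hk5 (by norm_num) (by norm_num), ?_⟩
    have e : η / s - (0 + J.κ * y ^ 2 / 2 * s + J.k₃ * y ^ 3 / 6 * s ^ 2 + J.k₄ * y ^ 4 / 24 * s ^ 3
        + J.k₅ * y ^ 5 / 120 * s ^ 4) = (η - J.curve (s * y)) / s := by
      rw [ArcJet.curve]; field_simp; ring
    rw [e, abs_div, abs_of_pos hs0, div_le_iff₀ hs0]
    refine hη.trans ?_
    rw [hsy]
    calc C * (s ^ 6 * |y| ^ 6) ≤ C * (s ^ 6 * W ^ 6) := by gcongr
      _ = B * s ^ 5 * s := by rw [hB]; ring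
  have A2 : Approx s B θ 0 (J.κ * y) (J.k₃ * y ^ 2 / 2) (J.k₄ * y ^ 3 / 6)
      (J.k₅ * y ^ 4 / 24) := by
    refine ⟨by simpa using hB0, by simpa using hcoef J.κ 1 1 hκ (by norm_num) (by norm_num),
      hcoef _ _ _ hk3 (by norm_num) (by norm_num), hcoef _ _ _ hk4 (by norm_num) (by norm_num),
      hcoef _ _ _ hk5 (by norm_num) (by norm_num), ?_⟩
    have e : θ - (0 + J.κ * y * s + J.k₃ * y ^ 2 / 2 * s ^ 2 + J.k₄ * y ^ 3 / 6 * s ^ 3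
        + J.k₅ * y ^ 4 / 24 * s ^ 4) = θ - J.slope (s * y) := by
      rw [ArcJet.slope]; ring
    rw [e]
    refine hθ.trans ?_
    rw [hsy]
    calc C * (s ^ 5 * |y| ^ 5) ≤ C * (s ^ 5 * W ^ 6) := by gcongr; exact hpow 5 (by norm_num)
      _ = B * s ^ 5 := by rw [hB]; ring
  have A3 : Approx s B g J.m₀ (J.m₁ * y) (J.m₂ * y ^ 2 / 2) (J.m₃ * y ^ 3 / 6)
      (J.m₄ * y ^ 4 / 24) := by
    refine ⟨by simpa using hcoef J.m₀ 1 0 hm0 (by norm_num) (by norm_num),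
      by simpa using hcoef J.m₁ 1 1 hm1 (by norm_num) (by norm_num),
      hcoef _ _ _ hm2 (by norm_num) (by norm_num), hcoef _ _ _ hm3 (by norm_num) (by norm_num),
      hcoef _ _ _ hm4 (by norm_num) (by norm_num), ?_⟩
    have e : g - (J.m₀ + J.m₁ * y * s + J.m₂ * y ^ 2 / 2 * s ^ 2 + J.m₃ * y ^ 3 / 6 * s ^ 3
        + J.m₄ * y ^ 4 / 24 * s ^ 4) = g - J.density (s * y) := by
      rw [ArcJet.density]; ring
    rw [e]
    refine hg.trans ?_
    rw [hsy]
    calc C * (s ^ 5 * |y| ^ 5) ≤ C * (s ^ 5 * W ^ 6) := by gcongr; exact hpow 5 (by norm_num)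
      _ = B * s ^ 5 := by rw [hB]; ring
  have hBB : B ≤ B ^ 2 := by nlinarith
  have A4 := ((Approx.const hs (hwW.trans hWB)).add (A1.smul (-1))).add (A2.smul y)
  have A4' := A4.mono (G := 3 * B ^ 2) hs (by
    have : |y| * B ≤ B * B := by gcongr; exact hyW.trans hWB
    rw [abs_neg, abs_one]; nlinarith)
  have A5 := ((A1.smul w).smul (1 / 2)).add ((A1.mul A1 hs hs1).smul (-1 / 4))
  have A5' := A5.mono (G := 6 * B ^ 2) hs (by
    have : |w| * B ≤ B * B := by gcongr; exact hwW.trans hWB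
    rw [show |(1:ℝ) / 2| = 1 / 2 by norm_num, show |(-1:ℝ) / 4| = 1 / 4 by norm_num [abs_div]]
    nlinarith)
  have eq5 : 1 / 2 * (w * (η / s)) + -1 / 4 * (η / s * (η / s))
      = (2 * (s * w) * η - η ^ 2) / (4 * s ^ 2) := by field_simp; ring
  rw [eq5] at A5'
  exact ⟨hB1, A4'.congr (by ring) (by ring) (by ring) (by ring) (by ring) (by ring), A3,
    A5'.congr rfl (by ring) (by ring) (by ring) (by ring) (by ring)⟩

/-- A polynomial bound for the profile. -/
lemma abs_profile_le {C : ℝ} (hC : 1 ≤ C) {J : ArcJet} (hJ : J.BoundedBy C) {s : ℝ}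
    (hs0 : 0 < s) (hs1 : s ≤ 1) (w y : ℝ) :
    |J.profile s w y| ≤ 10 ^ 16 * C ^ 13 * (1 + |y| + |w|) ^ 78 := by
  -- The Taylor polynomials themselves serve as the data, so all remainders vanish and the profile
  -- is exactly the degree-four truncation of the product.
  obtain ⟨hB1, A4, A3, A5⟩ := approx_factors hC hJ hs0 hs1 (w := w) (y := y)
    (η := J.curve (s * y)) (θ := J.slope (s * y)) (g := J.density (s * y))
    (by simp; positivity) (by simp; positivity) (by simp; positivity)
  obtain ⟨W, hW⟩ : ∃ W, W = 1 + |y| + |w| := ⟨_, rfl⟩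
  rw [← hW] at hB1 A4 A3 A5 ⊢
  obtain ⟨B, hB⟩ : ∃ B, B = C * W ^ 6 := ⟨_, rfl⟩
  rw [← hB] at hB1 A4 A3 A5
  -- The exponential polynomial replaces the exponential here: no bound on the phase is available,
  -- and the truncated coefficients are the same.
  have A7 := (A4.mul A3 hs0.le hs1).mul (A5.exp_taylor hs0.le hs1 (by nlinarith)) hs0.le hs1
  have hBpow : B ^ 13 = C ^ 13 * W ^ 78 := by rw [hB]; ring
  refine le_trans (le_of_eq ?_) ((A7.abs_poly_le hs0.le hs1).trans ?_)
  · congr 1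
    simp only [ArcJet.profile, ArcJet.q₁, ArcJet.q₂, ArcJet.q₃, ArcJet.q₄, ArcJet.q₅, ArcJet.q₆,
      ArcJet.q₇, ArcJet.q₈]
    ring
  · have e : 10 ^ 16 * C ^ 13 * W ^ 78 = 10 ^ 16 * B ^ 13 := by rw [hBpow]; ring
    have e2 : 5 * (21 * (21 * (3 * B ^ 2) * B) * (500 * (6 * B ^ 2) ^ 5))
      = 25719120000 * B ^ 13 := by ring
    have : 0 ≤ B ^ 13 := by positivity
    rw [e, e2]; linarith

/-- Pointwise expansion of the integrand in parabolic scaling. -/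
lemma abs_sub_profile_le {C : ℝ} (hC : 1 ≤ C) {J : ArcJet} (hJ : J.BoundedBy C) {s w y : ℝ}
    (hs0 : 0 < s) (hs1 : s ≤ 1) {η θ g : ℝ} (hη : |η - J.curve (s * y)| ≤ C * |s * y| ^ 6)
    (hθ : |θ - J.slope (s * y)| ≤ C * |s * y| ^ 5)
    (hg : |g - J.density (s * y)| ≤ C * |s * y| ^ 5)
    (hq : |(2 * (s * w) * η - η ^ 2) / (4 * s ^ 2)| ≤ y ^ 2 / 8) :
    |(s * w - η + s * y * θ) * g * exp ((2 * (s * w) * η - η ^ 2) / (4 * s ^ 2))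
        - s * J.profile s w y|
      ≤ 10 ^ 16 * C ^ 13 * (1 + |y| + |w|) ^ 78 * exp (y ^ 2 / 8) * s ^ 6 := by
  obtain ⟨hB1, A4, A3, A5⟩ := approx_factors hC hJ hs0 hs1 (w := w) hη hθ hg
  have hs := hs0.le
  obtain ⟨W, hW⟩ : ∃ W, W = 1 + |y| + |w| := ⟨_, rfl⟩
  rw [← hW] at hB1 A4 A3 A5 ⊢
  obtain ⟨B, hB⟩ : ∃ B, B = C * W ^ 6 := ⟨_, rfl⟩
  rw [← hB] at hB1 A4 A3 A5
  -- The factor exp(y²/8) introduced here is later absorbed by half of the Gaussian exp(-y²/4).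
  have A6 := A5.exp hs hs1 (by nlinarith) hq
  have A7 := (A4.mul A3 hs hs1).mul A6 hs hs1
  have hY0 := Real.exp_pos (y ^ 2 / 8)
  obtain ⟨Y, hY⟩ : ∃ Y, Y = Real.exp (y ^ 2 / 8) := ⟨_, rfl⟩
  rw [← hY] at hY0 A7 ⊢
  have hBpow : B ^ 13 = C ^ 13 * W ^ 78 := by rw [hB]; ring
  have hF : 21 * (21 * (3 * B ^ 2) * B) * (30000 * (6 * B ^ 2) ^ 5 * Y)
      ≤ 10 ^ 16 * C ^ 13 * W ^ 78 * Y := by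
    have : 0 ≤ B ^ 13 * Y := by positivity
    have e : 10 ^ 16 * C ^ 13 * W ^ 78 * Y = 10 ^ 16 * (B ^ 13 * Y) := by rw [hBpow]; ring
    have e2 : 21 * (21 * (3 * B ^ 2) * B) * (30000 * (6 * B ^ 2) ^ 5 * Y)
      = 308629440000 * (B ^ 13 * Y) := by ring
    rw [e, e2]; linarith
  have h2 := mul_le_mul_of_nonneg_left (A7.mono hs hF).err hs
  rw [← abs_of_nonneg hs, ← abs_mul, abs_of_nonneg hs] at h2
  refine le_trans (le_of_eq ?_) (h2.trans_eq (by ring))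
  congr 1
  have e1 : s * w - η + s * y * θ = s * (w - η / s + y * θ) := by field_simp
  rw [e1]
  simp only [ArcJet.profile, ArcJet.q₁, ArcJet.q₂, ArcJet.q₃, ArcJet.q₄, ArcJet.q₅, ArcJet.q₆,
    ArcJet.q₇, ArcJet.q₈]
  ring

/-! ### Gaussian bounds and moments. -/

lemma one_add_abs_pow_mul_exp_le (n : ℕ) {b : ℝ} (hb : 0 < b) (y : ℝ) :
    (1 + |y|) ^ n * exp (-(b * y ^ 2)) ≤ n.factorial * exp (1 + 1 / (4 * b)) := by
  have h1 := Real.pow_div_factorial_le_exp (1 + |y|) (by positivity) n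
  have hf : (0:ℝ) < n.factorial := by positivity
  rw [div_le_iff₀ hf] at h1
  -- The power has been traded for an exponential, and completing the square bounds the resulting
  -- exponent.
  have h2 : 1 + |y| + -(b * y ^ 2) ≤ 1 + 1 / (4 * b) := by
    have : 1 / (4 * b) - |y| + b * y ^ 2 = (2 * b * |y| - 1) ^ 2 / (4 * b) := by
      rw [← sq_abs y]; field_simp; ring
    have h3 : 0 ≤ (2 * b * |y| - 1) ^ 2 / (4 * b) := by positivity
    linarith
  calc (1 + |y|) ^ n * exp (-(b * y ^ 2))
      ≤ exp (1 + |y|) * n.factorial * exp (-(b * y ^ 2)) := by gcongr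
    _ = n.factorial * exp (1 + |y| + -(b * y ^ 2)) := by rw [exp_add (1 + |y|)]; ring
    _ ≤ _ := by gcongr

lemma exists_one_add_abs_pow_mul_exp_le (n : ℕ) {b : ℝ} (hb : 0 < b) :
    ∃ M : ℝ, 0 < M ∧ ∀ y : ℝ, (1 + |y|) ^ n * exp (-(b * y ^ 2)) ≤ M :=
  ⟨_, by positivity, one_add_abs_pow_mul_exp_le n hb⟩

/-- Half of the Gaussian absorbs the polynomial factor; the other half is integrable. -/
lemma integrable_one_add_abs_pow_mul_exp (n : ℕ) {b : ℝ} (hb : 0 < b) :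
    Integrable (fun y : ℝ => (1 + |y|) ^ n * exp (-(b * y ^ 2))) := by
  have hb2 : 0 < b / 2 := by positivity
  have h := (integrable_exp_neg_mul_sq hb2).const_mul (n.factorial * exp (1 + 1 / (4 * (b / 2))))
  refine h.mono' (by fun_prop) (Eventually.of_forall fun y => ?_)
  rw [Real.norm_of_nonneg (by positivity)]
  have := one_add_abs_pow_mul_exp_le n hb2 y
  calc (1 + |y|) ^ n * exp (-(b * y ^ 2))
      = (1 + |y|) ^ n * exp (-(b / 2 * y ^ 2)) * exp (-(b / 2) * y ^ 2) := by
        rw [mul_assoc, ← exp_add]; congr 2; ring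
    _ ≤ _ := by gcongr

lemma integrable_pow_mul_exp (n : ℕ) {b : ℝ} (hb : 0 < b) :
    Integrable (fun y : ℝ => y ^ n * exp (-(b * y ^ 2))) := by
  refine (integrable_one_add_abs_pow_mul_exp n hb).mono' (by fun_prop)
    (Eventually.of_forall fun y => ?_)
  rw [norm_mul, norm_pow, Real.norm_eq_abs, Real.norm_of_nonneg (exp_pos _).le]
  gcongr
  linarith

/-- The Gaussian moments. -/
def gaussMoment (n : ℕ) : ℝ := ∫ y : ℝ, y ^ n * exp (-(1 / 4 * y ^ 2))

lemma gaussMoment_zero : gaussMoment 0 = 2 * √π := by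
  have := integral_gaussian (1 / 4)
  simp only [gaussMoment, pow_zero, one_mul]
  simp only [neg_mul] at this
  rw [this, show π / (1 / 4) = 2 ^ 2 * π by ring, sqrt_mul (by norm_num), sqrt_sq (by norm_num)]

lemma hasDerivAt_exp_sq (y : ℝ) :
    HasDerivAt (fun y : ℝ => exp (-(1 / 4 * y ^ 2))) (-(y / 2) * exp (-(1 / 4 * y ^ 2))) y := by
  have h := (((hasDerivAt_pow 2 y).const_mul (1 / 4)).neg).exp
  convert h using 1
  simp only [Pi.neg_apply]
  norm_num
  ring

lemma gaussMoment_one : gaussMoment 1 = 0 := by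
  have := integral_eq_zero_of_hasDerivAt_of_integrable
    (fun y => (hasDerivAt_exp_sq y).const_mul (-2))
    (by
      refine (integrable_pow_mul_exp 1 (b := 1 / 4) (by norm_num)).congr
        (Eventually.of_forall fun y => ?_)
      simp; ring)
    (by
      refine ((integrable_pow_mul_exp 0 (b := 1 / 4) (by norm_num)).const_mul (-2)).congr
        (Eventually.of_forall fun y => ?_)
      simp)
  rw [gaussMoment, ← this]
  congr 1; ext y; ring

/-- Integration by parts: the derivative of y^(n+1) exp(-y²/4) has integral zero. -/
lemma gaussMoment_add_two (n : ℕ) : gaussMoment (n + 2) = 2 * (n + 1) * gaussMoment n := by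
  have hi := fun k => integrable_pow_mul_exp k (b := 1 / 4) (by norm_num)
  have := integral_eq_zero_of_hasDerivAt_of_integrable
    (fun y : ℝ => (hasDerivAt_pow (n + 1) y).mul (hasDerivAt_exp_sq y))
    (by
      refine (((hi n).const_mul (n + 1)).sub ((hi (n + 2)).const_mul (1 / 2))).congr
        (Eventually.of_forall fun y => ?_)
      simp; ring)
    (hi (n + 1))
  have h2 : ∫ y : ℝ, ((n + 1) * (y ^ n * exp (-(1 / 4 * y ^ 2)))
      - 1 / 2 * (y ^ (n + 2) * exp (-(1 / 4 * y ^ 2)))) = 0 := by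
    rw [← this]; congr 1; ext y; simp; ring
  rw [integral_sub ((hi n).const_mul _) ((hi (n + 2)).const_mul _), integral_const_mul,
    integral_const_mul] at h2
  simp only [gaussMoment]
  linarith

/-! ### The Gaussian average of the profile. -/

namespace ArcJet

/-- The time integrand of the expansion: the short-time expansion of the double layer heat
potential at time `s ^ 2` and signed distance `ρ`. -/
def model (J : ArcJet) (s ρ : ℝ) : ℝ :=
  exp (-(1 / 4 * (ρ / s) ^ 2)) / (√π * s ^ 2) *
    ((ρ / s * J.m₀ + 2 * J.q₂ s (ρ / s) + 12 * J.q₄ s (ρ / s) + 120 * J.q₆ s (ρ / s)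
      + 1680 * J.q₈ s (ρ / s)) / 4)

variable (J : ArcJet)

lemma continuous_profile (s w : ℝ) : Continuous (J.profile s w) := by
  unfold profile; fun_prop

/-- Odd moments vanish. The moment of order 2k is 2√π (2k)!/k!, which yields the weights 1, 2, 12,
120, 1680 that also appear in `model`. -/
lemma integral_profile (s w : ℝ) :
    Integrable (fun y => J.profile s w y * exp (-(1 / 4 * y ^ 2))) ∧
    ∫ y, J.profile s w y * exp (-(1 / 4 * y ^ 2)) =
      2 * √π * (w * J.m₀ + 2 * J.q₂ s w + 12 * J.q₄ s w + 120 * J.q₆ s w + 1680 * J.q₈ s w) := by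
  have hi := fun k => integrable_pow_mul_exp k (b := 1 / 4) (by norm_num)
  let q : ℕ → ℝ := ![w * J.m₀, J.q₁ s w, J.q₂ s w, J.q₃ s w, J.q₄ s w, J.q₅ s w, J.q₆ s w,
    J.q₇ s w, J.q₈ s w] ∘ Fin.ofNat 9
  have e : (fun y => J.profile s w y * exp (-(1 / 4 * y ^ 2))) =
      fun y => ∑ k ∈ Finset.range 9, q k * (y ^ k * exp (-(1 / 4 * y ^ 2))) := by
    ext y
    simp only [Finset.sum_range_succ, Finset.sum_range_zero, profile]
    have h0 : q 0 = w * J.m₀ := rfl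
    have h1 : q 1 = J.q₁ s w := rfl
    have h2 : q 2 = J.q₂ s w := rfl
    have h3 : q 3 = J.q₃ s w := rfl
    have h4 : q 4 = J.q₄ s w := rfl
    have h5 : q 5 = J.q₅ s w := rfl
    have h6 : q 6 = J.q₆ s w := rfl
    have h7 : q 7 = J.q₇ s w := rfl
    have h8 : q 8 = J.q₈ s w := rfl
    rw [h0, h1, h2, h3, h4, h5, h6, h7, h8]
    ring
  rw [e]
  refine ⟨integrable_finsetSum _ fun k _ => (hi k).const_mul _, ?_⟩
  rw [integral_finsetSum _ fun k _ => (hi k).const_mul _]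
  simp only [integral_const_mul]
  have hm : ∀ k, ∫ y : ℝ, y ^ k * exp (-(1 / 4 * y ^ 2)) = gaussMoment k := fun k => rfl
  simp only [hm, Finset.sum_range_succ, Finset.sum_range_zero]
  have m0 := gaussMoment_zero
  have m1 := gaussMoment_one
  have m2 := gaussMoment_add_two 0
  have m3 := gaussMoment_add_two 1
  have m4 := gaussMoment_add_two 2
  have m5 := gaussMoment_add_two 3
  have m6 := gaussMoment_add_two 4
  have m7 := gaussMoment_add_two 5
  have m8 := gaussMoment_add_two 6
  norm_num at m2 m3 m4 m5 m6 m7 m8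
  rw [m8, m7, m6, m5, m4, m3, m2, m1, m0]
  have h0 : q 0 = w * J.m₀ := rfl
  have h2 : q 2 = J.q₂ s w := rfl
  have h4 : q 4 = J.q₄ s w := rfl
  have h6 : q 6 = J.q₆ s w := rfl
  have h8 : q 8 = J.q₈ s w := rfl
  rw [h0, h2, h4, h6, h8]
  ring

end ArcJet

/-! ### Approximation of the integral over one boundary arc. -/

/-- The weight that dominates all errors. -/
def errWeight (y : ℝ) : ℝ := (1 + |y|) ^ 83 * exp (-(1 / 8 * y ^ 2))

lemma errWeight_nonneg (y : ℝ) : 0 ≤ errWeight y := by unfold errWeight; positivity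

lemma continuous_errWeight : Continuous errWeight := by unfold errWeight; fun_prop

lemma integrable_errWeight : Integrable errWeight :=
  integrable_one_add_abs_pow_mul_exp 83 (by norm_num)

/-- Because 1 + |y| + |w| ≤ (1 + |y|)(1 + |w|), the Gaussian in w absorbs the powers of w, uniformly
in w. The exponent 83 is 78 + 5: the version with |y|⁵ is for the truncated tails. -/
lemma exists_weight_bound : ∃ M : ℝ, 0 < M ∧ ∀ w y : ℝ,
    |y| ^ 5 * (1 + |y| + |w|) ^ 78 * exp (-(1 / 4 * w ^ 2)) * exp (-(1 / 8 * y ^ 2))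
      ≤ M * errWeight y ∧
    (1 + |y| + |w|) ^ 78 * exp (-(1 / 4 * w ^ 2)) * exp (-(1 / 8 * y ^ 2)) ≤ M * errWeight y := by
  obtain ⟨M, hMpos, hM⟩ := exists_one_add_abs_pow_mul_exp_le 78 (b := 1 / 4) (by norm_num)
  refine ⟨M, hMpos, fun w y => ?_⟩
  have h := hM w
  have hM0 := hMpos.le
  have hy0 := abs_nonneg y
  have hw0 := abs_nonneg w
  have h3 : 1 + |y| + |w| ≤ (1 + |y|) * (1 + |w|) := by nlinarith
  rw [errWeight]
  obtain ⟨a, ha⟩ : ∃ a, a = 1 + |y| := ⟨_, rfl⟩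
  obtain ⟨d, hd⟩ : ∃ d, d = 1 + |y| + |w| := ⟨_, rfl⟩
  obtain ⟨b, hb⟩ : ∃ b, b = 1 + |w| := ⟨_, rfl⟩
  rw [← hd, ← ha, ← hb] at h3
  have hya : |y| ≤ a := by linarith
  have ha1 : 1 ≤ a := by linarith
  have hb1 : 0 ≤ b := by linarith
  have hd0 : 0 ≤ d := by linarith
  rw [← hd, ← ha]
  rw [← hb] at h
  generalize |y| = y' at *
  have hE4 : 0 ≤ exp (-(1 / 4 * w ^ 2)) := (exp_pos _).le
  generalize exp (-(1 / 4 * w ^ 2)) = E at *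
  have hE : 0 ≤ exp (-(1 / 8 * y ^ 2)) := (exp_pos _).le
  generalize exp (-(1 / 8 * y ^ 2)) = E' at *
  have h2 : d ^ 78 * E * E' ≤ M * (a ^ 78 * E') := by
    calc d ^ 78 * E * E' ≤ (a * b) ^ 78 * E * E' := by gcongr
      _ = (b ^ 78 * E) * (a ^ 78 * E') := by ring
      _ ≤ _ := by gcongr
  constructor
  · calc y' ^ 5 * d ^ 78 * E * E' = y' ^ 5 * (d ^ 78 * E * E') := by ring
      _ ≤ a ^ 5 * (M * (a ^ 78 * E')) := by gcongr
      _ = M * (a ^ 83 * E') := by ring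
  · refine h2.trans ?_
    gcongr
    norm_num

/-- Taylor control of a boundary arc over its tangent line: `X` is the tangential coordinate with
derivative `dX`, `η` the normal coordinate, `θ` the slope and `g` the density. -/
structure ArcControl (C a u₀ : ℝ) (J : ArcJet) (X dX η θ g : ℝ → ℝ) : Prop where
  bounded : J.BoundedBy C
  deriv_X : ∀ u ∈ Icc (-u₀) u₀, HasDerivAt X (dX u) u
  dX_nonneg : ∀ u ∈ Icc (-u₀) u₀, 0 ≤ dX u
  cont_dX : ContinuousOn dX (Icc (-u₀) u₀)
  cont_η : ContinuousOn η (Icc (-u₀) u₀)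
  cont_θ : ContinuousOn θ (Icc (-u₀) u₀)
  cont_g : ContinuousOn g (Icc (-u₀) u₀)
  left : X (-u₀) ≤ -a
  right : a ≤ X u₀
  curve : ∀ u ∈ Icc (-u₀) u₀, |η u - J.curve (X u)| ≤ C * |X u| ^ 6
  slope : ∀ u ∈ Icc (-u₀) u₀, |θ u - J.slope (X u)| ≤ C * |X u| ^ 5
  density : ∀ u ∈ Icc (-u₀) u₀, |g u - J.density (X u)| ≤ C * |X u| ^ 5

/-- The integrand of the double layer heat potential along an arc, at time `s ^ 2`. -/
def arcIntegrand (s ρ : ℝ) (X dX η θ g : ℝ → ℝ) (u : ℝ) : ℝ :=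
  ((ρ - η u) * dX u + X u * (dX u * θ u)) * g u / (8 * π * s ^ 4) *
    exp (-(X u ^ 2 + (ρ - η u) ^ 2) / (4 * s ^ 2))

/-- Two errors are compared. Replacing the arc by its Taylor data costs s² `errWeight` (X/s) dX,
which integrates to O(s³). Extending the model integral from the arc to the whole line costs a tail
in |x| ≥ a, where any power of s can be gained. The constant depends only on C and a, hence neither
on the base point nor on ρ. -/
lemma exists_arc_bound {C a : ℝ} (hC : 1 ≤ C) (ha : 0 < a) : ∃ K : ℝ, 0 ≤ K ∧
    ∀ (u₀ : ℝ) (J : ArcJet) (X dX η θ g : ℝ → ℝ), 0 ≤ u₀ → ArcControl C a u₀ J X dX η θ g →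
    ∀ s ρ : ℝ, 0 < s → s ≤ 1 →
      (∀ u ∈ Icc (-u₀) u₀, |2 * ρ * η u - η u ^ 2| ≤ X u ^ 2 / 2) →
      |(∫ u in (-u₀)..u₀, arcIntegrand s ρ X dX η θ g u) - J.model s ρ| ≤ K * s ^ 3 := by
  obtain ⟨M, hM0, hM⟩ := exists_weight_bound
  obtain ⟨K₀, hK₀⟩ : ∃ K₀ : ℝ, K₀ = 10 ^ 16 * C ^ 13 := ⟨_, rfl⟩
  have hK₀0 : 0 ≤ K₀ := by rw [hK₀]; positivity
  obtain ⟨I, hI⟩ : ∃ I, I = ∫ y, errWeight y := ⟨_, rfl⟩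
  have hI0 : 0 ≤ I := hI ▸ integral_nonneg errWeight_nonneg
  refine ⟨K₀ * M / (8 * π) * I + K₀ * M / (8 * π * a ^ 5) * I, by positivity, ?_⟩
  intro u₀ J X dX η θ g hu₀ h s ρ hs hs1 hq
  have hle : -u₀ ≤ u₀ := by linarith
  have huIcc : uIcc (-u₀) u₀ = Icc (-u₀) u₀ := uIcc_of_le hle
  have hcX : ContinuousOn X (Icc (-u₀) u₀) := fun u hu => (h.deriv_X u hu).continuousAt.continuousWithinAt
  have hcdX := h.cont_dX
  have hcη := h.cont_η
  have hcθ := h.cont_θ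
  have hcg := h.cont_g
  set w := ρ / s with hw
  have hρ : ρ = s * w := by rw [hw]; field_simp
  -- the model integrand in the tangential coordinate
  set H : ℝ → ℝ := fun x => exp (-(1 / 4 * w ^ 2)) / (8 * π * s ^ 3) *
    (J.profile s w (x / s) * exp (-(1 / 4 * (x / s) ^ 2))) with hH
  have hcP := J.continuous_profile s w
  have hcH : Continuous H := by
    rw [hH]
    have : Continuous fun x : ℝ => J.profile s w (x / s) := hcP.comp (by fun_prop)
    fun_prop
  obtain ⟨hPi, hPint⟩ := J.integral_profile s w
  have hHi : Integrable H := by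
    have := (hPi.comp_div hs.ne').const_mul (exp (-(1 / 4 * w ^ 2)) / (8 * π * s ^ 3))
    exact this
  have hHint : ∫ x, H x = J.model s ρ := by
    rw [hH, integral_const_mul,
      Measure.integral_comp_div (fun y => J.profile s w y * exp (-(1 / 4 * y ^ 2))) s, hPint,
      abs_of_pos hs, ArcJet.model, ← hw, smul_eq_mul]
    have : √π ^ 2 = π := sq_sqrt pi_pos.le
    have h2 : √π ≠ 0 := by positivity
    have hp : π ≠ 0 := pi_ne_zero
    field_simp
    rw [this]
    ring
  have hWi : Integrable (fun x => errWeight (x / s)) := integrable_errWeight.comp_div hs.ne'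
  have hWint : ∫ x, errWeight (x / s) = s * I := by
    rw [Measure.integral_comp_div errWeight s, abs_of_pos hs, smul_eq_mul, hI]
  have hWc : Continuous fun x => errWeight (x / s) := continuous_errWeight.comp (by fun_prop)
  -- Change of variables to the tangential coordinate, for the model integrand and for the weight.
  have hcomp : ∀ F : ℝ → ℝ, Continuous F →
      ∫ u in (-u₀)..u₀, F (X u) * dX u = ∫ x in (X (-u₀))..(X u₀), F x := fun F hF =>
    intervalIntegral.integral_comp_mul_deriv' (g := F) (by rw [huIcc]; exact h.deriv_X)
      (by rw [huIcc]; exact hcdX) hF.continuousOn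
  have hXle : X (-u₀) ≤ X u₀ := by linarith [h.left, h.right]
  -- the error of replacing the arc by its Taylor data
  have key1 : ∀ u ∈ Icc (-u₀) u₀, |arcIntegrand s ρ X dX η θ g u - H (X u) * dX u| ≤
      K₀ * M / (8 * π) * s ^ 2 * (errWeight (X u / s) * dX u) := by
    intro u hu
    set y := X u / s with hy
    have hX : X u = s * y := by rw [hy]; field_simp
    have hq' : |(2 * (s * w) * η u - η u ^ 2) / (4 * s ^ 2)| ≤ y ^ 2 / 8 := by
      rw [abs_div, abs_of_pos (by positivity : (0:ℝ) < 4 * s ^ 2), ← hρ,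
        div_le_iff₀ (by positivity)]
      refine (hq u hu).trans_eq ?_
      rw [hX]; ring
    have hb := abs_sub_profile_le (w := w) hC h.bounded hs hs1 (hX ▸ h.curve u hu)
      (hX ▸ h.slope u hu) (hX ▸ h.density u hu) hq'
    rw [← hK₀] at hb
    have hexp : exp (-(X u ^ 2 + (ρ - η u) ^ 2) / (4 * s ^ 2)) =
        exp (-(1 / 4 * w ^ 2)) * exp (-(1 / 4 * y ^ 2)) *
          exp ((2 * (s * w) * η u - η u ^ 2) / (4 * s ^ 2)) := by
      rw [← exp_add, ← exp_add, hX, hρ]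
      congr 1; field_simp; ring
    have hdiff : arcIntegrand s ρ X dX η θ g u - H (X u) * dX u =
        dX u / (8 * π * s ^ 4) * exp (-(1 / 4 * w ^ 2)) * exp (-(1 / 4 * y ^ 2)) *
        ((s * w - η u + s * y * θ u) * g u * exp ((2 * (s * w) * η u - η u ^ 2) / (4 * s ^ 2))
        - s * J.profile s w y) := by
      rw [arcIntegrand, hexp]
      simp only [hH]
      rw [← hy, hX, hρ]
      have hp : π ≠ 0 := pi_ne_zero
      field_simp
    have hd := h.dX_nonneg u hu
    rw [hdiff, abs_mul, abs_of_nonneg (by positivity)]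
    have hexp2 : exp (-(1 / 4 * y ^ 2)) * exp (y ^ 2 / 8) = exp (-(1 / 8 * y ^ 2)) := by
      rw [← exp_add]; congr 1; ring
    calc _ ≤ dX u / (8 * π * s ^ 4) * exp (-(1 / 4 * w ^ 2)) * exp (-(1 / 4 * y ^ 2)) *
          (K₀ * (1 + |y| + |w|) ^ 78 * exp (y ^ 2 / 8) * s ^ 6) :=
          mul_le_mul_of_nonneg_left hb (by positivity)
      _ = dX u / (8 * π * s ^ 4) * K₀ * s ^ 6 * ((1 + |y| + |w|) ^ 78 * exp (-(1 / 4 * w ^ 2)) *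
          exp (-(1 / 8 * y ^ 2))) := by
        rw [← hexp2]; generalize (1 + |y| + |w|) ^ 78 = Q; ring
      _ ≤ dX u / (8 * π * s ^ 4) * K₀ * s ^ 6 * (M * errWeight y) :=
        mul_le_mul_of_nonneg_left (hM w y).2 (by positivity)
      _ = _ := by have hp : π ≠ 0 := pi_ne_zero; field_simp
  have hcA : ContinuousOn (arcIntegrand s ρ X dX η θ g) (Icc (-u₀) u₀) := by
    unfold arcIntegrand; fun_prop (disch := positivity)
  have hcB : ContinuousOn (fun u => H (X u) * dX u) (Icc (-u₀) u₀) :=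
    (hcH.comp_continuousOn hcX).mul hcdX
  have hcW : ContinuousOn (fun u => errWeight (X u / s) * dX u) (Icc (-u₀) u₀) :=
    (hWc.comp_continuousOn hcX).mul hcdX
  have hiA : IntervalIntegrable (arcIntegrand s ρ X dX η θ g) volume (-u₀) u₀ :=
    (huIcc ▸ hcA).intervalIntegrable
  have hiB : IntervalIntegrable (fun u => H (X u) * dX u) volume (-u₀) u₀ :=
    ContinuousOn.intervalIntegrable (by rw [huIcc]; exact hcB)
  have hiW : IntervalIntegrable (fun u => errWeight (X u / s) * dX u) volume (-u₀) u₀ :=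
    ContinuousOn.intervalIntegrable (by rw [huIcc]; exact hcW)
  have part1 : |(∫ u in (-u₀)..u₀, arcIntegrand s ρ X dX η θ g u) -
      ∫ u in (-u₀)..u₀, H (X u) * dX u| ≤ K₀ * M / (8 * π) * I * s ^ 3 := by
    rw [← intervalIntegral.integral_sub hiA hiB, ← Real.norm_eq_abs]
    refine (intervalIntegral.norm_integral_le_of_norm_le hle
      (Eventually.of_forall fun u hu => key1 u (Ioc_subset_Icc_self hu)) (hiW.const_mul _)).trans ?_
    rw [intervalIntegral.integral_const_mul, hcomp (fun x => errWeight (x / s)) hWc]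
    have : ∫ x in (X (-u₀))..(X u₀), errWeight (x / s) ≤ s * I := by
      rw [← hWint, intervalIntegral.integral_of_le hXle]
      exact setIntegral_le_integral hWi (Eventually.of_forall fun x => errWeight_nonneg _)
    calc _ ≤ K₀ * M / (8 * π) * s ^ 2 * (s * I) := by gcongr
      _ = _ := by ring
  -- the error of truncating the integral of the model
  have part2 : |(∫ u in (-u₀)..u₀, H (X u) * dX u) - J.model s ρ| ≤
      K₀ * M / (8 * π * a ^ 5) * I * s ^ 3 := by
    rw [hcomp H hcH, intervalIntegral.integral_of_le hXle, ← hHint,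
      ← integral_add_compl (measurableSet_Ioc : MeasurableSet (Ioc (X (-u₀)) (X u₀))) hHi,
      sub_add_cancel_left, abs_neg, ← Real.norm_eq_abs]
    have hb : ∀ x ∈ (Ioc (X (-u₀)) (X u₀))ᶜ, ‖H x‖ ≤
        K₀ * M / (8 * π * a ^ 5) * s ^ 2 * errWeight (x / s) := by
      intro x hx
      have hxa : a ≤ |x| := by
        rw [mem_compl_iff, mem_Ioc, not_and_or, not_lt, not_le] at hx
        rcases hx with hx | hx
        · exact le_trans (by linarith [h.left]) (neg_le_abs x)
        · exact le_trans (by linarith [h.right]) (le_abs_self x)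
      set y := x / s with hy
      have hX : x = s * y := by rw [hy]; field_simp
      have hp := abs_profile_le hC h.bounded hs hs1 w y
      rw [← hK₀] at hp
      -- Outside the arc s |y| ≥ a. Inserting this factor turns the prefactor s⁻³ into s², and |y|⁵
      -- goes into the weight.
      have h5 : 1 ≤ s ^ 5 * |y| ^ 5 / a ^ 5 := by
        rw [one_le_div (by positivity), ← mul_pow]
        gcongr
        rwa [hX, abs_mul, abs_of_pos hs] at hxa
      have hexp2 : exp (-(1 / 4 * y ^ 2)) ≤ exp (-(1 / 8 * y ^ 2)) := by
        gcongr; norm_num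
      simp only [hH]
      rw [← hy, norm_mul, norm_mul, Real.norm_of_nonneg (by positivity),
        Real.norm_of_nonneg (exp_pos _).le, Real.norm_eq_abs]
      calc _ ≤ exp (-(1 / 4 * w ^ 2)) / (8 * π * s ^ 3) *
            ((K₀ * (1 + |y| + |w|) ^ 78) * exp (-(1 / 8 * y ^ 2))) * 1 := by
            rw [mul_one]; gcongr
        _ ≤ exp (-(1 / 4 * w ^ 2)) / (8 * π * s ^ 3) *
            ((K₀ * (1 + |y| + |w|) ^ 78) * exp (-(1 / 8 * y ^ 2))) * (s ^ 5 * |y| ^ 5 / a ^ 5) := by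
            gcongr
        _ = K₀ / (8 * π * a ^ 5) * s ^ 2 * (|y| ^ 5 * (1 + |y| + |w|) ^ 78 *
            exp (-(1 / 4 * w ^ 2)) * exp (-(1 / 8 * y ^ 2))) := by
            generalize (1 + |y| + |w|) ^ 78 = Q
            have hp : π ≠ 0 := pi_ne_zero
            field_simp
        _ ≤ K₀ / (8 * π * a ^ 5) * s ^ 2 * (M * errWeight y) :=
            mul_le_mul_of_nonneg_left (hM w y).1 (by positivity)
        _ = _ := by ring
    refine (norm_integral_le_of_norm_le
      (hWi.const_mul (K₀ * M / (8 * π * a ^ 5) * s ^ 2)).integrableOn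
      ((ae_restrict_iff' measurableSet_Ioc.compl).2 (Eventually.of_forall hb))).trans ?_
    refine (setIntegral_le_integral (hWi.const_mul (K₀ * M / (8 * π * a ^ 5) * s ^ 2))
      (Eventually.of_forall fun x => mul_nonneg (by positivity) (errWeight_nonneg _))).trans ?_
    rw [integral_const_mul, hWint]
    exact le_of_eq (by ring)
  calc _ ≤ _ := abs_sub_le _ (∫ u in (-u₀)..u₀, H (X u) * dX u) _
    _ ≤ _ := add_le_add part1 part2
    _ = _ := by ring

/-! ### Size of the model, uniformly in the Taylor data. -/

/-- Polynomially bounded dependence on the jet and on the scaled distance. -/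
def PolyBound (f : ArcJet → ℝ → ℝ) : Prop :=
  ∃ (K : ℝ) (n : ℕ), 0 ≤ K ∧ ∀ C : ℝ, 1 ≤ C → ∀ J : ArcJet, J.BoundedBy C → ∀ w : ℝ,
    |f J w| ≤ K * (C * (1 + |w|)) ^ n

namespace PolyBound

lemma one_le {C : ℝ} (hC : 1 ≤ C) (w : ℝ) : 1 ≤ C * (1 + |w|) := by
  nlinarith [abs_nonneg w]

lemma add {f g : ArcJet → ℝ → ℝ} (hf : PolyBound f) (hg : PolyBound g) :
    PolyBound fun J w => f J w + g J w := by
  obtain ⟨K, n, hK, h⟩ := hf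
  obtain ⟨L, m, hL, h'⟩ := hg
  refine ⟨K + L, max n m, by positivity, fun C hC J hJ w => ?_⟩
  have h1 := one_le hC w
  refine (abs_add_le _ _).trans ?_
  rw [add_mul]
  refine add_le_add ((h C hC J hJ w).trans ?_) ((h' C hC J hJ w).trans ?_)
  · gcongr
    exact le_max_left _ _
  · gcongr
    exact le_max_right _ _

lemma mul {f g : ArcJet → ℝ → ℝ} (hf : PolyBound f) (hg : PolyBound g) :
    PolyBound fun J w => f J w * g J w := by
  obtain ⟨K, n, hK, h⟩ := hf
  obtain ⟨L, m, hL, h'⟩ := hg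
  refine ⟨K * L, n + m, by positivity, fun C hC J hJ w => ?_⟩
  have h1 := one_le hC w
  rw [abs_mul]
  calc _ ≤ (K * (C * (1 + |w|)) ^ n) * (L * (C * (1 + |w|)) ^ m) :=
        mul_le_mul (h C hC J hJ w) (h' C hC J hJ w) (abs_nonneg _) (by positivity)
    _ = _ := by rw [pow_add]; ring

lemma const (c : ℝ) : PolyBound fun _ _ => c :=
  ⟨|c|, 0, abs_nonneg c, fun C hC J hJ w => by simp⟩

lemma of_le {f : ArcJet → ℝ → ℝ} (h : ∀ C J w, ArcJet.BoundedBy J C → |f J w| ≤ C) :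
    PolyBound f := by
  refine ⟨1, 1, zero_le_one, fun C hC J hJ w => (h C J w hJ).trans ?_⟩
  nlinarith [abs_nonneg w]

lemma dist : PolyBound fun _ w => w := by
  refine ⟨1, 1, zero_le_one, fun C hC J hJ w => ?_⟩
  nlinarith [abs_nonneg w]

end PolyBound

namespace ArcJet

/-- Coefficient of `s ^ 1` in the model. -/
def p₁ (J : ArcJet) (w : ℝ) : ℝ := J.κ * J.m₀ + 1 / 2 * w ^ 2 * J.κ * J.m₀
/-- Coefficient of `s ^ 2` in the model. -/
def p₂ (J : ArcJet) (w : ℝ) : ℝ :=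
  w * J.m₂ + 3 / 4 * w * J.κ ^ 2 * J.m₀ + 3 / 8 * w ^ 3 * J.κ ^ 2 * J.m₀
/-- Coefficient of `s ^ 3` in the model. -/
def p₃ (J : ArcJet) (w : ℝ) : ℝ :=
  3 / 2 * J.k₄ * J.m₀ + 4 * J.k₃ * J.m₁ + 3 * J.κ * J.m₂ + (-15 / 4) * J.κ ^ 3 * J.m₀
    + 1 / 4 * w ^ 2 * J.k₄ * J.m₀ + w ^ 2 * J.k₃ * J.m₁ + 3 / 2 * w ^ 2 * J.κ * J.m₂
    + 5 / 16 * w ^ 4 * J.κ ^ 3 * J.m₀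
/-- Coefficient of `s ^ 4` in the model. -/
def p₄ (J : ArcJet) (w : ℝ) : ℝ :=
  1 / 2 * w * J.m₄ + 5 / 2 * w * J.k₃ ^ 2 * J.m₀ + 15 / 4 * w * J.κ * J.k₄ * J.m₀
    + 10 * w * J.κ * J.k₃ * J.m₁ + 15 / 4 * w * J.κ ^ 2 * J.m₂ + (-315 / 32) * w * J.κ ^ 4 * J.m₀
    + 5 / 12 * w ^ 3 * J.k₃ ^ 2 * J.m₀ + 5 / 8 * w ^ 3 * J.κ * J.k₄ * J.m₀
    + 5 / 2 * w ^ 3 * J.κ * J.k₃ * J.m₁ + 15 / 8 * w ^ 3 * J.κ ^ 2 * J.m₂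
    + (-35 / 32) * w ^ 3 * J.κ ^ 4 * J.m₀ + 35 / 128 * w ^ 5 * J.κ ^ 4 * J.m₀

/-- The moments regrouped by powers of s: the form needed both for bounds and for comparison with
the derivative of the closed formula. -/
lemma model_eq (J : ArcJet) (s ρ : ℝ) : J.model s ρ =
    exp (-(1 / 4 * (ρ / s) ^ 2)) / (√π * s ^ 2) *
      ((ρ / s * J.m₀ + s * J.p₁ (ρ / s) + s ^ 2 * J.p₂ (ρ / s) + s ^ 3 * J.p₃ (ρ / s)
        + s ^ 4 * J.p₄ (ρ / s)) / 4) := by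
  rw [model, q₂, q₄, q₆, q₈, p₁, p₂, p₃, p₄]
  congr 2
  ring

lemma polyBound_κ : PolyBound fun J _ => J.κ := .of_le fun _ _ _ h => h.1
lemma polyBound_k₃ : PolyBound fun J _ => J.k₃ := .of_le fun _ _ _ h => h.2.1
lemma polyBound_k₄ : PolyBound fun J _ => J.k₄ := .of_le fun _ _ _ h => h.2.2.1
lemma polyBound_m₀ : PolyBound fun J _ => J.m₀ := .of_le fun _ _ _ h => h.2.2.2.2.1
lemma polyBound_m₁ : PolyBound fun J _ => J.m₁ := .of_le fun _ _ _ h => h.2.2.2.2.2.1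
lemma polyBound_m₂ : PolyBound fun J _ => J.m₂ := .of_le fun _ _ _ h => h.2.2.2.2.2.2.1
lemma polyBound_m₄ : PolyBound fun J _ => J.m₄ := .of_le fun _ _ _ h => h.2.2.2.2.2.2.2.2

lemma polyBound_p₁ : PolyBound p₁ := by
  unfold p₁
  repeat' first
    | exact PolyBound.const _ | exact PolyBound.dist | exact polyBound_κ | exact polyBound_m₀
    | exact polyBound_k₃ | exact polyBound_k₄ | exact polyBound_m₁ | exact polyBound_m₂
    | exact polyBound_m₄
    | apply PolyBound.add | apply PolyBound.mul

lemma polyBound_p₂ : PolyBound p₂ := by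
  unfold p₂
  repeat' first
    | exact PolyBound.const _ | exact PolyBound.dist | exact polyBound_κ | exact polyBound_m₀
    | exact polyBound_k₃ | exact polyBound_k₄ | exact polyBound_m₁ | exact polyBound_m₂
    | exact polyBound_m₄
    | apply PolyBound.add | apply PolyBound.mul

lemma polyBound_p₃ : PolyBound p₃ := by
  unfold p₃
  repeat' first
    | exact PolyBound.const _ | exact PolyBound.dist | exact polyBound_κ | exact polyBound_m₀
    | exact polyBound_k₃ | exact polyBound_k₄ | exact polyBound_m₁ | exact polyBound_m₂
    | exact polyBound_m₄
    | apply PolyBound.add | apply PolyBound.mul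

lemma polyBound_p₄ : PolyBound p₄ := by
  unfold p₄
  repeat' first
    | exact PolyBound.const _ | exact PolyBound.dist | exact polyBound_κ | exact polyBound_m₀
    | exact polyBound_k₃ | exact polyBound_k₄ | exact polyBound_m₁ | exact polyBound_m₂
    | exact polyBound_m₄
    | apply PolyBound.add | apply PolyBound.mul

/-- The model is dominated by its leading part and powers of `s`, with a Gaussian factor. -/
lemma exists_model_bound {C : ℝ} (hC : 1 ≤ C) : ∃ (K : ℝ) (n : ℕ), 0 ≤ K ∧
    ∀ J : ArcJet, J.BoundedBy C → ∀ s ρ : ℝ, 0 < s →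
      |J.model s ρ| ≤ K * ((1 + |ρ / s|) ^ n * exp (-(1 / 4 * (ρ / s) ^ 2))) *
        ((|ρ / s| + s + s ^ 4) / s ^ 2) := by
  obtain ⟨K₁, n₁, hK₁, h₁⟩ := polyBound_p₁
  obtain ⟨K₂, n₂, hK₂, h₂⟩ := polyBound_p₂
  obtain ⟨K₃, n₃, hK₃, h₃⟩ := polyBound_p₃
  obtain ⟨K₄, n₄, hK₄, h₄⟩ := polyBound_p₄
  set N := n₁ + n₂ + n₃ + n₄ with hN
  set K := 1 + K₁ + K₂ + K₃ + K₄ with hK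
  have hC0 : 0 ≤ C := by linarith
  refine ⟨4 * (K * C ^ (N + 1)) / (√π * 4), N, by positivity, fun J hJ s ρ hs => ?_⟩
  set w := ρ / s with hw
  set v := 1 + |w| with hv
  have hv1 : 1 ≤ v := by rw [hv]; linarith [abs_nonneg w]
  have hCv : 1 ≤ C * v := PolyBound.one_le hC w
  have hm : |J.m₀| ≤ C := hJ.2.2.2.2.1
  have key : ∀ {k : ℝ} {n : ℕ} {x : ℝ}, 0 ≤ k → k ≤ K → n ≤ N → |x| ≤ k * (C * v) ^ n →
      |x| ≤ K * C ^ (N + 1) * v ^ N := by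
    intro k n x hk hkK hn hx
    calc |x| ≤ k * (C * v) ^ n := hx
      _ ≤ K * (C * v) ^ N := by gcongr
      _ = K * C ^ N * v ^ N := by rw [mul_pow]; ring
      _ ≤ _ := by gcongr; omega
  set B := K * C ^ (N + 1) * v ^ N with hB
  have b₁ : |J.p₁ w| ≤ B := key hK₁ (by linarith) (by omega) (h₁ C hC J hJ w)
  have b₂ : |J.p₂ w| ≤ B := key hK₂ (by linarith) (by omega) (h₂ C hC J hJ w)
  have b₃ : |J.p₃ w| ≤ B := key hK₃ (by linarith) (by omega) (h₃ C hC J hJ w)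
  have b₄ : |J.p₄ w| ≤ B := key hK₄ (by linarith) (by omega) (h₄ C hC J hJ w)
  have b₀ : |J.m₀| ≤ B := by
    refine hm.trans ?_
    have e1 : C ≤ C ^ (N + 1) := le_self_pow₀ hC (by omega)
    have e2 : 1 ≤ v ^ N := one_le_pow₀ hv1
    have e3 : 1 ≤ K := by linarith
    calc C = 1 * C * 1 := by ring
      _ ≤ _ := by rw [hB]; gcongr
  have hB0 : 0 ≤ B := (abs_nonneg _).trans b₀
  have hsum : |w * J.m₀ + s * J.p₁ w + s ^ 2 * J.p₂ w + s ^ 3 * J.p₃ w + s ^ 4 * J.p₄ w| ≤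
      4 * B * (|w| + s + s ^ 4) := by
    have c : ∀ (x p : ℝ), |p| ≤ B → |x * p| ≤ |x| * B := fun x p hp => by rw [abs_mul]; gcongr
    have c0 := c w _ b₀
    have c1 := (c (s) _ b₁).trans_eq (by rw [abs_of_pos (by positivity)])
    have c2 := (c (s ^ 2) _ b₂).trans_eq (by rw [abs_of_pos (by positivity)])
    have c3 := (c (s ^ 3) _ b₃).trans_eq (by rw [abs_of_pos (by positivity)])
    have c4 := (c (s ^ 4) _ b₄).trans_eq (by rw [abs_of_pos (by positivity)])
    -- Intermediate powers lie below the sum of the extreme ones, whether s is below or above one.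
    have d2 : s ^ 2 ≤ s + s ^ 4 := by
      rcases le_total s 1 with h | h
      · nlinarith [pow_pos hs 4]
      · nlinarith [pow_le_pow_right₀ h (show 2 ≤ 4 by norm_num)]
    have d3 : s ^ 3 ≤ s + s ^ 4 := by
      rcases le_total s 1 with h | h
      · nlinarith [pow_pos hs 4, pow_le_of_le_one hs.le h (show 3 ≠ 0 by norm_num)]
      · nlinarith [pow_le_pow_right₀ h (show 3 ≤ 4 by norm_num)]
    calc _ ≤ |w| * B + s * B + s ^ 2 * B + s ^ 3 * B + s ^ 4 * B := by
          refine (abs_add_le _ _).trans (add_le_add ?_ c4)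
          refine (abs_add_le _ _).trans (add_le_add ?_ c3)
          refine (abs_add_le _ _).trans (add_le_add ?_ c2)
          exact (abs_add_le _ _).trans (add_le_add c0 c1)
      _ ≤ |w| * B + s * B + (s + s ^ 4) * B + (s + s ^ 4) * B + s ^ 4 * B := by gcongr
      _ ≤ _ := by
        have := mul_nonneg (abs_nonneg w) hB0
        have := mul_nonneg hs.le hB0
        have := mul_nonneg (pow_pos hs 4).le hB0
        linarith
  rw [model_eq, ← hw, abs_mul, abs_div _ 4, abs_of_nonneg (by positivity : (0:ℝ) ≤
    exp (-(1 / 4 * w ^ 2)) / (√π * s ^ 2)), abs_of_pos (by norm_num : (0:ℝ) < 4)]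
  calc _ ≤ exp (-(1 / 4 * w ^ 2)) / (√π * s ^ 2) * (4 * B * (|w| + s + s ^ 4) / 4) := by gcongr
    _ = _ := by rw [hB]; field_simp

/-- The model is negligible away from the boundary and for large times. -/
lemma exists_model_le_cube {C r₀ : ℝ} (hC : 1 ≤ C) (hr₀ : 0 < r₀) : ∃ K : ℝ, 0 ≤ K ∧
    ∀ J : ArcJet, J.BoundedBy C → ∀ s ρ : ℝ, 0 < s → (r₀ ≤ |ρ| ∨ 1 ≤ s) →
      |J.model s ρ| ≤ K * s ^ 3 := by
  obtain ⟨K, n, hK, h⟩ := exists_model_bound hC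
  -- Of the six extra powers of 1 + |w|, one bounds the factor |w| + s + s⁴ for s ≤ 1. The other
  -- five turn s⁻² into s³, since s |w| ≥ r₀.
  obtain ⟨M, hM0, hM⟩ := exists_one_add_abs_pow_mul_exp_le (n + 6) (b := 1 / 4) (by norm_num)
  refine ⟨3 * K * M * (1 + 1 / r₀ ^ 5), by positivity, fun J hJ s ρ hs hor => ?_⟩
  have hb := h J hJ s ρ hs
  have hMw := hM (ρ / s)
  have hρ : |ρ| = s * |ρ / s| := by rw [abs_div, abs_of_pos hs]; field_simp
  generalize ρ / s = w at *
  set E := exp (-(1 / 4 * w ^ 2)) with hE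
  have hE0 : 0 < E := exp_pos _
  have hw0 := abs_nonneg w
  have hv : (1 + |w|) ^ (n + 6) = (1 + |w|) ^ n * (1 + |w|) ^ 6 := pow_add _ _ _
  set P := (1 + |w|) ^ n with hP
  have hP0 : 0 < P := by positivity
  rcases le_total 1 s with hs1 | hs1
  · have e : (|w| + s + s ^ 4) / s ^ 2 ≤ 3 * (1 + |w|) ^ 6 * s ^ 3 := by
      rw [div_le_iff₀ (by positivity)]
      have h1 : |w| ≤ (1 + |w|) ^ 6 := le_trans (by linarith)
        (le_self_pow₀ (by linarith : 1 ≤ 1 + |w|) (by norm_num : 6 ≠ 0))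
      have h2 : 1 ≤ (1 + |w|) ^ 6 := one_le_pow₀ (by linarith)
      have h3 : 1 ≤ s ^ 5 := one_le_pow₀ hs1
      have h4 : s ≤ s ^ 5 := le_self_pow₀ hs1 (by norm_num)
      have h5 : s ^ 4 ≤ s ^ 5 := pow_le_pow_right₀ hs1 (by norm_num)
      have h6 : s ^ 5 ≤ (1 + |w|) ^ 6 * s ^ 5 := le_mul_of_one_le_left (by positivity) h2
      have h7 : (1 + |w|) ^ 6 ≤ (1 + |w|) ^ 6 * s ^ 5 := le_mul_of_one_le_right (by positivity) h3
      have : 3 * (1 + |w|) ^ 6 * s ^ 3 * s ^ 2 = 3 * ((1 + |w|) ^ 6 * s ^ 5) := by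
        generalize (1 + |w|) ^ 6 = Q; ring
      rw [this]; linarith
    calc _ ≤ _ := hb
      _ ≤ K * (P * E) * (3 * (1 + |w|) ^ 6 * s ^ 3) := by gcongr
      _ = 3 * K * ((1 + |w|) ^ (n + 6) * E) * s ^ 3 := by
        rw [hv]; generalize (1 + |w|) ^ 6 = Q; ring
      _ ≤ 3 * K * M * s ^ 3 := by gcongr
      _ ≤ 3 * K * M * (1 + 1 / r₀ ^ 5) * s ^ 3 := by
        refine mul_le_mul_of_nonneg_right (le_mul_of_one_le_right (by positivity) ?_)
          (by positivity)
        have : 0 ≤ 1 / r₀ ^ 5 := by positivity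
        linarith
  · have hor' : r₀ ≤ s * |w| ∨ s = 1 := by
      rcases hor with h | h
      · left; rwa [hρ] at h
      · right; linarith
    have e0 : (|w| + s + s ^ 4) / s ^ 2 ≤ 3 * (1 + |w|) / s ^ 2 := by
      gcongr
      have : s ^ 4 ≤ 1 := pow_le_one₀ hs.le hs1
      linarith
    have e1 : 1 ≤ (1 + 1 / r₀ ^ 5) * (1 + |w|) ^ 5 * s ^ 5 := by
      have h2 : 1 ≤ (1 + |w|) ^ 5 := one_le_pow₀ (by linarith)
      have h3 : 0 ≤ 1 / r₀ ^ 5 := by positivity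
      rcases hor' with h | h
      · have : r₀ ^ 5 ≤ s ^ 5 * (1 + |w|) ^ 5 := by
          rw [← mul_pow]; gcongr; nlinarith
        have h4 : 1 ≤ 1 / r₀ ^ 5 * (s ^ 5 * (1 + |w|) ^ 5) := by
          rw [div_mul_eq_mul_div, one_mul, one_le_div (by positivity)]; exact this
        have h5 : 0 ≤ s ^ 5 * (1 + |w|) ^ 5 := by positivity
        generalize (1 + |w|) ^ 5 = Q at *
        nlinarith
      · subst h
        rw [one_pow, mul_one]
        nlinarith
    have e : (|w| + s + s ^ 4) / s ^ 2 ≤ 3 * (1 + |w|) ^ 6 * (1 + 1 / r₀ ^ 5) * s ^ 3 := by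
      refine e0.trans ?_
      rw [div_le_iff₀ (by positivity)]
      have h3 := mul_le_mul_of_nonneg_left e1 (by positivity : 0 ≤ 3 * (1 + |w|))
      calc _ = 3 * (1 + |w|) * 1 := by ring
        _ ≤ _ := h3
        _ = _ := by
          rw [pow_succ (1 + |w|) 5]; generalize (1 + |w|) ^ 5 = Q; generalize 1 + |w| = R
          generalize 1 / r₀ ^ 5 = T; ring
    calc _ ≤ _ := hb
      _ ≤ K * (P * E) * (3 * (1 + |w|) ^ 6 * (1 + 1 / r₀ ^ 5) * s ^ 3) := by gcongr
      _ = 3 * K * ((1 + |w|) ^ (n + 6) * E) * (1 + 1 / r₀ ^ 5) * s ^ 3 := by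
        rw [hv]; generalize (1 + |w|) ^ 6 = Q; generalize 1 / r₀ ^ 5 = T; ring
      _ ≤ 3 * K * M * (1 + 1 / r₀ ^ 5) * s ^ 3 := by gcongr

end ArcJet

/-! ### The complementary error function -/

lemma integrable_exp_neg_sq : Integrable (fun t : ℝ => exp (-t ^ 2)) := by
  simpa using integrable_exp_neg_mul_sq (b := 1) one_pos

lemma erfc_zero : erfc 0 = 1 := by
  have h := integral_gaussian_Ioi 1
  simp only [neg_mul, one_mul, div_one] at h
  rw [erfc, h]
  have : √π ≠ 0 := by positivity
  field_simp

lemma hasDerivAt_erfc (a : ℝ) : HasDerivAt erfc (-(2 / √π * exp (-a ^ 2))) a := by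
  have hc : Continuous fun t : ℝ => exp (-t ^ 2) := by fun_prop
  have h1 : erfc = fun a => 2 / √π * ((∫ t in Ioi (0 : ℝ), exp (-t ^ 2)) -
      ∫ t in (0 : ℝ)..a, exp (-t ^ 2)) := by
    ext a
    rw [← intervalIntegral.integral_Ioi_sub_Ioi' integrable_exp_neg_sq.integrableOn
      integrable_exp_neg_sq.integrableOn, sub_sub_cancel, erfc]
  rw [h1]
  have h2 := ((intervalIntegral.integral_hasDerivAt_right (hc.intervalIntegrable 0 a)
    (hc.stronglyMeasurableAtFilter _ _) hc.continuousAt).const_sub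
      (∫ t in Ioi (0 : ℝ), exp (-t ^ 2))).const_mul (2 / √π)
  exact h2.congr_deriv (by ring)

lemma continuous_erfc : Continuous erfc :=
  continuous_iff_continuousAt.2 fun a => (hasDerivAt_erfc a).continuousAt

lemma erfc_nonneg (a : ℝ) : 0 ≤ erfc a := by
  unfold erfc
  have : 0 ≤ ∫ t in Ioi a, exp (-t ^ 2) := integral_nonneg fun t => (exp_pos _).le
  positivity

/-- Shift the integral to start at zero and use (t + a)² ≥ t² + a² for t, a ≥ 0. -/
lemma erfc_le {a : ℝ} (ha : 0 ≤ a) : erfc a ≤ exp (-a ^ 2) := by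
  have h1 : ∫ t in Ioi a, exp (-t ^ 2) = ∫ t in Ioi (0 : ℝ), exp (-(t + a) ^ 2) := by
    have h := (measurePreserving_add_right volume a).setIntegral_preimage_emb
      (measurableEmbedding_addRight a) (fun t => exp (-t ^ 2)) (Ioi a)
    rw [preimage_add_const_Ioi, sub_self] at h
    exact h.symm
  have h2 : ∫ t in Ioi (0 : ℝ), exp (-(t + a) ^ 2) ≤
      ∫ t in Ioi (0 : ℝ), exp (-a ^ 2) * exp (-t ^ 2) := by
    refine setIntegral_mono_on ?_ (integrable_exp_neg_sq.const_mul _).integrableOn measurableSet_Ioi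
      fun t ht => ?_
    · exact (integrable_exp_neg_sq.comp_add_right a).integrableOn
    · rw [← exp_add]
      gcongr
      have : (0:ℝ) < t := ht
      nlinarith [mul_nonneg this.le ha]
  rw [integral_const_mul] at h2
  have h3 := erfc_zero
  rw [erfc] at h3
  rw [erfc, h1]
  calc _ ≤ 2 / √π * (exp (-a ^ 2) * ∫ t in Ioi (0 : ℝ), exp (-t ^ 2)) := by gcongr
    _ = exp (-a ^ 2) * (2 / √π * ∫ t in Ioi (0 : ℝ), exp (-t ^ 2)) := by ring
    _ = _ := by rw [h3, mul_one]

/-! ### Building blocks of the expansion -/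

/-- A power of `s` times a power of `r / s` times the Gaussian of `r / s`. -/
def gaussBlock (m j : ℕ) (r s : ℝ) : ℝ := s ^ m * (r / s) ^ j * exp (-(r / s) ^ 2 / 4)

/-- A power of `s` times the same power of `r / s` times `erfc (r / (2 s))`. -/
def erfcBlock (n : ℕ) (r s : ℝ) : ℝ := s ^ n * (r / s) ^ n * erfc (r / s / 2)

lemma hasDerivAt_const_div (r : ℝ) {s : ℝ} (hs : 0 < s) :
    HasDerivAt (fun s : ℝ => r / s) (-(r / s) / s) s := by
  have := ((hasDerivAt_inv hs.ne').const_mul r).congr_deriv (g' := -(r / s) / s) (by field_simp)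
  simpa only [div_eq_mul_inv] using this

lemma hasDerivAt_gaussBlock (m j : ℕ) (r : ℝ) {s : ℝ} (hs : 0 < s) :
    HasDerivAt (gaussBlock m j r)
      (s ^ m * (r / s) ^ j * exp (-(r / s) ^ 2 / 4) / s * (m - j + (r / s) ^ 2 / 2)) s := by
  have hc := hasDerivAt_const_div r hs
  have he : HasDerivAt (fun s => exp (-(r / s) ^ 2 / 4))
      (exp (-(r / s) ^ 2 / 4) * ((r / s) ^ 2 / (2 * s))) s := by
    have := ((hc.pow 2).neg.div_const 4).exp
    refine this.congr_deriv ?_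
    simp only [Pi.neg_apply, Pi.pow_apply]
    norm_num
    field_simp
    ring
  have h := ((hasDerivAt_pow m s).mul (hc.pow j)).mul he
  refine h.congr_deriv ?_
  simp only [Pi.mul_apply, Pi.pow_apply]
  generalize r / s = c
  -- The exponents m - 1 and j - 1 from the power rule are truncated at zero, so those cases are
  -- treated separately.
  rcases m with _ | m <;> rcases j with _ | j <;> simp <;> field_simp <;> ring

/-- The product s^n (r/s)^n is the constant r^n, so only erfc is differentiated and the derivative
contains no erfc. This is why erfc occurs only with equal powers of s and r/s, and why the model is
free of it. -/
lemma hasDerivAt_erfcBlock (n : ℕ) (r : ℝ) {s : ℝ} (hs : 0 < s) :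
    HasDerivAt (erfcBlock n r)
      (s ^ n * (r / s) ^ n * (r / s) / s * (exp (-(r / s) ^ 2 / 4) / √π)) s := by
  have hc := hasDerivAt_const_div r hs
  have h1 := ((hasDerivAt_erfc (r / s / 2)).comp s (hc.div_const 2)).const_mul (r ^ n)
  have h2 := h1.congr_of_eventuallyEq (f₁ := erfcBlock n r) (by
    filter_upwards [lt_mem_nhds hs] with x hx
    simp only [erfcBlock, Function.comp_apply]
    rw [← mul_pow, mul_div_cancel₀ _ (ne_of_gt hx)])
  refine h2.congr_deriv ?_
  rw [← mul_pow, mul_div_cancel₀ _ hs.ne', show -(r / s / 2) ^ 2 = -(r / s) ^ 2 / 4 by ring]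
  ring

lemma tendsto_gaussBlock {m : ℕ} (hm : m ≠ 0) (j : ℕ) (r : ℝ) :
    Tendsto (gaussBlock m j r) (𝓝[>] 0) (𝓝 0) := by
  obtain ⟨M, hM0, hM⟩ := exists_one_add_abs_pow_mul_exp_le j (b := 1 / 4) (by norm_num)
  have h1 : Tendsto (fun s : ℝ => s ^ m * M) (𝓝[>] 0) (𝓝 0) := by
    have : Continuous fun s : ℝ => s ^ m * M := by fun_prop
    have := this.tendsto 0
    simp only [zero_pow hm, zero_mul] at this
    exact this.mono_left nhdsWithin_le_nhds
  refine squeeze_zero_norm' ?_ h1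
  filter_upwards [self_mem_nhdsWithin] with s hs
  have hs : 0 < s := hs
  rw [gaussBlock, mul_assoc, norm_mul, norm_mul, norm_pow, norm_pow, Real.norm_of_nonneg hs.le,
    Real.norm_of_nonneg (exp_pos _).le, Real.norm_eq_abs]
  gcongr
  refine le_trans ?_ (hM (r / s))
  rw [show -(r / s) ^ 2 / 4 = -(1 / 4 * (r / s) ^ 2) by ring]
  gcongr
  linarith

lemma erfcBlock_le (n : ℕ) {r s : ℝ} (hr : 0 ≤ r) (hs : 0 < s) :
    |erfcBlock n r s| ≤ |gaussBlock n n r s| := by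
  rw [erfcBlock, gaussBlock, abs_mul, abs_mul _ (exp _), abs_of_nonneg (erfc_nonneg _),
    abs_of_pos (exp_pos _)]
  gcongr
  refine (erfc_le (by positivity)).trans_eq ?_
  congr 1; ring

lemma tendsto_erfcBlock {n : ℕ} (hn : n ≠ 0) {r : ℝ} (hr : 0 ≤ r) :
    Tendsto (erfcBlock n r) (𝓝[>] 0) (𝓝 0) := by
  have h := (tendsto_gaussBlock hn n r).abs
  rw [abs_zero] at h
  refine squeeze_zero_norm' ?_ h
  filter_upwards [self_mem_nhdsWithin] with s hs
  exact erfcBlock_le n hr hs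

/-- Positivity of r is essential: at r = 0 this block is constantly one. This is the source of the
jump. -/
lemma tendsto_erfcBlock_zero {r : ℝ} (hr : 0 < r) :
    Tendsto (erfcBlock 0 r) (𝓝[>] 0) (𝓝 0) := by
  have h := ((tendsto_gaussBlock one_ne_zero 1 r).div_const r).abs
  rw [zero_div, abs_zero] at h
  refine squeeze_zero_norm' ?_ h
  filter_upwards [self_mem_nhdsWithin] with s hs
  have hs : 0 < s := hs
  refine (erfcBlock_le 0 hr.le hs).trans_eq ?_
  rw [gaussBlock, gaussBlock]
  congr 1
  field_simp

/-! ### The expansion as a time integral of the model -/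

/-- The expansion at the time `s ^ 2`, as a combination of elementary blocks. -/
def blockExpansion (J : ArcJet) (σ r s : ℝ) : ℝ :=
  σ * (J.m₀ / 2) * erfcBlock 0 r s + J.κ * J.m₀ / (2 * √π) * gaussBlock 1 0 r s
  + σ * ((3 * J.κ ^ 2 * J.m₀ / 8 + J.m₂ / 2) / √π) * gaussBlock 2 1 r s
  + σ * (-(J.m₂ / 4)) * erfcBlock 2 r s
  + (5 * J.κ ^ 3 * J.m₀ / 16 + J.κ * J.m₂ / 2 + J.k₃ * J.m₁ / 6) / √π * gaussBlock 3 2 r s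
  + (-(5 * J.κ ^ 3 * J.m₀ / 8) + J.k₄ * J.m₀ / 4 + J.κ * J.m₂ / 2 + 2 * J.k₃ * J.m₁ / 3) / √π
      * gaussBlock 3 0 r s
  + (-(J.κ * J.m₂ / 4) - J.k₃ * J.m₁ / 12) * erfcBlock 3 r s
  + σ * ((35 * J.κ ^ 4 * J.m₀ / 128 + 5 * J.κ ^ 2 * J.m₂ / 8 + 5 * J.κ * J.k₃ * J.m₁ / 12
      - J.m₄ / 24) / √π) * gaussBlock 4 3 r s
  + σ * ((-(210 * J.κ ^ 4 * J.m₀ / 128) + 5 * J.k₃ ^ 2 * J.m₀ / 12 + 5 * J.κ * J.k₄ * J.m₀ / 8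
      + 5 * J.κ ^ 2 * J.m₂ / 8 + 5 * J.κ * J.k₃ * J.m₁ / 3 + J.m₄ / 12) / √π) * gaussBlock 4 1 r s
  + σ * (-(5 * J.κ ^ 2 * J.m₂ / 16) - 5 * J.κ * J.k₃ * J.m₁ / 24 + J.m₄ / 48) * erfcBlock 4 r s

lemma sqrt_rpow_three {δ : ℝ} (hδ : 0 < δ) : δ ^ (3 / 2 : ℝ) = √δ ^ 3 := by
  rw [sqrt_eq_rpow, ← rpow_natCast, ← rpow_mul hδ.le]; norm_num

lemma doubleLayerExpansion_eq (J : ArcJet) (σ r : ℝ) {δ : ℝ} (hδ : 0 < δ) :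
    doubleLayerExpansion δ σ (r / √δ) J.κ J.k₃ J.k₄ J.m₀ J.m₁ J.m₂ J.m₄
      = blockExpansion J σ r √δ := by
  have h2 : δ = √δ ^ 2 := (sq_sqrt hδ.le).symm
  have h4 : δ ^ 2 = √δ ^ 4 := by nth_rewrite 1 [h2]; ring
  have hs : √δ ≠ 0 := by positivity
  have hp : √π ≠ 0 := by positivity
  rw [doubleLayerExpansion, sqrt_rpow_three hδ, h4]
  simp only [blockExpansion, gaussBlock, erfcBlock]
  generalize r / √δ = c
  generalize √δ = s at *
  subst h2
  generalize exp (-c ^ 2 / 4) = E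
  generalize erfc (c / 2) = R
  field_simp
  ring

/-- The explicit coefficients are verified here by differentiation. The factor 2s is dt/ds for t =
s². The sign enters the model through odd powers of σ r only, since even powers of σ drop out when
σ² = 1 or r = 0. -/
lemma hasDerivAt_blockExpansion (J : ArcJet) {σ r s : ℝ} (hs : 0 < s)
    (hσ : r = 0 ∨ σ ^ 2 = 1) :
    HasDerivAt (blockExpansion J σ r) (2 * s * J.model s (σ * r)) s := by
  have G := fun m j => hasDerivAt_gaussBlock m j r hs
  have R := fun n => hasDerivAt_erfcBlock n r hs
  have h := (((((((((((R 0).const_mul (σ * (J.m₀ / 2))).add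
    ((G 1 0).const_mul (J.κ * J.m₀ / (2 * √π)))).add
    ((G 2 1).const_mul (σ * ((3 * J.κ ^ 2 * J.m₀ / 8 + J.m₂ / 2) / √π)))).add
    ((R 2).const_mul (σ * (-(J.m₂ / 4))))).add
    ((G 3 2).const_mul ((5 * J.κ ^ 3 * J.m₀ / 16 + J.κ * J.m₂ / 2 + J.k₃ * J.m₁ / 6) / √π))).add
    ((G 3 0).const_mul ((-(5 * J.κ ^ 3 * J.m₀ / 8) + J.k₄ * J.m₀ / 4 + J.κ * J.m₂ / 2
      + 2 * J.k₃ * J.m₁ / 3) / √π))).add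
    ((R 3).const_mul (-(J.κ * J.m₂ / 4) - J.k₃ * J.m₁ / 12))).add
    ((G 4 3).const_mul (σ * ((35 * J.κ ^ 4 * J.m₀ / 128 + 5 * J.κ ^ 2 * J.m₂ / 8
      + 5 * J.κ * J.k₃ * J.m₁ / 12 - J.m₄ / 24) / √π)))).add
    ((G 4 1).const_mul (σ * ((-(210 * J.κ ^ 4 * J.m₀ / 128) + 5 * J.k₃ ^ 2 * J.m₀ / 12
      + 5 * J.κ * J.k₄ * J.m₀ / 8 + 5 * J.κ ^ 2 * J.m₂ / 8 + 5 * J.κ * J.k₃ * J.m₁ / 3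
      + J.m₄ / 12) / √π)))).add
    ((R 4).const_mul (σ * (-(5 * J.κ ^ 2 * J.m₂ / 16) - 5 * J.κ * J.k₃ * J.m₁ / 24 + J.m₄ / 48))))
  refine HasDerivAt.congr_deriv h ?_
  have hp : √π ≠ 0 := by positivity
  have hπ : √π ^ 2 = π := sq_sqrt pi_pos.le
  rw [ArcJet.model_eq, mul_div_assoc σ r s]
  have hσc : r / s = 0 ∨ σ ^ 2 = 1 := by
    rcases hσ with h | h
    · left; rw [h, zero_div]
    · right; exact h
  have hexp : exp (-(1 / 4 * (σ * (r / s)) ^ 2)) = exp (-(r / s) ^ 2 / 4) := by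
    congr 1
    rcases hσc with h | h
    · rw [h]; ring
    · rw [mul_pow, h]; ring
  rw [hexp, ArcJet.p₁, ArcJet.p₂, ArcJet.p₃, ArcJet.p₄]
  generalize r / s = c at *
  generalize exp (-c ^ 2 / 4) = E
  have e2 : (σ * c) ^ 2 = c ^ 2 := by
    rcases hσc with h | h
    · rw [h]; ring
    · rw [mul_pow, h]; ring
  have e3 : (σ * c) ^ 3 = σ * c ^ 3 := by rw [pow_succ, e2]; ring
  have e4 : (σ * c) ^ 4 = c ^ 4 := by rw [show (σ * c) ^ 4 = ((σ * c) ^ 2) ^ 2 by ring, e2]; ring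
  have e5 : (σ * c) ^ 5 = σ * c ^ 5 := by rw [pow_succ, e4]; ring
  rw [e2, e3, e4, e5]
  push_cast
  field_simp
  ring

/-- Every block carries a positive power of s except the leading erfc. That one decays for r > 0,
and for r = 0 its coefficient σ must vanish. -/
lemma tendsto_blockExpansion (J : ArcJet) {σ r : ℝ} (hr : 0 ≤ r) (hσ : r = 0 → σ = 0) :
    Tendsto (blockExpansion J σ r) (𝓝[>] 0) (𝓝 0) := by
  have h0 : Tendsto (fun s => σ * (J.m₀ / 2) * erfcBlock 0 r s) (𝓝[>] 0) (𝓝 0) := by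
    rcases hr.eq_or_lt with h | h
    · simp [hσ h.symm]
    · simpa using (tendsto_erfcBlock_zero h).const_mul (σ * (J.m₀ / 2))
  have G : ∀ (m j : ℕ), m ≠ 0 → ∀ k : ℝ, Tendsto (fun s => k * gaussBlock m j r s) (𝓝[>] 0) (𝓝 0) :=
    fun m j hm k => by simpa using (tendsto_gaussBlock hm j r).const_mul k
  have R : ∀ (n : ℕ), n ≠ 0 → ∀ k : ℝ, Tendsto (fun s => k * erfcBlock n r s) (𝓝[>] 0) (𝓝 0) :=
    fun n hn k => by simpa using (tendsto_erfcBlock hn hr).const_mul k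
  have h : Tendsto (blockExpansion J σ r) (𝓝[>] 0) (𝓝 (0 + 0 + 0 + 0 + 0 + 0 + 0 + 0 + 0 + 0)) :=
    ((((((((h0.add (G 1 0 (by norm_num) _)).add (G 2 1 (by norm_num) _)).add
    (R 2 (by norm_num) _)).add (G 3 2 (by norm_num) _)).add (G 3 0 (by norm_num) _)).add
    (R 3 (by norm_num) _)).add (G 4 3 (by norm_num) _)).add (G 4 1 (by norm_num) _)).add
    (R 4 (by norm_num) _)
  simpa only [add_zero] using h

lemma ArcJet.continuousOn_model (J : ArcJet) (ρ : ℝ) :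
    ContinuousOn (fun s => J.model s ρ) (Ioi 0) := by
  intro s hs
  have hs : s ≠ 0 := (ne_of_gt hs)
  have hp : √π * s ^ 2 ≠ 0 := by positivity
  refine ContinuousAt.continuousWithinAt ?_
  unfold ArcJet.model ArcJet.q₂ ArcJet.q₄ ArcJet.q₆ ArcJet.q₈
  fun_prop (disch := assumption)

lemma ArcJet.continuous_model (J : ArcJet) (s : ℝ) : Continuous (fun ρ => J.model s ρ) := by
  unfold ArcJet.model ArcJet.q₂ ArcJet.q₄ ArcJet.q₆ ArcJet.q₈
  fun_prop

lemma ArcJet.exists_boundedBy (J : ArcJet) : ∃ C, 1 ≤ C ∧ J.BoundedBy C := by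
  have h := fun x : ℝ => abs_nonneg x
  refine ⟨1 + |J.κ| + |J.k₃| + |J.k₄| + |J.k₅| + |J.m₀| + |J.m₁| + |J.m₂| + |J.m₃| + |J.m₄|, ?_,
    ?_, ?_, ?_, ?_, ?_, ?_, ?_, ?_, ?_⟩ <;>
  linarith [h J.κ, h J.k₃, h J.k₄, h J.k₅, h J.m₀, h J.m₁, h J.m₂, h J.m₃, h J.m₄]

lemma intervalIntegrable_inv_sqrt (δ : ℝ) :
    IntervalIntegrable (fun t : ℝ => t ^ (-(1 / 2) : ℝ)) volume 0 δ :=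
  intervalIntegral.intervalIntegrable_rpow' (by norm_num)

/-- For fixed ρ the singularity at t = 0 is at most t^(-1/2): one further power of |ρ|/s from the
Gaussian gains a factor s/|ρ|. The bound degenerates as ρ → 0, so it serves for integrability only,
not for uniform limits. -/
lemma ArcJet.intervalIntegrable_model (J : ArcJet) (ρ : ℝ) {δ : ℝ} (hδ : 0 < δ) :
    IntervalIntegrable (fun t => J.model √t ρ) volume 0 δ := by
  obtain ⟨C, hC, hJ⟩ := J.exists_boundedBy
  obtain ⟨K, n, hK, h⟩ := ArcJet.exists_model_bound hC
  obtain ⟨M, hM0, hM⟩ := exists_one_add_abs_pow_mul_exp_le (n + 2) (b := 1 / 4) (by norm_num)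
  set D := K * M * (1 / |ρ| + 1 + √δ ^ 3) with hD
  rw [intervalIntegrable_iff_integrableOn_Ioc_of_le hδ.le]
  have hi := (intervalIntegrable_iff_integrableOn_Ioc_of_le hδ.le).1
    ((intervalIntegrable_inv_sqrt δ).const_mul D)
  refine Integrable.mono' hi ?_ ?_
  · refine ContinuousOn.aestronglyMeasurable ?_ measurableSet_Ioc
    exact (J.continuousOn_model ρ).comp (by fun_prop) fun t ht => sqrt_pos.2 ht.1
  · refine (ae_restrict_iff' measurableSet_Ioc).2 (Eventually.of_forall fun t ht => ?_)
    have ht0 : 0 < t := ht.1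
    have hs : 0 < √t := sqrt_pos.2 ht0
    have hsδ : √t ≤ √δ := sqrt_le_sqrt ht.2
    have e : t ^ (-(1 / 2) : ℝ) = 1 / √t := by
      rw [rpow_neg ht0.le, ← sqrt_eq_rpow, one_div]
    rw [e, Real.norm_eq_abs]
    refine (h J hJ √t ρ hs).trans ?_
    generalize √t = s at *
    have hMw := hM (ρ / s)
    -- At ρ = 0 both sides are zero under the convention 1 / 0 = 0.
    have hw : |ρ / s| / s ^ 2 ≤ (1 + |ρ / s|) ^ 2 * (1 / |ρ|) * (1 / s) := by
      rcases eq_or_ne ρ 0 with h0 | h0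
      · simp [h0]
      · have hρ0 : 0 < |ρ| := abs_pos.2 h0
        have : |ρ / s| / s ^ 2 = |ρ / s| ^ 2 * (1 / |ρ|) * (1 / s) := by
          rw [abs_div, abs_of_pos hs]; field_simp
        rw [this]
        gcongr
        linarith
    have h1 : (1:ℝ) ≤ (1 + |ρ / s|) ^ 2 := one_le_pow₀ (by linarith [abs_nonneg (ρ / s)])
    have hsum : (|ρ / s| + s + s ^ 4) / s ^ 2 ≤
        (1 + |ρ / s|) ^ 2 * ((1 / |ρ| + 1 + √δ ^ 3) * (1 / s)) := by
      have e1 : (|ρ / s| + s + s ^ 4) / s ^ 2 = |ρ / s| / s ^ 2 + 1 * ((1 + s ^ 3) * (1 / s)) := by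
        field_simp
        ring
      rw [e1]
      calc _ ≤ (1 + |ρ / s|) ^ 2 * (1 / |ρ|) * (1 / s)
            + (1 + |ρ / s|) ^ 2 * ((1 + √δ ^ 3) * (1 / s)) := by gcongr
        _ = _ := by ring
    calc _ ≤ K * ((1 + |ρ / s|) ^ n * exp (-(1 / 4 * (ρ / s) ^ 2))) *
          ((1 + |ρ / s|) ^ 2 * ((1 / |ρ| + 1 + √δ ^ 3) * (1 / s))) := by gcongr
      _ = K * ((1 + |ρ / s|) ^ (n + 2) * exp (-(1 / 4 * (ρ / s) ^ 2))) *
          ((1 / |ρ| + 1 + √δ ^ 3) * (1 / s)) := by rw [pow_add]; ring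
      _ ≤ K * M * ((1 / |ρ| + 1 + √δ ^ 3) * (1 / s)) := by gcongr
      _ = _ := by rw [hD]; ring

/-- The time integral of the model is the explicit expansion. -/
lemma ArcJet.integral_model (J : ArcJet) {σ r δ : ℝ} (hδ : 0 < δ) (hr : 0 ≤ r)
    (hσ : (r = 0 ∧ σ = 0) ∨ (r ≠ 0 ∧ σ ^ 2 = 1)) :
    ∫ t in (0 : ℝ)..δ, J.model √t (σ * r) =
      doubleLayerExpansion δ σ (r / √δ) J.κ J.k₃ J.k₄ J.m₀ J.m₁ J.m₂ J.m₄ := by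
  have hσ1 : r = 0 ∨ σ ^ 2 = 1 := hσ.imp And.left And.right
  have hσ2 : r = 0 → σ = 0 := fun h => by
    rcases hσ with h' | h'
    · exact h'.2
    · exact absurd h h'.1
  have hder : ∀ t, 0 < t → HasDerivAt (fun t => blockExpansion J σ r √t)
      (J.model √t (σ * r)) t := by
    intro t ht
    have hs : 0 < √t := sqrt_pos.2 ht
    have h := (hasDerivAt_blockExpansion J hs hσ1).comp t (Real.hasDerivAt_sqrt ht.ne')
    refine h.congr_deriv ?_
    field_simp
  have hsqrt : Tendsto (fun t : ℝ => √t) (𝓝[>] 0) (𝓝[>] 0) := by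
    refine tendsto_nhdsWithin_iff.2 ⟨?_, ?_⟩
    · have := Real.continuous_sqrt.tendsto 0
      rw [sqrt_zero] at this
      exact this.mono_left nhdsWithin_le_nhds
    · filter_upwards [self_mem_nhdsWithin] with t ht using sqrt_pos.2 ht
  -- The antiderivative is differentiable only for positive times, so its one-sided limit at zero
  -- replaces a value there.
  rw [intervalIntegral.integral_eq_sub_of_hasDerivAt_of_tendsto hδ (fun t ht => hder t ht.1)
    (J.intervalIntegrable_model _ hδ) ((tendsto_blockExpansion J hr hσ2).comp hsqrt)
    ((hder δ hδ).continuousAt.tendsto.mono_left nhdsWithin_le_nhds), sub_zero,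
    doubleLayerExpansion_eq J σ r hδ]

/-- The jump of the expansion across the boundary. -/
lemma tendsto_doubleLayerExpansion (δ σ κ k₃ k₄ m₀ m₁ m₂ m₄ : ℝ) :
    Tendsto (fun r : ℝ => doubleLayerExpansion δ σ (r / √δ) κ k₃ k₄ m₀ m₁ m₂ m₄) (𝓝[>] 0)
      (𝓝 (doubleLayerExpansion δ 0 0 κ k₃ k₄ m₀ m₁ m₂ m₄ + σ * (m₀ / 2))) := by
  have hc : Continuous fun r : ℝ => doubleLayerExpansion δ σ (r / √δ) κ k₃ k₄ m₀ m₁ m₂ m₄ := by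
    have h := continuous_erfc
    unfold doubleLayerExpansion
    have : Continuous fun r : ℝ => erfc (r / √δ / 2) := h.comp (by fun_prop)
    fun_prop
  have h := (hc.tendsto 0).mono_left (nhdsWithin_le_nhds (s := Ioi 0))
  convert h using 2
  simp only [doubleLayerExpansion, zero_div, erfc_zero]
  simp
  ring

/-! ### Plane geometry -/

/-- The rotation by a right angle that takes the unit tangent to the unit normal. -/
def rot (v : Plane) : Plane := !₂[v 1, -v 0]

@[simp] lemma rot_zero_apply (v : Plane) : rot v 0 = v 1 := rfl
@[simp] lemma rot_one_apply (v : Plane) : rot v 1 = -v 0 := rfl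

lemma inner_plane (v w : Plane) : inner ℝ v w = v 0 * w 0 + v 1 * w 1 := by
  simp [PiLp.inner_apply, Fin.sum_univ_two, mul_comm]

lemma norm_sq_plane (v : Plane) : ‖v‖ ^ 2 = v 0 ^ 2 + v 1 ^ 2 := by
  rw [← real_inner_self_eq_norm_sq, inner_plane]; ring

lemma norm_rot (v : Plane) : ‖rot v‖ = ‖v‖ := by
  rw [← sq_eq_sq₀ (norm_nonneg _) (norm_nonneg _), norm_sq_plane, norm_sq_plane]
  simp; ring

lemma inner_rot_self (v : Plane) : inner ℝ v (rot v) = 0 := by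
  rw [inner_plane]; simp; ring

lemma rot_smul (c : ℝ) (v : Plane) : rot (c • v) = c • rot v := by
  ext i; fin_cases i <;> simp [rot]

lemma unitNormal_eq (z : ℝ → Plane) (s : ℝ) : unitNormal z s = rot (unitTangent z s) := rfl

/-- Decomposition along an orthonormal frame. -/
lemma eq_inner_smul_add {τ : Plane} (hτ : ‖τ‖ = 1) (v : Plane) :
    v = inner ℝ v τ • τ + inner ℝ v (rot τ) • rot τ := by
  have h := norm_sq_plane τ
  rw [hτ] at h
  ext i
  fin_cases i
  · simp [inner_plane]; linear_combination (v 0) * h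
  · simp [inner_plane]; linear_combination (v 1) * h

lemma norm_sq_sub_frame {τ : Plane} (hτ : ‖τ‖ = 1) (ρ : ℝ) (v : Plane) :
    ‖ρ • rot τ - v‖ ^ 2 = inner ℝ v τ ^ 2 + (ρ - inner ℝ v (rot τ)) ^ 2 := by
  have h := norm_sq_plane τ
  rw [hτ] at h
  rw [norm_sq_plane]
  simp [inner_plane]
  linear_combination (v 0 ^ 2 + v 1 ^ 2 - ρ ^ 2) * h

lemma inner_sub_frame {τ : Plane} (hτ : ‖τ‖ = 1) (ρ : ℝ) (v d : Plane) :
    inner ℝ (ρ • rot τ - v) (rot d) =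
      (ρ - inner ℝ v (rot τ)) * inner ℝ d τ + inner ℝ v τ * inner ℝ d (rot τ) := by
  have h := norm_sq_plane τ
  rw [hτ] at h
  simp [inner_plane]
  linear_combination (-v 0 * d 1 + v 1 * d 0) * h

lemma norm_unitTangent {z : ℝ → Plane} {s : ℝ} (h : deriv z s ≠ 0) : ‖unitTangent z s‖ = 1 := by
  rw [unitTangent, norm_smul, norm_inv, norm_norm, inv_mul_cancel₀ (norm_ne_zero_iff.2 h)]

lemma norm_unitNormal {z : ℝ → Plane} {s : ℝ} (h : deriv z s ≠ 0) : ‖unitNormal z s‖ = 1 := by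
  rw [unitNormal_eq, norm_rot, norm_unitTangent h]

lemma norm_smul_unitNormal {z : ℝ → Plane} {s : ℝ} (h : deriv z s ≠ 0) :
    ‖deriv z s‖ • unitNormal z s = rot (deriv z s) := by
  rw [unitNormal_eq, unitTangent, rot_smul, smul_smul, mul_inv_cancel₀ (norm_ne_zero_iff.2 h),
    one_smul]

/-! ### The kernel of the double layer potential -/

/-- The kernel of the double layer heat potential along a parametrized curve. -/
def layerKernel (z : ℝ → Plane) (μ : Plane → ℝ) (x : Plane) (t s : ℝ) : ℝ :=
  inner ℝ (x - z s) (rot (deriv z s)) * μ (z s) / (8 * π * t ^ 2) *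
    exp (-‖x - z s‖ ^ 2 / (4 * t))

lemma fderiv_heatKernel {t : ℝ} (ht : 0 < t) (x p v : Plane) :
    fderiv ℝ (fun x' => heatKernel t (x - x')) p v =
      inner ℝ (x - p) v / (8 * π * t ^ 2) * exp (-‖x - p‖ ^ 2 / (4 * t)) := by
  have h1 : HasFDerivAt (fun x' : Plane => x - x') (-(ContinuousLinearMap.id ℝ Plane)) p := by
    simpa using (hasFDerivAt_id p).const_sub x
  have h2 := (((h1.norm_sq.neg.mul_const (4 * t)⁻¹).exp).mul_const (4 * π * t)⁻¹)
  have h3 := h2.congr_of_eventuallyEq (f₁ := fun x' => heatKernel t (x - x'))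
    (Eventually.of_forall fun y => by simp [heatKernel, div_eq_mul_inv])
  rw [h3.fderiv]
  have hp : π ≠ 0 := pi_ne_zero
  simp [div_eq_mul_inv, inner_sub_left]
  field_simp
  ring

lemma doubleLayerAt_eq {ι : Type*} [Fintype ι] {z : ι → ℝ → Plane}
    (hz : ∀ i s, deriv (z i) s ≠ 0) (μ : Plane → ℝ) (x : Plane) {t : ℝ} (ht : 0 < t) :
    doubleLayerAt z μ x t = ∑ i, ∫ s in (0 : ℝ)..1, layerKernel (z i) μ x t s := by
  unfold doubleLayerAt
  refine Finset.sum_congr rfl fun i _ => intervalIntegral.integral_congr fun s _ => ?_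
  simp only [layerKernel]
  rw [fderiv_heatKernel ht, ← norm_smul_unitNormal (hz i s), inner_smul_right]
  ring

/-- The kernel is negligible away from its singularity and for large times. -/
lemma exists_layerKernel_le {d : ℝ} (hd : 0 < d) : ∃ K : ℝ, 0 ≤ K ∧
    ∀ (z : ℝ → Plane) (μ : Plane → ℝ) (x : Plane) (s u : ℝ), 0 < s →
      (d ≤ ‖x - z u‖ ∨ 1 ≤ s) →
      |layerKernel z μ x (s ^ 2) u| ≤ K * (‖deriv z u‖ * |μ (z u)|) * s ^ 3 := by
  -- One power of 1 + D/s bounds the factor D/s coming from the inner product, and six turn s⁻³ into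
  -- s³ when D ≥ d.
  obtain ⟨M, hM0, hM⟩ := exists_one_add_abs_pow_mul_exp_le 7 (b := 1 / 4) (by norm_num)
  refine ⟨(1 + 1 / d ^ 6) * M, by positivity, fun z μ x s u hs hor => ?_⟩
  have hN0 : 0 ≤ ‖deriv z u‖ * |μ (z u)| := by positivity
  have hcs : |inner ℝ (x - z u) (rot (deriv z u))| ≤ ‖x - z u‖ * ‖deriv z u‖ := by
    have := abs_real_inner_le_norm (x - z u) (rot (deriv z u))
    rwa [norm_rot] at this
  set D := ‖x - z u‖ with hD
  have hD0 : 0 ≤ D := norm_nonneg _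
  have hMw := hM (D / s)
  have hDs : 0 ≤ D / s := by positivity
  rw [abs_of_nonneg hDs] at hMw
  have hexp : exp (-D ^ 2 / (4 * s ^ 2)) = exp (-(1 / 4 * (D / s) ^ 2)) := by
    congr 1; field_simp
  have h1 : |layerKernel z μ x (s ^ 2) u| ≤
      D * (‖deriv z u‖ * |μ (z u)|) / (8 * π * s ^ 4) * exp (-(1 / 4 * (D / s) ^ 2)) := by
    rw [layerKernel, ← hD, hexp, abs_mul, abs_div, abs_mul, abs_of_pos (exp_pos _),
      abs_of_pos (by positivity : (0:ℝ) < 8 * π * (s ^ 2) ^ 2), ← pow_mul]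
    gcongr ?_ / _ * _
    calc _ ≤ D * ‖deriv z u‖ * |μ (z u)| := by gcongr
      _ = _ := by ring
  have h8 : 1 ≤ 8 * π := by linarith [pi_gt_three]
  have key : D / s ^ 4 ≤ (1 + 1 / d ^ 6) * (1 + D / s) ^ 7 * s ^ 3 := by
    have e1 : 1 ≤ (1 + 1 / d ^ 6) * (1 + D / s) ^ 6 * s ^ 6 := by
      have g1 : 1 ≤ (1 + D / s) ^ 6 := one_le_pow₀ (by linarith)
      have g2 : 0 ≤ 1 / d ^ 6 := by positivity
      rcases hor with h | h
      · have : d ^ 6 ≤ (1 + D / s) ^ 6 * s ^ 6 := by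
          rw [← mul_pow]
          gcongr
          have : (1 + D / s) * s = s + D := by field_simp
          linarith
        have g3 : 1 ≤ 1 / d ^ 6 * ((1 + D / s) ^ 6 * s ^ 6) := by
          rw [div_mul_eq_mul_div, one_mul, one_le_div (by positivity)]; exact this
        have g4 : 0 ≤ (1 + D / s) ^ 6 * s ^ 6 := by positivity
        calc 1 ≤ 1 / d ^ 6 * ((1 + D / s) ^ 6 * s ^ 6) := g3
          _ ≤ (1 + 1 / d ^ 6) * ((1 + D / s) ^ 6 * s ^ 6) := by gcongr; linarith
          _ = _ := by generalize (1 + D / s) ^ 6 = Q; ring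
      · have g5 : 1 ≤ s ^ 6 := one_le_pow₀ h
        have g6 : (1:ℝ) ≤ 1 + 1 / d ^ 6 := by linarith
        calc (1:ℝ) = 1 * 1 * 1 := by ring
          _ ≤ _ := by gcongr
    have e2 : D / s ^ 4 = D / s * s⁻¹ ^ 3 * 1 := by field_simp
    have e3 : (1 + 1 / d ^ 6) * (1 + D / s) ^ 7 * s ^ 3 =
        (1 + D / s) * s⁻¹ ^ 3 * ((1 + 1 / d ^ 6) * (1 + D / s) ^ 6 * s ^ 6) := by
      generalize D / s = q
      generalize 1 / d ^ 6 = T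
      rw [pow_succ (1 + q) 6]
      generalize (1 + q) ^ 6 = Q
      field_simp
    rw [e2, e3]
    gcongr
    linarith
  calc _ ≤ _ := h1
    _ = 1 / (8 * π) * (D / s ^ 4 * ((‖deriv z u‖ * |μ (z u)|) * exp (-(1 / 4 * (D / s) ^ 2)))) := by
      field_simp
    _ ≤ 1 * (((1 + 1 / d ^ 6) * (1 + D / s) ^ 7 * s ^ 3) *
        ((‖deriv z u‖ * |μ (z u)|) * exp (-(1 / 4 * (D / s) ^ 2)))) := by
      gcongr
      rw [div_le_one (by positivity)]; exact h8
    _ = (1 + 1 / d ^ 6) * ((1 + D / s) ^ 7 * exp (-(1 / 4 * (D / s) ^ 2))) *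
        (‖deriv z u‖ * |μ (z u)|) * s ^ 3 := by
      generalize (1 + D / s) ^ 7 = Q; generalize 1 / d ^ 6 = T; ring
    _ ≤ _ := by gcongr

/-- Writing the time as an exponential keeps it positive, so continuity is global and the theorem on
parametric integrals applies without restricting the parameters. -/
lemma continuous_layerKernel {z : ℝ → Plane} {μ : Plane → ℝ} (hz : ContDiff ℝ ∞ z)
    (hμ : Continuous fun s => μ (z s)) :
    Continuous fun p : (Plane × ℝ) × ℝ => layerKernel z μ p.1.1 (exp p.1.2) p.2 := by
  have h0 : Continuous z := hz.continuous
  have h1 : Continuous (deriv z) := hz.continuous_deriv (by simp)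
  have h2 : Continuous rot := by
    have : rot = fun v : Plane => !₂[v 1, -v 0] := rfl
    rw [this]; fun_prop
  have h3 : Continuous fun p : (Plane × ℝ) × ℝ => inner ℝ (p.1.1 - z p.2) (rot (deriv z p.2)) :=
    (by fun_prop : Continuous fun p : (Plane × ℝ) × ℝ => p.1.1 - z p.2).inner
      (h2.comp (h1.comp continuous_snd))
  have h4 : Continuous fun p : (Plane × ℝ) × ℝ => μ (z p.2) := hμ.comp continuous_snd
  unfold layerKernel
  have hp : π ≠ 0 := pi_ne_zero
  refine ((h3.mul h4).div (by fun_prop) fun p => by positivity).mul (continuous_exp.comp ?_)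
  refine Continuous.div (by fun_prop) (by fun_prop) fun p => by positivity

/-- For positive times, the inner integral is a continuous function of the target and of the
logarithm of time. -/
lemma continuous_doubleLayerAt_exp {ι : Type*} [Fintype ι] {z : ι → ℝ → Plane} {μ : Plane → ℝ}
    (hz : ∀ i, ContDiff ℝ ∞ (z i)) (hreg : ∀ i s, deriv (z i) s ≠ 0)
    (hμ : ∀ i, ContDiff ℝ ∞ fun s => μ (z i s)) :
    Continuous fun p : Plane × ℝ => doubleLayerAt z μ p.1 (exp p.2) := by
  have : (fun p : Plane × ℝ => doubleLayerAt z μ p.1 (exp p.2)) =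
      fun p => ∑ i, ∫ s in (0 : ℝ)..1, layerKernel (z i) μ p.1 (exp p.2) s := by
    ext p; exact doubleLayerAt_eq hreg μ p.1 (exp_pos _)
  rw [this]
  refine continuous_finsetSum _ fun i _ => ?_
  exact intervalIntegral.continuous_parametric_intervalIntegral_of_continuous'
    (continuous_layerKernel (hz i) (hμ i).continuous) 0 1

/-! ### Tangential and normal coordinates along a curve -/

/-- Tangential coordinate of `z (s + u)` in the frame at `z s`. -/
def tanCoord (z : ℝ → Plane) (s u : ℝ) : ℝ := inner ℝ (z (s + u) - z s) (unitTangent z s)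

/-- Normal coordinate of `z (s + u)` in the frame at `z s`. -/
def norCoord (z : ℝ → Plane) (s u : ℝ) : ℝ := inner ℝ (z (s + u) - z s) (unitNormal z s)

/-- Derivative of the tangential coordinate. -/
def tanSpeed (z : ℝ → Plane) (s u : ℝ) : ℝ := inner ℝ (deriv z (s + u)) (unitTangent z s)

/-- Parameters `(s, u)` at which the curve is locally a graph over the tangent line at `z s`. -/
def graphDomain (z : ℝ → Plane) : Set (ℝ × ℝ) := {p | 0 < tanSpeed z p.1 p.2}

/-- Differentiation with respect to the tangential coordinate. -/
def graphDeriv (z : ℝ → Plane) (F : ℝ × ℝ → ℝ) (p : ℝ × ℝ) : ℝ :=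
  fderiv ℝ F p (0, 1) / tanSpeed z p.1 p.2

@[simp] lemma tanCoord_zero (z : ℝ → Plane) (s : ℝ) : tanCoord z s 0 = 0 := by simp [tanCoord]

@[simp] lemma norCoord_zero (z : ℝ → Plane) (s : ℝ) : norCoord z s 0 = 0 := by simp [norCoord]

section Coordinates

variable {z : ℝ → Plane}
lemma contDiff_deriv (hz : ContDiff ℝ ∞ z) : ContDiff ℝ ∞ (deriv z) :=
  ((contDiff_succ_iff_deriv (n := ∞)).1 (by simpa using hz)).2.2

lemma contDiff_unitTangent (hz : ContDiff ℝ ∞ z) (hreg : ∀ s, deriv z s ≠ 0) :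
    ContDiff ℝ ∞ (unitTangent z) := by
  have h := contDiff_deriv hz
  unfold unitTangent
  exact ((h.norm ℝ hreg).inv fun s => norm_ne_zero_iff.2 (hreg s)).smul h

lemma contDiff_unitNormal (hz : ContDiff ℝ ∞ z) (hreg : ∀ s, deriv z s ≠ 0) :
    ContDiff ℝ ∞ (unitNormal z) := by
  have h := contDiff_unitTangent hz hreg
  have h2 := contDiff_euclidean.1 h
  refine contDiff_euclidean.2 fun i => ?_
  fin_cases i
  · exact h2 1
  · exact (h2 0).neg

lemma contDiff_tanCoord (hz : ContDiff ℝ ∞ z) (hreg : ∀ s, deriv z s ≠ 0) :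
    ContDiff ℝ ∞ fun p : ℝ × ℝ => tanCoord z p.1 p.2 :=
  ContDiff.inner ℝ ((hz.comp (contDiff_fst.add contDiff_snd)).sub (hz.comp contDiff_fst))
    ((contDiff_unitTangent hz hreg).comp contDiff_fst)

lemma contDiff_norCoord (hz : ContDiff ℝ ∞ z) (hreg : ∀ s, deriv z s ≠ 0) :
    ContDiff ℝ ∞ fun p : ℝ × ℝ => norCoord z p.1 p.2 :=
  ContDiff.inner ℝ ((hz.comp (contDiff_fst.add contDiff_snd)).sub (hz.comp contDiff_fst))
    ((contDiff_unitNormal hz hreg).comp contDiff_fst)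

lemma contDiff_tanSpeed (hz : ContDiff ℝ ∞ z) (hreg : ∀ s, deriv z s ≠ 0) :
    ContDiff ℝ ∞ fun p : ℝ × ℝ => tanSpeed z p.1 p.2 :=
  ContDiff.inner ℝ ((contDiff_deriv hz).comp (contDiff_fst.add contDiff_snd))
    ((contDiff_unitTangent hz hreg).comp contDiff_fst)

lemma isOpen_graphDomain (hz : ContDiff ℝ ∞ z) (hreg : ∀ s, deriv z s ≠ 0) :
    IsOpen (graphDomain z) :=
  isOpen_lt continuous_const (contDiff_tanSpeed hz hreg).continuous

lemma hasDerivAt_inner_sub (hz : ContDiff ℝ ∞ z) (s u : ℝ) (w : Plane) :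
    HasDerivAt (fun u => inner ℝ (z (s + u) - z s) w) (inner ℝ (deriv z (s + u)) w) u := by
  have h1 : HasDerivAt z (deriv z (s + u)) (s + u) :=
    (hz.differentiable (by simp)).differentiableAt.hasDerivAt
  have h2 := ((h1.comp_const_add s u).sub_const (z s)).inner ℝ (hasDerivAt_const u w)
  simpa using h2

lemma hasDerivAt_tanCoord (hz : ContDiff ℝ ∞ z) (s u : ℝ) :
    HasDerivAt (tanCoord z s) (tanSpeed z s u) u :=
  hasDerivAt_inner_sub hz s u _

lemma tanSpeed_zero_pos (hreg : ∀ s, deriv z s ≠ 0) (s : ℝ) : 0 < tanSpeed z s 0 := by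
  rw [tanSpeed, add_zero, unitTangent, inner_smul_right, real_inner_self_eq_norm_sq]
  have := norm_pos_iff.2 (hreg s)
  positivity

/-- Smoothness is joint in the base point s and the parameter u, although only u is differentiated;
compactness then bounds every derivative uniformly in the base point. -/
lemma contDiffOn_iterate (hz : ContDiff ℝ ∞ z) (hreg : ∀ s, deriv z s ≠ 0)
    {F : ℝ × ℝ → ℝ} (hF : ContDiff ℝ ∞ F) (k : ℕ) :
    ContDiffOn ℝ ∞ ((graphDeriv z)^[k] F) (graphDomain z) := by
  induction k with
  | zero => exact hF.contDiffOn
  | succ k ih =>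
    rw [Function.iterate_succ_apply']
    have h1 := ih.fderiv_of_isOpen (isOpen_graphDomain hz hreg) (m := ∞) (by simp)
    exact (h1.clm_apply contDiffOn_const).div (contDiff_tanSpeed hz hreg).contDiffOn
      fun p hp => ne_of_gt hp

/-- Chain rule: d/du is the speed of the tangential coordinate times the derivative in that
coordinate. This is the input for Taylor's formula without inverting the coordinate. -/
lemma hasDerivAt_iterate (hz : ContDiff ℝ ∞ z) (hreg : ∀ s, deriv z s ≠ 0)
    {F : ℝ × ℝ → ℝ} (hF : ContDiff ℝ ∞ F) (k : ℕ) {s u : ℝ}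
    (hu : (s, u) ∈ graphDomain z) :
    HasDerivAt (fun u => (graphDeriv z)^[k] F (s, u))
      (tanSpeed z s u * (graphDeriv z)^[k + 1] F (s, u)) u := by
  have h1 := ((contDiffOn_iterate hz hreg hF k).contDiffAt
    ((isOpen_graphDomain hz hreg).mem_nhds hu)).differentiableAt (by simp)
  have h2 : HasDerivAt (fun u : ℝ => (s, u)) ((0 : ℝ), (1 : ℝ)) u :=
    (hasDerivAt_const u s).prodMk (hasDerivAt_id u)
  have h3 := h1.hasFDerivAt.comp_hasDerivAt u h2
  refine h3.congr_deriv ?_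
  rw [Function.iterate_succ_apply', graphDeriv, mul_div_cancel₀ _ (ne_of_gt hu)]

end Coordinates

/-! ### Taylor expansion in the tangential coordinate. -/

/-- Taylor's formula in a coordinate `X`, for a sequence of successive derivatives with respect
to `X`. -/
lemma abs_sub_taylor_le {F : ℕ → ℝ → ℝ} {X dX : ℝ → ℝ} {u₀ B : ℝ} {N : ℕ} (hX0 : X 0 = 0)
    (hX : ∀ u ∈ Icc (-u₀) u₀, HasDerivAt X (dX u) u)
    (hF : ∀ k, ∀ u ∈ Icc (-u₀) u₀, HasDerivAt (F k) (dX u * F (k + 1) u) u)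
    (hdX : ∀ u ∈ Icc (-u₀) u₀, |dX u| ≤ B)
    (hB : ∀ k ≤ N, ∀ u ∈ Icc (-u₀) u₀, |F k u| ≤ B) (n k : ℕ) (hnk : k + n ≤ N) :
    ∀ u ∈ Icc (-u₀) u₀,
      |F k u - ∑ j ∈ Finset.range n, F (k + j) 0 * X u ^ j / j.factorial| ≤
        B ^ (n + 1) * |u| ^ n := by
  induction n generalizing k with
  | zero => intro u hu; simpa using hB k (by omega) u hu
  | succ n ih =>
    intro u hu
    have hB0 : 0 ≤ B := (abs_nonneg _).trans (hdX u hu)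
    have ih' := ih (k + 1) (by omega)
    have hsub : ∀ v ∈ Icc (-|u|) |u|, v ∈ Icc (-u₀) u₀ := fun v hv => by
      have : |u| ≤ u₀ := abs_le.2 hu
      exact ⟨by linarith [hv.1], by linarith [hv.2]⟩
    -- The remainder of order n + 1 of F k has as derivative dX times the remainder of order n of F
    -- (k + 1), and it vanishes at zero. The mean value inequality closes the induction, each step
    -- adding one factor B |u|.
    have hR : ∀ v ∈ Icc (-|u|) |u|, HasDerivAt
        (fun u => F k u - ∑ j ∈ Finset.range (n + 1), F (k + j) 0 * X u ^ j / j.factorial)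
        (dX v * (F (k + 1) v - ∑ j ∈ Finset.range n, F (k + 1 + j) 0 * X v ^ j / j.factorial)) v := by
      intro v hv
      have h1 := hF k v (hsub v hv)
      have h2 : ∀ j ∈ Finset.range (n + 1), HasDerivAt
          (fun u => F (k + j) 0 * X u ^ j / j.factorial)
          (F (k + j) 0 * (j * X v ^ (j - 1) * dX v) / j.factorial) v := fun j _ =>
        (((hX v (hsub v hv)).pow j).const_mul _).div_const _
      refine (h1.sub (HasDerivAt.fun_sum h2)).congr_deriv ?_
      rw [mul_sub, Finset.sum_range_succ', Finset.mul_sum]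
      simp only [Nat.cast_zero, zero_mul, mul_zero, zero_div, add_zero]
      congr 1
      refine Finset.sum_congr rfl fun j _ => ?_
      rw [Nat.factorial_succ, add_tsub_cancel_right, show k + (j + 1) = k + 1 + j by ring]
      have : (j.factorial : ℝ) ≠ 0 := by positivity
      push_cast
      field_simp
    have hbound : ∀ v ∈ Icc (-|u|) |u|,
        ‖dX v * (F (k + 1) v - ∑ j ∈ Finset.range n, F (k + 1 + j) 0 * X v ^ j / j.factorial)‖
          ≤ B ^ (n + 2) * |u| ^ n := by
      intro v hv
      rw [norm_mul, Real.norm_eq_abs, Real.norm_eq_abs]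
      have hvu : |v| ≤ |u| := abs_le.2 hv
      calc _ ≤ B * (B ^ (n + 1) * |v| ^ n) :=
            mul_le_mul (hdX v (hsub v hv)) (ih' v (hsub v hv)) (abs_nonneg _) hB0
        _ ≤ B * (B ^ (n + 1) * |u| ^ n) := by gcongr
        _ = _ := by ring
    have h0 : (fun u => F k u - ∑ j ∈ Finset.range (n + 1), F (k + j) 0 * X u ^ j / j.factorial) 0
        = 0 := by
      simp [Finset.sum_range_succ', hX0]
    have key := (convex_Icc (-|u|) |u|).norm_image_sub_le_of_norm_hasDerivWithin_le
      (fun v hv => (hR v hv).hasDerivWithinAt) hbound (x := 0) (y := u) (by simp)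
      (by simp [le_abs_self, neg_le, neg_le_abs u])
    beta_reduce at h0 key
    rw [h0, sub_zero, sub_zero, Real.norm_eq_abs, Real.norm_eq_abs] at key
    exact key.trans_eq (by ring)

/-- If a function of the tangential coordinate represents `F` near `z s`, then its derivatives
are given by iterating `graphDeriv`. -/
lemma iterate_graphDeriv_eq {z : ℝ → Plane} (hz : ContDiff ℝ ∞ z) (hreg : ∀ s, deriv z s ≠ 0)
    {F : ℝ × ℝ → ℝ} (hF : ContDiff ℝ ∞ F) {s : ℝ} {γ : ℝ → ℝ} (hγ : ContDiffAt ℝ ∞ γ 0)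
    (h : ∀ᶠ u in 𝓝 (0 : ℝ), γ (tanCoord z s u) = F (s, u)) (k : ℕ) :
    (graphDeriv z)^[k] F (s, 0) = iteratedDeriv k γ 0 := by
  have hXt : Tendsto (tanCoord z s) (𝓝 0) (𝓝 0) := by
    have := (hasDerivAt_tanCoord hz s 0).continuousAt.tendsto
    rwa [tanCoord_zero] at this
  have hdom : ∀ᶠ u in 𝓝 (0 : ℝ), (s, u) ∈ graphDomain z := by
    have hc : ContinuousAt (fun u : ℝ => (s, u)) 0 := by fun_prop
    exact hc.eventually_mem ((isOpen_graphDomain hz hreg).mem_nhds (tanSpeed_zero_pos hreg s))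
  -- The equality is proved on a neighbourhood, not only at zero, so that it can be differentiated
  -- again.
  have key : ∀ k, ∀ᶠ u in 𝓝 (0 : ℝ),
      iteratedDeriv k γ (tanCoord z s u) = (graphDeriv z)^[k] F (s, u) := by
    intro k
    induction k with
    | zero => simpa using h
    | succ k ih =>
      -- Smoothness at zero supplies a neighbourhood for each finite order separately, and order k +
      -- 1 suffices here.
      have hsm : ∀ᶠ y in 𝓝 (0 : ℝ), ContDiffAt ℝ ((k + 1 : ℕ) : WithTop ℕ∞) γ y :=
        (hγ.of_le (by exact_mod_cast le_top)).eventually (by simp)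
      filter_upwards [ih.eventually_nhds, hXt.eventually hsm, hdom] with u hu hsmu hdomu
      have h1 : DifferentiableAt ℝ (iteratedDeriv k γ) (tanCoord z s u) := by
        rw [iteratedDeriv_eq_equiv_comp]
        exact (LinearIsometryEquiv.differentiable _).differentiableAt.comp _
          (hsmu.differentiableAt_iteratedFDeriv (by exact_mod_cast Nat.lt_succ_self k))
      have h2 := h1.hasDerivAt.comp u (hasDerivAt_tanCoord hz s u)
      have h3 := (hasDerivAt_iterate hz hreg hF k hdomu).congr_of_eventuallyEq
        (f₁ := iteratedDeriv k γ ∘ tanCoord z s) hu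
      have h4 := h2.unique h3
      rw [mul_comm] at h4
      rw [iteratedDeriv_succ]
      exact mul_left_cancel₀ (ne_of_gt hdomu) h4
  have := (key k).self_of_nhds
  rw [tanCoord_zero] at this
  exact this.symm

/-! ### The Taylor data of a boundary point and uniform control of its arc. -/

/-- Derivatives of the boundary curve over the tangent line at `z s`. -/
def curveDeriv (z : ℝ → Plane) (s : ℝ) (k : ℕ) (u : ℝ) : ℝ :=
  (graphDeriv z)^[k] (fun p => norCoord z p.1 p.2) (s, u)

/-- Derivatives of the density over the tangent line at `z s`. -/
def densityDeriv (z : ℝ → Plane) (μ : Plane → ℝ) (s : ℝ) (k : ℕ) (u : ℝ) : ℝ :=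
  (graphDeriv z)^[k] (fun p => μ (z (p.1 + p.2))) (s, u)

/-- The Taylor data at the boundary point `z s`. -/
def boundaryJet (z : ℝ → Plane) (μ : Plane → ℝ) (s : ℝ) : ArcJet where
  κ := curveDeriv z s 2 0
  k₃ := curveDeriv z s 3 0
  k₄ := curveDeriv z s 4 0
  k₅ := curveDeriv z s 5 0
  m₀ := densityDeriv z μ s 0 0
  m₁ := densityDeriv z μ s 1 0
  m₂ := densityDeriv z μ s 2 0
  m₃ := densityDeriv z μ s 3 0
  m₄ := densityDeriv z μ s 4 0

lemma inner_deriv_unitNormal (z : ℝ → Plane) (s : ℝ) :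
    inner ℝ (deriv z s) (unitNormal z s) = 0 := by
  rw [unitNormal_eq, unitTangent, rot_smul, inner_smul_right, inner_rot_self, mul_zero]

/-- The normal component of the velocity is speed times slope; this gives the kernel in the frame
the form of `arcIntegrand`. -/
lemma tanSpeed_mul_curveDeriv_one {z : ℝ → Plane} (hz : ContDiff ℝ ∞ z)
    (hreg : ∀ s, deriv z s ≠ 0) {s u : ℝ} (hu : (s, u) ∈ graphDomain z) :
    tanSpeed z s u * curveDeriv z s 1 u = inner ℝ (deriv z (s + u)) (unitNormal z s) :=
  (hasDerivAt_iterate hz hreg (contDiff_norCoord hz hreg) 0 hu).unique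
    (hasDerivAt_inner_sub hz s u (unitNormal z s))

lemma hasDerivAt_curveDeriv {z : ℝ → Plane} (hz : ContDiff ℝ ∞ z) (hreg : ∀ s, deriv z s ≠ 0)
    (k : ℕ) {s u : ℝ} (hu : (s, u) ∈ graphDomain z) :
    HasDerivAt (curveDeriv z s k) (tanSpeed z s u * curveDeriv z s (k + 1) u) u :=
  hasDerivAt_iterate hz hreg (contDiff_norCoord hz hreg) k hu

lemma hasDerivAt_densityDeriv {z : ℝ → Plane} (hz : ContDiff ℝ ∞ z) (hreg : ∀ s, deriv z s ≠ 0)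
    {μ : Plane → ℝ} (hμ : ContDiff ℝ ∞ fun s => μ (z s)) (k : ℕ) {s u : ℝ}
    (hu : (s, u) ∈ graphDomain z) :
    HasDerivAt (densityDeriv z μ s k) (tanSpeed z s u * densityDeriv z μ s (k + 1) u) u :=
  hasDerivAt_iterate hz hreg (F := fun p => μ (z (p.1 + p.2)))
    (hμ.comp (contDiff_fst.add contDiff_snd)) k hu

lemma curveDeriv_one_zero {z : ℝ → Plane} (hz : ContDiff ℝ ∞ z)
    (hreg : ∀ s, deriv z s ≠ 0) (s : ℝ) : curveDeriv z s 1 0 = 0 := by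
  have h := tanSpeed_mul_curveDeriv_one hz hreg (tanSpeed_zero_pos hreg s : (s, 0) ∈ graphDomain z)
  rw [add_zero, inner_deriv_unitNormal] at h
  exact (mul_eq_zero.1 h).resolve_left (tanSpeed_zero_pos hreg s).ne'

/-- The second derivative of the boundary curve over its tangent line is the curvature. -/
lemma curveDeriv_two_zero {z : ℝ → Plane} (hz : ContDiff ℝ ∞ z)
    (hreg : ∀ s, deriv z s ≠ 0) (s : ℝ) : curveDeriv z s 2 0 = curvature z s := by
  have hd0 : (s, (0:ℝ)) ∈ graphDomain z := tanSpeed_zero_pos hreg s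
  have h1 := hasDerivAt_iterate hz hreg (contDiff_norCoord hz hreg) 1 hd0
  have h2 : HasDerivAt (tanSpeed z s) (inner ℝ (deriv (deriv z) (s + 0)) (unitTangent z s)) 0 := by
    have := (((contDiff_deriv hz).differentiable (by simp)).differentiableAt
      (x := s + 0)).hasDerivAt
    have h2 := (this.comp_const_add s 0).inner ℝ (hasDerivAt_const (0:ℝ) (unitTangent z s))
    refine HasDerivAt.congr_deriv (f := tanSpeed z s) h2 ?_
    simp
  have h3 : HasDerivAt (fun u => inner ℝ (deriv z (s + u)) (unitNormal z s))
      (inner ℝ (deriv (deriv z) (s + 0)) (unitNormal z s)) 0 := by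
    have := (((contDiff_deriv hz).differentiable (by simp)).differentiableAt
      (x := s + 0)).hasDerivAt
    have h2 := (this.comp_const_add s 0).inner ℝ (hasDerivAt_const (0:ℝ) (unitNormal z s))
    simpa using h2
  have hev : ∀ᶠ u in 𝓝 (0:ℝ), (s, u) ∈ graphDomain z := by
    have hc : ContinuousAt (fun u : ℝ => (s, u)) 0 := by fun_prop
    exact hc.eventually_mem ((isOpen_graphDomain hz hreg).mem_nhds hd0)
  have h4 : (fun u => inner ℝ (deriv z (s + u)) (unitNormal z s)) =ᶠ[𝓝 0]
      fun u => tanSpeed z s u * curveDeriv z s 1 u := by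
    filter_upwards [hev] with u hu using (tanSpeed_mul_curveDeriv_one hz hreg hu).symm
  -- Speed times slope and the normal velocity have the same derivative at zero. The slope vanishes
  -- there, so only speed times the derivative of the slope survives, and that derivative carries a
  -- second factor of the speed.
  have h5 := (h2.mul h1).unique (h3.congr_of_eventuallyEq h4.symm)
  have e1 : (graphDeriv z)^[1] (fun p => norCoord z p.1 p.2) (s, 0) = 0 :=
    curveDeriv_one_zero hz hreg s
  rw [e1, mul_zero, zero_add, add_zero] at h5
  have hn : ‖deriv z s‖ ≠ 0 := norm_ne_zero_iff.2 (hreg s)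
  have hT : tanSpeed z s 0 = ‖deriv z s‖ := by
    rw [tanSpeed, add_zero, unitTangent, inner_smul_right, real_inner_self_eq_norm_sq]
    field_simp
  rw [hT] at h5
  rw [curvature, iteratedDeriv_succ, iteratedDeriv_one, ← h5]
  field_simp
  rfl

lemma densityDeriv_zero_zero (z : ℝ → Plane) (μ : Plane → ℝ) (s : ℝ) :
    densityDeriv z μ s 0 0 = μ (z s) := by
  simp [densityDeriv]

set_option maxHeartbeats 1000000 in
/-- Uniform control of the boundary arcs around all base points. -/
lemma exists_arcControl {z : ℝ → Plane} (hz : ContDiff ℝ ∞ z) (hreg : ∀ s, deriv z s ≠ 0)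
    {μ : Plane → ℝ} (hμ : ContDiff ℝ ∞ fun s => μ (z s)) :
    ∃ C a u₀ r₀ : ℝ, 1 ≤ C ∧ 0 < a ∧ 0 < u₀ ∧ u₀ < 1 / 2 ∧ 0 < r₀ ∧ ∀ s ∈ Icc (0:ℝ) 1,
      ArcControl C a u₀ (boundaryJet z μ s) (tanCoord z s) (tanSpeed z s) (norCoord z s)
        (curveDeriv z s 1) (fun u => μ (z (s + u))) ∧
      (∀ u ∈ Icc (-u₀) u₀, (s, u) ∈ graphDomain z) ∧
      ∀ ρ, |ρ| ≤ r₀ → ∀ u ∈ Icc (-u₀) u₀,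
        |2 * ρ * norCoord z s u - norCoord z s u ^ 2| ≤ tanCoord z s u ^ 2 / 2 := by
  have hcN := contDiff_norCoord hz hreg
  have hcM : ContDiff ℝ ∞ fun p : ℝ × ℝ => μ (z (p.1 + p.2)) :=
    hμ.comp (contDiff_fst.add contDiff_snd)
  have hcT := (contDiff_tanSpeed hz hreg).continuous
  -- Compactness of the base parameters yields one interval of u on which every arc is a graph over
  -- its tangent line.
  obtain ⟨U, V, -, hV, hU01, hV0, hUV⟩ := generalized_tube_lemma (isCompact_Icc (a := (0:ℝ)) (b := 1))
    (isCompact_singleton (x := (0:ℝ))) (isOpen_graphDomain hz hreg) (by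
      rintro ⟨s, u⟩ ⟨-, hu⟩
      rw [mem_singleton_iff] at hu
      change 0 < tanSpeed z s u
      rw [show u = 0 from hu]
      exact tanSpeed_zero_pos hreg s)
  obtain ⟨u₁, hu₁, hball⟩ := Metric.nhds_basis_closedBall.mem_iff.1
    (hV.mem_nhds (hV0 (mem_singleton _)))
  rw [Real.closedBall_eq_Icc, zero_sub, zero_add] at hball
  set K : Set (ℝ × ℝ) := Icc (0:ℝ) 1 ×ˢ Icc (-u₁) u₁ with hK
  have hKc : IsCompact K := isCompact_Icc.prod isCompact_Icc
  have hKd : K ⊆ graphDomain z := (Set.prod_mono hU01 hball).trans hUV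
  have hN := fun k => (contDiffOn_iterate hz hreg hcN k).continuousOn.mono hKd
  have hM := fun k => (contDiffOn_iterate hz hreg hcM k).continuousOn.mono hKd
  obtain ⟨B₀, hB₀⟩ := hKc.exists_bound_of_continuousOn (f := fun p => |tanSpeed z p.1 p.2| +
      ∑ k ∈ Finset.range 7, (|(graphDeriv z)^[k] (fun p => norCoord z p.1 p.2) p| +
        |(graphDeriv z)^[k] (fun p => μ (z (p.1 + p.2))) p|)) (by
    refine ContinuousOn.add hcT.continuousOn.abs ?_
    exact continuousOn_finsetSum _ fun k _ => (hN k).abs.add (hM k).abs)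
  obtain ⟨p₀, hp₀, hmin⟩ := hKc.exists_isMinOn (f := fun p => tanSpeed z p.1 p.2)
    ⟨(0, 0), ⟨by simp, by simp [hu₁.le]⟩⟩ hcT.continuousOn
  set c := tanSpeed z p₀.1 p₀.2 with hc
  have hc0 : 0 < c := hKd hp₀
  set B := max B₀ 1 with hB
  have hB1 : 1 ≤ B := le_max_right _ _
  have hB0 : 0 < B := by linarith
  have hsum : ∀ s ∈ Icc (0:ℝ) 1, ∀ u ∈ Icc (-u₁) u₁, |tanSpeed z s u| ≤ B ∧
      ∀ k ≤ 6, |curveDeriv z s k u| ≤ B ∧ |densityDeriv z μ s k u| ≤ B := by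
    intro s hs u hu
    have h1 := (le_abs_self _).trans ((hB₀ (s, u) ⟨hs, hu⟩).trans (le_max_left B₀ 1))
    have hnn : ∀ k ∈ Finset.range 7, 0 ≤
        |(graphDeriv z)^[k] (fun p => norCoord z p.1 p.2) (s, u)| +
        |(graphDeriv z)^[k] (fun p => μ (z (p.1 + p.2))) (s, u)| := fun k _ => by positivity
    refine ⟨by linarith [Finset.sum_nonneg hnn], fun k hk => ?_⟩
    have h2 := Finset.single_le_sum hnn (Finset.mem_range.2 (by omega : k < 7))
    have h3 := abs_nonneg (tanSpeed z s u)
    have h4 := abs_nonneg ((graphDeriv z)^[k] (fun p => norCoord z p.1 p.2) (s, u))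
    have h5 := abs_nonneg ((graphDeriv z)^[k] (fun p => μ (z (p.1 + p.2))) (s, u))
    constructor
    · change |(graphDeriv z)^[k] (fun p => norCoord z p.1 p.2) (s, u)| ≤ B
      linarith
    · change |(graphDeriv z)^[k] (fun p => μ (z (p.1 + p.2))) (s, u)| ≤ B
      linarith
  -- A is the constant in |η| ≤ A X²: Taylor's formula gives B³ u², and |u| ≤ |X| / c.
  set A := B ^ 3 / c ^ 2 with hA
  have hA0 : 0 < A := by positivity
  -- The bound 1/(2AB) forces |X| ≤ 1/(2A), hence η² ≤ X²/4. The bound 1/4 keeps the arc shorter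
  -- than one period.
  set u₀ := min (min u₁ (1 / 4)) (1 / (2 * A * B)) with hu₀
  have hu₀0 : 0 < u₀ := by positivity
  have hu₀1 : u₀ ≤ u₁ := (min_le_left _ _).trans (min_le_left _ _)
  have hu₀2 : u₀ ≤ 1 / 4 := (min_le_left _ _).trans (min_le_right _ _)
  have hu₀3 : u₀ ≤ 1 / (2 * A * B) := min_le_right _ _
  -- The three summands of C cover the remainders of order six and five and the bound on the jet.
  -- The value 1/(8A) for r₀ makes |2ρη| ≤ X²/4.
  refine ⟨B ^ 7 / c ^ 6 + B ^ 6 / c ^ 5 + B, c * u₀, u₀, 1 / (8 * A), ?_, by positivity, hu₀0,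
    by linarith, by positivity, fun s hs => ?_⟩
  · have : 0 ≤ B ^ 7 / c ^ 6 + B ^ 6 / c ^ 5 := by positivity
    linarith
  have hsub : ∀ u ∈ Icc (-u₀) u₀, u ∈ Icc (-u₁) u₁ := fun u hu =>
    ⟨by linarith [hu.1], by linarith [hu.2]⟩
  have hdom : ∀ u ∈ Icc (-u₁) u₁, (s, u) ∈ graphDomain z := fun u hu => hKd ⟨hs, hu⟩
  have hXd : ∀ u ∈ Icc (-u₁) u₁, HasDerivAt (tanCoord z s) (tanSpeed z s u) u := fun u _ =>
    hasDerivAt_tanCoord hz s u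
  have hT0 := tanCoord_zero z s
  have hlow : ∀ u ∈ Icc (-u₁) u₁, ∀ v ∈ Icc (-u₁) u₁, u ≤ v →
      c * (v - u) ≤ tanCoord z s v - tanCoord z s u := by
    intro u hu v hv huv
    refine (convex_Icc (-u₁) u₁).mul_sub_le_image_sub_of_le_deriv
      (fun w hw => (hXd w hw).continuousAt.continuousWithinAt)
      (fun w hw => (hXd w (interior_subset hw)).differentiableAt.differentiableWithinAt)
      (fun w hw => ?_) u hu v hv huv
    rw [(hXd w (interior_subset hw)).deriv]
    have hmem : (s, w) ∈ K := ⟨hs, interior_subset hw⟩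
    exact isMinOn_iff.1 hmin (s, w) hmem
  have h0mem : (0:ℝ) ∈ Icc (-u₁) u₁ := ⟨by linarith, hu₁.le⟩
  have hXlow : ∀ u ∈ Icc (-u₁) u₁, c * |u| ≤ |tanCoord z s u| := by
    intro u hu
    rcases le_total 0 u with h | h
    · have := hlow 0 h0mem u hu h
      rw [hT0, sub_zero, sub_zero] at this
      rw [abs_of_nonneg h]
      exact this.trans (le_abs_self _)
    · have := hlow u hu 0 h0mem h
      rw [hT0] at this
      rw [abs_of_nonpos h]
      refine le_trans ?_ (neg_le_abs _)
      linarith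
  have hXup : ∀ u ∈ Icc (-u₁) u₁, |tanCoord z s u| ≤ B * |u| := by
    intro u hu
    have := (convex_Icc (-u₁) u₁).norm_image_sub_le_of_norm_hasDerivWithin_le
      (fun w hw => (hXd w hw).hasDerivWithinAt)
      (fun w hw => by rw [Real.norm_eq_abs]; exact (hsum s hs w hw).1) h0mem hu
    simpa [hT0] using this
  have hpow : ∀ (n : ℕ), ∀ u ∈ Icc (-u₁) u₁, |u| ^ n ≤ |tanCoord z s u| ^ n / c ^ n := by
    intro n u hu
    rw [← div_pow]
    refine pow_le_pow_left₀ (abs_nonneg u) ?_ n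
    rw [le_div_iff₀ hc0, mul_comm]
    exact hXlow u hu
  have tN := abs_sub_taylor_le (F := curveDeriv z s) (N := 6) hT0 hXd
    (fun k u hu => hasDerivAt_curveDeriv hz hreg k (hdom u hu)) (fun u hu => (hsum s hs u hu).1)
    (fun k hk u hu => ((hsum s hs u hu).2 k hk).1)
  have tM := abs_sub_taylor_le (F := densityDeriv z μ s) (N := 6) hT0 hXd
    (fun k u hu => hasDerivAt_densityDeriv hz hreg hμ k (hdom u hu)) (fun u hu => (hsum s hs u hu).1)
    (fun k hk u hu => ((hsum s hs u hu).2 k hk).2)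
  have n0 : curveDeriv z s 0 0 = 0 := by simp [curveDeriv]
  have n1 : curveDeriv z s 1 0 = 0 := curveDeriv_one_zero hz hreg s
  have hη2 : ∀ u ∈ Icc (-u₀) u₀, |norCoord z s u| ≤ A * tanCoord z s u ^ 2 := by
    intro u hu
    have h := tN 2 0 (by norm_num) u (hsub u hu)
    simp only [Finset.sum_range_succ, Finset.sum_range_zero, zero_add, n0, n1] at h
    norm_num at h
    have h' : |norCoord z s u| ≤ B ^ 3 * u ^ 2 := h
    have h2 := hpow 2 u (hsub u hu)
    rw [sq_abs, sq_abs] at h2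
    calc _ ≤ B ^ 3 * u ^ 2 := h'
      _ ≤ B ^ 3 * (tanCoord z s u ^ 2 / c ^ 2) := by gcongr
      _ = _ := by rw [hA]; ring
  have hC6 : ∀ x : ℝ, B ^ 7 * (|x| ^ 6 / c ^ 6) ≤ (B ^ 7 / c ^ 6 + B ^ 6 / c ^ 5 + B) * |x| ^ 6 := by
    intro x
    have : 0 ≤ (B ^ 6 / c ^ 5 + B) * |x| ^ 6 := by positivity
    have e : B ^ 7 * (|x| ^ 6 / c ^ 6) = B ^ 7 / c ^ 6 * |x| ^ 6 := by ring
    rw [e]; linarith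
  have hC5 : ∀ x : ℝ, B ^ 6 * (|x| ^ 5 / c ^ 5) ≤ (B ^ 7 / c ^ 6 + B ^ 6 / c ^ 5 + B) * |x| ^ 5 := by
    intro x
    have : 0 ≤ (B ^ 7 / c ^ 6 + B) * |x| ^ 5 := by positivity
    have e : B ^ 6 * (|x| ^ 5 / c ^ 5) = B ^ 6 / c ^ 5 * |x| ^ 5 := by ring
    rw [e]; linarith
  have hBC : B ≤ B ^ 7 / c ^ 6 + B ^ 6 / c ^ 5 + B := by
    have : 0 ≤ B ^ 7 / c ^ 6 + B ^ 6 / c ^ 5 := by positivity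
    linarith
  have hs0 := hsum s hs 0 h0mem
  have hcont : ∀ (F : ℝ × ℝ → ℝ), ContDiff ℝ ∞ F → ∀ k, ContinuousOn
      (fun u => (graphDeriv z)^[k] F (s, u)) (Icc (-u₀) u₀) := fun F hF k u hu =>
    (hasDerivAt_iterate hz hreg hF k (hdom u (hsub u hu))).continuousAt.continuousWithinAt
  have hu₀m : u₀ ∈ Icc (-u₁) u₁ := ⟨by linarith, hu₀1⟩
  have hu₀m' : -u₀ ∈ Icc (-u₁) u₁ := ⟨by linarith, by linarith⟩
  refine ⟨?_, fun u hu => hdom u (hsub u hu), ?_⟩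
  · refine ⟨?_, fun u hu => hXd u (hsub u hu), fun u hu => le_of_lt (hdom u (hsub u hu)),
      (hcT.comp (by fun_prop : Continuous fun u : ℝ => (s, u))).continuousOn, ?_, ?_, ?_, ?_, ?_, ?_,
      ?_, ?_⟩
    · exact ⟨(hs0.2 2 (by norm_num)).1.trans hBC, (hs0.2 3 (by norm_num)).1.trans hBC,
        (hs0.2 4 (by norm_num)).1.trans hBC, (hs0.2 5 (by norm_num)).1.trans hBC,
        (hs0.2 0 (by norm_num)).2.trans hBC, (hs0.2 1 (by norm_num)).2.trans hBC,
        (hs0.2 2 (by norm_num)).2.trans hBC, (hs0.2 3 (by norm_num)).2.trans hBC,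
        (hs0.2 4 (by norm_num)).2.trans hBC⟩
    · exact hcont _ hcN 0
    · exact hcont _ hcN 1
    · exact hcont _ hcM 0
    · have := hlow (-u₀) hu₀m' 0 h0mem (by linarith)
      rw [hT0] at this
      linarith
    · have := hlow 0 h0mem u₀ hu₀m hu₀0.le
      rw [hT0] at this
      linarith
    · intro u hu
      have h := tN 6 0 (by norm_num) u (hsub u hu)
      have e : curveDeriv z s 0 u - ∑ j ∈ Finset.range 6, curveDeriv z s (0 + j) 0 *
          tanCoord z s u ^ j / j.factorial =
          norCoord z s u - (boundaryJet z μ s).curve (tanCoord z s u) := by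
        simp only [Finset.sum_range_succ, Finset.sum_range_zero, zero_add, n0, n1, ArcJet.curve,
          boundaryJet, Nat.factorial]
        norm_num
        congr 1
      rw [e] at h
      refine h.trans ((mul_le_mul_of_nonneg_left (hpow 6 u (hsub u hu)) (by positivity)).trans ?_)
      exact hC6 _
    · intro u hu
      have h := tN 5 1 (by norm_num) u (hsub u hu)
      have e : curveDeriv z s 1 u - ∑ j ∈ Finset.range 5, curveDeriv z s (1 + j) 0 *
          tanCoord z s u ^ j / j.factorial =
          curveDeriv z s 1 u - (boundaryJet z μ s).slope (tanCoord z s u) := by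
        simp only [Finset.sum_range_succ, Finset.sum_range_zero, zero_add, n1, ArcJet.slope,
          boundaryJet, Nat.factorial, add_zero]
        norm_num
      rw [e] at h
      refine h.trans ((mul_le_mul_of_nonneg_left (hpow 5 u (hsub u hu)) (by positivity)).trans ?_)
      exact hC5 _
    · intro u hu
      have h := tM 5 0 (by norm_num) u (hsub u hu)
      have e : densityDeriv z μ s 0 u - ∑ j ∈ Finset.range 5, densityDeriv z μ s (0 + j) 0 *
          tanCoord z s u ^ j / j.factorial =
          μ (z (s + u)) - (boundaryJet z μ s).density (tanCoord z s u) := by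
        simp only [Finset.sum_range_succ, Finset.sum_range_zero, zero_add, ArcJet.density,
          boundaryJet, Nat.factorial]
        norm_num
        congr 1
      rw [e] at h
      refine h.trans ((mul_le_mul_of_nonneg_left (hpow 5 u (hsub u hu)) (by positivity)).trans ?_)
      exact hC5 _
  · intro ρ hρ u hu
    have h1 := hη2 u hu
    have h2 := hXup u (hsub u hu)
    have hu' : |u| ≤ u₀ := abs_le.2 hu
    have h3 : |tanCoord z s u| ≤ 1 / (2 * A) := by
      calc _ ≤ B * |u| := h2
        _ ≤ B * (1 / (2 * A * B)) := by gcongr; linarith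
        _ = _ := by field_simp
    set X := tanCoord z s u with hX
    set η := norCoord z s u with hη
    have hX2 : A * X ^ 2 ≤ 1 / (4 * A) := by
      rw [← sq_abs]
      calc A * |X| ^ 2 ≤ A * (1 / (2 * A)) ^ 2 := by gcongr
        _ = _ := by field_simp; norm_num
    have e1 : |2 * ρ * η| ≤ X ^ 2 / 4 := by
      rw [abs_mul, abs_mul, abs_two]
      calc 2 * |ρ| * |η| ≤ 2 * (1 / (8 * A)) * (A * X ^ 2) := by gcongr
        _ = _ := by field_simp; ring
    have e2 : η ^ 2 ≤ X ^ 2 / 4 := by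
      rw [← sq_abs]
      calc |η| ^ 2 ≤ (A * X ^ 2) * (A * X ^ 2) := by rw [sq]; gcongr
        _ ≤ 1 / (4 * A) * (A * X ^ 2) := by gcongr
        _ = _ := by field_simp
    rw [abs_le] at e1 ⊢
    have := sq_nonneg η
    constructor <;> linarith [e1.1, e1.2]

/-! ### Separation of the boundary arcs -/

lemma periodic_deriv {z : ℝ → Plane} (hz : Function.Periodic z 1) :
    Function.Periodic (deriv z) 1 := fun s => by
  rw [← deriv_comp_add_const, show (fun x => z (x + 1)) = z from funext hz]

lemma periodic_map_fract {E : Type*} {f : ℝ → E} (hf : Function.Periodic f 1) (s : ℝ) :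
    f (Int.fract s) = f s := by
  rw [Int.fract, ← mul_one ((⌊s⌋ : ℤ) : ℝ), hf.sub_int_mul_eq]

section Boundary

variable {ι : Type*} {Ω : Set Plane} {z : ι → ℝ → Plane}

lemma IsSmoothBoundary.eq_and_fract_eq (hΩ : IsSmoothBoundary Ω z) {i j : ι} {s t : ℝ}
    (h : z i s = z j t) : i = j ∧ Int.fract s = Int.fract t := by
  rw [← periodic_map_fract (hΩ.periodic i), ← periodic_map_fract (hΩ.periodic j)] at h
  exact hΩ.simple i j _ ⟨Int.fract_nonneg s, Int.fract_lt_one s⟩ _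
    ⟨Int.fract_nonneg t, Int.fract_lt_one t⟩ h

/-- Points of the boundary with distant parameters have a distance bounded below. -/
lemma IsSmoothBoundary.exists_separation [Finite ι] (hΩ : IsSmoothBoundary Ω z) (i : ι) {u₀ : ℝ}
    (hu₀ : 0 < u₀) : ∃ d : ℝ, 0 < d ∧ ∀ s ∈ Icc (0 : ℝ) 1,
      (∀ u, u₀ ≤ |u| → |u| ≤ 1 / 2 → d ≤ ‖z i (s + u) - z i s‖) ∧
      ∀ j, j ≠ i → ∀ u, d ≤ ‖z j u - z i s‖ := by
  have hc : ∀ j, Continuous (z j) := fun j => (hΩ.smooth j).continuous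
  have hK : IsCompact {u : ℝ | u₀ ≤ |u| ∧ |u| ≤ 1 / 2} := by
    refine isCompact_Icc.of_isClosed_subset (s := Icc (-(1 / 2) : ℝ) (1 / 2)) ?_
      fun u hu => abs_le.1 hu.2
    exact (isClosed_le continuous_const continuous_abs).inter
      (isClosed_le continuous_abs continuous_const)
  obtain ⟨d₁, hd₁, h₁⟩ := ((isCompact_Icc (a := (0 : ℝ)) (b := 1)).prod hK).exists_forall_le'
    (f := fun p => ‖z i (p.1 + p.2) - z i p.1‖) (a := 0) (by
      have := hc i; exact Continuous.continuousOn (by fun_prop)) (by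
      rintro ⟨s, u⟩ ⟨-, hu⟩
      refine norm_pos_iff.2 (sub_ne_zero.2 fun h => ?_)
      -- Coinciding points have parameters differing by an integer, and |u| ≤ 1/2 leaves only u = 0,
      -- which u₀ > 0 excludes.
      obtain ⟨n, hn⟩ := Int.fract_eq_fract.1 (hΩ.eq_and_fract_eq h).2
      have hun : u = n := by linarith
      have h1 : u₀ ≤ |u| := hu.1
      have h2 : |u| ≤ 1 / 2 := hu.2
      rw [hun] at h1 h2
      rcases eq_or_ne n 0 with h0 | h0
      · rw [h0, Int.cast_zero, abs_zero] at h1; linarith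
      · have : (1 : ℝ) ≤ |(n : ℝ)| := by exact_mod_cast Int.one_le_abs h0
        linarith)
  have h₂ : ∀ j, ∃ d > 0, j ≠ i → ∀ s ∈ Icc (0 : ℝ) 1, ∀ u ∈ Icc (0 : ℝ) 1,
      d ≤ ‖z j u - z i s‖ := by
    intro j
    by_cases hj : j = i
    · exact ⟨1, one_pos, fun h => absurd hj h⟩
    obtain ⟨d, hd, h⟩ := ((isCompact_Icc (a := (0 : ℝ)) (b := 1)).prod
      (isCompact_Icc (a := (0 : ℝ)) (b := 1))).exists_forall_le'
      (f := fun p => ‖z j p.2 - z i p.1‖) (a := 0) (by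
        have := hc i; have := hc j; exact Continuous.continuousOn (by fun_prop)) (by
        rintro ⟨s, u⟩ -
        exact norm_pos_iff.2 (sub_ne_zero.2 fun h => hj (hΩ.eq_and_fract_eq h).1))
    exact ⟨d, hd, fun _ s hs u hu => h (s, u) ⟨hs, hu⟩⟩
  choose D hD0 hD using h₂
  -- A small positive d lies below finitely many positive bounds; the filter formulation avoids
  -- minima over a possibly empty index type.
  obtain ⟨d, ⟨hd1, hd2⟩, hd0⟩ := ((Filter.Eventually.and (Ioc_mem_nhdsGT hd₁)
    (eventually_all.2 fun j => Ioc_mem_nhdsGT (hD0 j)) : ∀ᶠ d in 𝓝[>] (0 : ℝ),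
      d ∈ Ioc 0 d₁ ∧ ∀ j, d ∈ Ioc 0 (D j)).and self_mem_nhdsWithin).exists
  refine ⟨d, hd0, fun s hs => ⟨fun u hu hu' => hd1.2.trans (h₁ (s, u) ⟨hs, hu, hu'⟩),
    fun j hj u => ?_⟩⟩
  rw [← periodic_map_fract (hΩ.periodic j) u]
  exact (hd2 j).2.trans (hD j hj s hs _ ⟨Int.fract_nonneg u, (Int.fract_lt_one u).le⟩)

/-! ### Comparison with the model -/

/-- The frame is orthonormal, so the squared distance is X² + (ρ - η)². The arc length factor is
already in the unnormalized rotated velocity. -/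
lemma layerKernel_frame {z : ℝ → Plane} (hz : ContDiff ℝ ∞ z) (hreg : ∀ s, deriv z s ≠ 0)
    (μ : Plane → ℝ) {s u : ℝ} (hu : (s, u) ∈ graphDomain z) (σ ρ : ℝ) :
    layerKernel z μ (z s + ρ • unitNormal z s) (σ ^ 2) (s + u) =
      arcIntegrand σ ρ (tanCoord z s) (tanSpeed z s) (norCoord z s) (curveDeriv z s 1)
        (fun u => μ (z (s + u))) u := by
  have e : z s + ρ • unitNormal z s - z (s + u) =
      ρ • rot (unitTangent z s) - (z (s + u) - z s) := by rw [unitNormal_eq]; abel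
  have hτ := norm_unitTangent (hreg s)
  rw [layerKernel, arcIntegrand, tanSpeed_mul_curveDeriv_one hz hreg hu, e,
    norm_sq_sub_frame hτ, inner_sub_frame hτ, ← pow_mul]
  rfl

lemma continuous_layerKernel_right {z : ℝ → Plane} {μ : Plane → ℝ} (hz : ContDiff ℝ ∞ z)
    (hμ : Continuous fun s => μ (z s)) (x : Plane) {t : ℝ} (ht : 0 < t) :
    Continuous (layerKernel z μ x t) := by
  have h := (continuous_layerKernel hz hμ).comp
    (by fun_prop : Continuous fun u : ℝ => ((x, log t), u))
  simpa only [Function.comp_def, exp_log ht] using h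

lemma exists_speed_density_le [Finite ι] (hΩ : IsSmoothBoundary Ω z) {μ : Plane → ℝ}
    (hμ : ∀ i, ContDiff ℝ ∞ (fun s => μ (z i s))) : ∃ M : ℝ, 0 ≤ M ∧
      ∀ j u, ‖deriv (z j) u‖ * |μ (z j u)| ≤ M := by
  have : ∀ j, ∃ M, ∀ u ∈ Icc (0 : ℝ) 1, ‖‖deriv (z j) u‖ * |μ (z j u)|‖ ≤ M := fun j =>
    isCompact_Icc.exists_bound_of_continuousOn
      (((hΩ.smooth j).continuous_deriv (by simp)).norm.mul (hμ j).continuous.abs).continuousOn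
  choose M hM using this
  obtain ⟨B, hB, hB0⟩ := ((eventually_all.2 fun j => eventually_ge_atTop (M j)).and
    (eventually_ge_atTop (0 : ℝ))).exists
  refine ⟨B, hB0, fun j u => ?_⟩
  rw [← periodic_map_fract (hΩ.periodic j) u, ← periodic_map_fract (periodic_deriv (hΩ.periodic j)) u]
  exact (le_abs_self _).trans ((hM j _ ⟨Int.fract_nonneg u, (Int.fract_lt_one u).le⟩).trans (hB j))

/-- The layer potential of a distant piece of the boundary, or at large times. -/
lemma exists_integral_layerKernel_le [Finite ι] (hΩ : IsSmoothBoundary Ω z) {μ : Plane → ℝ}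
    (hμ : ∀ i, ContDiff ℝ ∞ (fun s => μ (z i s))) {d : ℝ} (hd : 0 < d) : ∃ K : ℝ, 0 ≤ K ∧
      ∀ (j : ι) (x : Plane) (s a b : ℝ), 0 < s → a ≤ b → b - a ≤ 1 →
        (1 ≤ s ∨ ∀ u ∈ Icc a b, d ≤ ‖x - z j u‖) →
        |∫ u in a..b, layerKernel (z j) μ x (s ^ 2) u| ≤ K * s ^ 3 := by
  obtain ⟨M, hM0, hM⟩ := exists_speed_density_le hΩ hμ
  obtain ⟨K, hK0, hK⟩ := exists_layerKernel_le hd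
  refine ⟨K * M, by positivity, fun j x s a b hs hab hab1 hor => ?_⟩
  have h : ∀ u ∈ uIoc a b, ‖layerKernel (z j) μ x (s ^ 2) u‖ ≤ K * M * s ^ 3 := by
    intro u hu
    rw [uIoc_of_le hab] at hu
    have h1 : d ≤ ‖x - z j u‖ ∨ 1 ≤ s := hor.elim Or.inr fun h => Or.inl (h u ⟨hu.1.le, hu.2⟩)
    refine (hK (z j) μ x s u hs h1).trans ?_
    have := hM j u
    gcongr
  refine (intervalIntegral.norm_integral_le_of_norm_le_const h).trans ?_
  rw [abs_of_nonneg (by linarith)]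
  exact mul_le_of_le_one_right (by positivity) hab1

lemma exists_doubleLayerAt_le [Fintype ι] (hΩ : IsSmoothBoundary Ω z) {μ : Plane → ℝ}
    (hμ : ∀ i, ContDiff ℝ ∞ (fun s => μ (z i s))) {d : ℝ} (hd : 0 < d) : ∃ K : ℝ, 0 ≤ K ∧
      ∀ (x : Plane) (s : ℝ), 0 < s → (∀ j u, d ≤ ‖x - z j u‖) →
        |doubleLayerAt z μ x (s ^ 2)| ≤ K * s ^ 3 := by
  obtain ⟨K, hK0, hK⟩ := exists_integral_layerKernel_le hΩ hμ hd
  refine ⟨Fintype.card ι * K, by positivity, fun x s hs h => ?_⟩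
  rw [doubleLayerAt_eq hΩ.regular μ x (by positivity)]
  calc _ ≤ ∑ i, |∫ u in (0 : ℝ)..1, layerKernel (z i) μ x (s ^ 2) u| :=
        Finset.abs_sum_le_sum_abs _ _
    _ ≤ ∑ i : ι, K * s ^ 3 := Finset.sum_le_sum fun i _ =>
        hK i x s 0 1 hs zero_le_one (by norm_num) (Or.inr fun u _ => h i u)
    _ = _ := by rw [Finset.sum_const, Finset.card_univ, nsmul_eq_mul, mul_assoc]

/-- Close to the boundary, the inner integral is approximated by the model of the boundary arc. -/
lemma exists_near_bound [Fintype ι] (hΩ : IsSmoothBoundary Ω z) {μ : Plane → ℝ}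
    (hμ : ∀ i, ContDiff ℝ ∞ (fun s => μ (z i s))) (i : ι) : ∃ C r : ℝ, 1 ≤ C ∧ 0 < r ∧
      ∀ s ∈ Icc (0 : ℝ) 1, (boundaryJet (z i) μ s).BoundedBy C ∧
        ∀ ρ, |ρ| ≤ r → ∀ σ, 0 < σ →
        |doubleLayerAt z μ (z i s + ρ • unitNormal (z i) s) (σ ^ 2) -
          (boundaryJet (z i) μ s).model σ ρ| ≤ C * σ ^ 3 := by
  obtain ⟨C, a, u₀, r₀, hC, ha, hu₀, hu₀', hr₀, harc⟩ :=
    exists_arcControl (hΩ.smooth i) (hΩ.regular i) (hμ i)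
  obtain ⟨d, hd, hsep⟩ := hΩ.exists_separation i hu₀
  obtain ⟨K, hK0, hK⟩ := exists_integral_layerKernel_le hΩ hμ (half_pos hd)
  obtain ⟨K₁, hK₁0, hK₁⟩ := exists_arc_bound hC ha
  obtain ⟨K₂, hK₂0, hK₂⟩ := ArcJet.exists_model_le_cube hC one_pos
  have hmax : C ≤ C + Fintype.card ι * (2 * K + K₁ + K₂) := by
    have : 0 ≤ Fintype.card ι * (2 * K + K₁ + K₂) := by positivity
    linarith
  refine ⟨C + Fintype.card ι * (2 * K + K₁ + K₂), min r₀ (d / 2), hC.trans hmax, by positivity,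
    fun s hs => ?_⟩
  obtain ⟨hA, hdom, hq⟩ := harc s hs
  refine ⟨?_, fun ρ hρ σ hσ => ?_⟩
  · obtain ⟨h1, h2, h3, h4, h5, h6, h7, h8, h9⟩ := hA.bounded
    exact ⟨h1.trans hmax, h2.trans hmax, h3.trans hmax, h4.trans hmax, h5.trans hmax,
      h6.trans hmax, h7.trans hmax, h8.trans hmax, h9.trans hmax⟩
  set J := boundaryJet (z i) μ s with hJ
  set x := z i s + ρ • unitNormal (z i) s with hx
  have hfar : ∀ p : Plane, d ≤ ‖p - z i s‖ → d / 2 ≤ ‖x - p‖ := by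
    intro p hp
    have h1 : ‖x - z i s‖ ≤ d / 2 := by
      rw [hx, add_sub_cancel_left, norm_smul, norm_unitNormal (hΩ.regular i s), mul_one,
        Real.norm_eq_abs]
      exact hρ.trans (min_le_right _ _)
    have h2 : ‖p - z i s‖ ≤ ‖x - z i s‖ + ‖x - p‖ := by
      have := norm_sub_le (x - z i s) (x - p)
      rwa [sub_sub_sub_cancel_left] at this
    linarith
  classical
  -- The model is charged to the curve carrying the base point; the other curves keep a positive
  -- distance from x and contribute O(σ³).
  have key : ∀ j, |(∫ u in (0 : ℝ)..1, layerKernel (z j) μ x (σ ^ 2) u) -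
      if j = i then J.model σ ρ else 0| ≤ (2 * K + K₁ + K₂) * σ ^ 3 := by
    intro j
    have hσ3 : 0 ≤ σ ^ 3 := by positivity
    have hK3 : 0 ≤ K * σ ^ 3 := by positivity
    have hK13 : 0 ≤ K₁ * σ ^ 3 := by positivity
    have hK23 : 0 ≤ K₂ * σ ^ 3 := by positivity
    by_cases hj : j = i
    swap
    · rw [if_neg hj, sub_zero]
      refine (hK j x σ 0 1 hσ zero_le_one (by norm_num)
        (Or.inr fun u _ => hfar _ ((hsep s hs).2 j hj u))).trans ?_
      linarith
    subst hj
    rw [if_pos rfl]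
    -- For σ ≥ 1 the integral and the model are each bounded by a multiple of σ³, so no comparison
    -- is needed.
    rcases le_total 1 σ with hσ1 | hσ1
    · have h1 := hK j x σ 0 1 hσ zero_le_one (by norm_num) (Or.inl hσ1)
      have h2 := hK₂ J hA.bounded σ ρ hσ (Or.inr hσ1)
      have := abs_sub (∫ u in (0 : ℝ)..1, layerKernel (z j) μ x (σ ^ 2) u) (J.model σ ρ)
      linarith
    have hcont := continuous_layerKernel_right (hΩ.smooth j) (hμ j).continuous x
      (by positivity : 0 < σ ^ 2)
    have hint : ∀ p q, IntervalIntegrable (layerKernel (z j) μ x (σ ^ 2)) volume p q := fun p q =>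
      hcont.intervalIntegrable p q
    have hper : Function.Periodic (layerKernel (z j) μ x (σ ^ 2)) 1 := fun u => by
      rw [layerKernel, layerKernel, hΩ.periodic j u, periodic_deriv (hΩ.periodic j) u]
    -- Periodicity moves the period to one centred at s. The central arc is compared with the model,
    -- and the two outer pieces stay away from x.
    have e1 := hper.intervalIntegral_add_eq 0 (s - 1 / 2)
    rw [zero_add, show s - 1 / 2 + 1 = s + 1 / 2 by ring] at e1
    rw [e1, ← intervalIntegral.integral_add_adjacent_intervals (hint (s - 1 / 2) (s + u₀))
        (hint (s + u₀) (s + 1 / 2)),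
      ← intervalIntegral.integral_add_adjacent_intervals (hint (s - 1 / 2) (s + -u₀))
        (hint (s + -u₀) (s + u₀))]
    have e2 : ∫ u in (s + -u₀)..(s + u₀), layerKernel (z j) μ x (σ ^ 2) u =
        ∫ u in (-u₀)..u₀, arcIntegrand σ ρ (tanCoord (z j) s) (tanSpeed (z j) s)
          (norCoord (z j) s) (curveDeriv (z j) s 1) (fun u => μ (z j (s + u))) u := by
      rw [← intervalIntegral.integral_comp_add_left]
      refine intervalIntegral.integral_congr fun u hu => ?_
      rw [uIcc_of_le (by linarith)] at hu
      exact layerKernel_frame (hΩ.smooth j) (hΩ.regular j) μ (hdom u hu) σ ρ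
    have hout : ∀ v ∈ Icc (s - 1 / 2) (s + 1 / 2), u₀ ≤ |v - s| → d / 2 ≤ ‖x - z j v‖ := by
      intro v hv hv'
      have := (hsep s hs).1 (v - s) hv' (abs_le.2 ⟨by linarith [hv.1], by linarith [hv.2]⟩)
      rw [add_sub_cancel] at this
      exact hfar _ this
    have b1 := hK j x σ (s - 1 / 2) (s + -u₀) hσ (by linarith) (by linarith)
      (Or.inr fun u hu => hout u ⟨hu.1, by linarith [hu.2]⟩
        (le_trans (by linarith [hu.2]) (neg_le_abs _)))
    have b2 := hK j x σ (s + u₀) (s + 1 / 2) hσ (by linarith) (by linarith)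
      (Or.inr fun u hu => hout u ⟨by linarith [hu.1], hu.2⟩
        (le_trans (by linarith [hu.1]) (le_abs_self _)))
    have b3 := hK₁ u₀ J _ _ _ _ _ hu₀.le hA σ ρ hσ hσ1 (hq ρ (hρ.trans (min_le_left _ _)))
    rw [← e2] at b3
    rw [abs_le] at b1 b2 b3 ⊢
    constructor <;> linarith [b1.1, b1.2, b2.1, b2.2, b3.1, b3.2]
  rw [doubleLayerAt_eq hΩ.regular μ x (by positivity)]
  have e : ∑ j, (∫ u in (0 : ℝ)..1, layerKernel (z j) μ x (σ ^ 2) u) - J.model σ ρ =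
      ∑ j, ((∫ u in (0 : ℝ)..1, layerKernel (z j) μ x (σ ^ 2) u) -
        if j = i then J.model σ ρ else 0) := by
    rw [Finset.sum_sub_distrib, Finset.sum_ite_eq' Finset.univ i, if_pos (Finset.mem_univ i)]
  rw [e]
  calc _ ≤ ∑ j, |(∫ u in (0 : ℝ)..1, layerKernel (z j) μ x (σ ^ 2) u) -
        if j = i then J.model σ ρ else 0| := Finset.abs_sum_le_sum_abs _ _
    _ ≤ ∑ j : ι, (2 * K + K₁ + K₂) * σ ^ 3 := Finset.sum_le_sum fun j _ => key j
    _ = Fintype.card ι * (2 * K + K₁ + K₂) * σ ^ 3 := by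
        rw [Finset.sum_const, Finset.card_univ, nsmul_eq_mul, mul_assoc]
    _ ≤ _ := by gcongr; linarith

/-- The inner integral is approximated by the model uniformly in the target point. -/
lemma exists_model_approx [Fintype ι] (hΩ : IsSmoothBoundary Ω z) {μ : Plane → ℝ}
    (hμ : ∀ i, ContDiff ℝ ∞ (fun s => μ (z i s))) : ∃ C r : ℝ, 0 < C ∧ 0 < r ∧
      ∀ i, ∀ s ∈ Icc (0 : ℝ) 1,
        (∀ ρ, |ρ| ≤ r → ∀ σ, 0 < σ →
          |doubleLayerAt z μ (z i s + ρ • unitNormal (z i) s) (σ ^ 2) -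
            (boundaryJet (z i) μ s).model σ ρ| ≤ C * σ ^ 3) ∧
        ∀ x, (∀ j u, r ≤ ‖x - z j u‖) → ∀ ρ, r ≤ |ρ| → ∀ σ, 0 < σ →
          |doubleLayerAt z μ x (σ ^ 2) - (boundaryJet (z i) μ s).model σ ρ| ≤ C * σ ^ 3 := by
  choose C R hC hR h using exists_near_bound hΩ hμ
  obtain ⟨r, hr, hr0⟩ := ((eventually_all.2 fun j => Ioc_mem_nhdsGT (hR j) :
    ∀ᶠ d in 𝓝[>] (0 : ℝ), ∀ j, d ∈ Ioc 0 (R j)).and self_mem_nhdsWithin).exists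
  obtain ⟨K₁, hK₁0, hK₁⟩ := exists_doubleLayerAt_le hΩ hμ (hr0 : 0 < r)
  have hm := fun i => ArcJet.exists_model_le_cube (hC i) (hr0 : 0 < r)
  choose K₂ hK₂0 hK₂ using hm
  obtain ⟨B, ⟨hB1, hB2⟩, hB0⟩ := (((eventually_all.2 fun j => eventually_ge_atTop (C j)).and
    (eventually_all.2 fun j => eventually_ge_atTop (K₁ + K₂ j))).and
    (eventually_gt_atTop (0 : ℝ))).exists
  refine ⟨B, r, hB0, hr0, fun i s hs => ⟨fun ρ hρ σ hσ => ?_, fun x hx ρ hρ σ hσ => ?_⟩⟩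
  · refine ((h i s hs).2 ρ (hρ.trans (hr i).2) σ hσ).trans ?_
    have := hB1 i
    gcongr
  · have h1 := hK₁ x σ hσ hx
    have h2 := hK₂ i _ (h i s hs).1 σ ρ hσ (Or.inl hρ)
    calc _ ≤ |doubleLayerAt z μ x (σ ^ 2)| + |(boundaryJet (z i) μ s).model σ ρ| := abs_sub _ _
      _ ≤ (K₁ + K₂ i) * σ ^ 3 := by linarith
      _ ≤ _ := by have := hB2 i; gcongr

end Boundary

/-! ### The boundary as a graph over its tangent lines -/

lemma unitTangent_fract {z : ℝ → Plane} (hz : Function.Periodic z 1) (s : ℝ) :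
    unitTangent z (Int.fract s) = unitTangent z s := by
  rw [unitTangent, unitTangent, periodic_map_fract (periodic_deriv hz)]

lemma unitNormal_fract {z : ℝ → Plane} (hz : Function.Periodic z 1) (s : ℝ) :
    unitNormal z (Int.fract s) = unitNormal z s := by
  rw [unitNormal_eq, unitNormal_eq, unitTangent_fract hz]

lemma curvature_fract {z : ℝ → Plane} (hz : Function.Periodic z 1) (s : ℝ) :
    curvature z (Int.fract s) = curvature z s := by
  rw [curvature, curvature, unitNormal_fract hz, periodic_map_fract (periodic_deriv hz),
    iteratedDeriv_succ, iteratedDeriv_one,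
    periodic_map_fract (periodic_deriv (periodic_deriv hz))]

lemma IsTangentParam.fract {Ω : Set Plane} {z : ℝ → Plane} (hz : Function.Periodic z 1) {s : ℝ}
    {μ : Plane → ℝ} {γ m : ℝ → ℝ} (h : IsTangentParam Ω z s μ γ m) :
    IsTangentParam Ω z (Int.fract s) μ γ m := by
  obtain ⟨h1, h2, h3, h4, h5⟩ := h
  refine ⟨h1, h2, h3, ?_, ?_⟩ <;>
    rwa [periodic_map_fract hz, unitTangent_fract hz, unitNormal_fract hz]

lemma add_tanCoord_norCoord {z : ℝ → Plane} (hreg : ∀ s, deriv z s ≠ 0) (s u : ℝ) :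
    z s + tanCoord z s u • unitTangent z s + norCoord z s u • unitNormal z s = z (s + u) := by
  have h := eq_inner_smul_add (norm_unitTangent (hreg s)) (z (s + u) - z s)
  rw [add_assoc]
  exact (eq_sub_iff_add_eq'.1 h.symm)

/-- The inverse function theorem on the line. -/
lemma exists_contDiffAt_rightInverse {f : ℝ → ℝ} {c : ℝ} (hf : ContDiff ℝ ∞ f) (hf0 : f 0 = 0)
    (hd : HasDerivAt f c 0) (hc : c ≠ 0) :
    ∃ ψ : ℝ → ℝ, ContDiffAt ℝ ∞ ψ 0 ∧ ψ 0 = 0 ∧ ∀ᶠ y in 𝓝 (0 : ℝ), f (ψ y) = y := by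
  have hd' := hd.hasFDerivAt_equiv hc
  have hne : (∞ : WithTop ℕ∞) ≠ 0 := by simp
  have h1 := hf.contDiffAt.to_localInverse hd' hne
  have h2 := hf.contDiffAt.localInverse_apply_image hd' hne
  have h3 := (hf.contDiffAt.hasStrictFDerivAt' hd' hne).eventually_right_inverse
  rw [hf0] at h1 h2 h3
  exact ⟨_, h1, h2, h3⟩

section Boundary

variable {ι : Type*} {Ω : Set Plane} {z : ι → ℝ → Plane}

lemma IsSmoothBoundary.mem_frontier (hΩ : IsSmoothBoundary Ω z) (i : ι) (s : ℝ) :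
    z i s ∈ frontier Ω := by
  rw [hΩ.frontier_eq]; exact mem_iUnion_of_mem i (mem_range_self s)

lemma IsSmoothBoundary.exists_tangentParam (hΩ : IsSmoothBoundary Ω z) {μ : Plane → ℝ}
    (hμ : ∀ i, ContDiff ℝ ∞ (fun s => μ (z i s))) (i : ι) (s : ℝ) :
    ∃ γ m : ℝ → ℝ, IsTangentParam Ω (z i) s μ γ m := by
  have hz := hΩ.smooth i
  have hreg := hΩ.regular i
  have hX : ContDiff ℝ ∞ fun u => tanCoord (z i) s u :=
    (contDiff_tanCoord hz hreg).comp₂ contDiff_const contDiff_id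
  have hN : ContDiff ℝ ∞ fun u => norCoord (z i) s u :=
    (contDiff_norCoord hz hreg).comp₂ contDiff_const contDiff_id
  obtain ⟨ψ, hψ, hψ0, hψr⟩ := exists_contDiffAt_rightInverse hX (tanCoord_zero _ _)
    (hasDerivAt_tanCoord hz s 0) (tanSpeed_zero_pos hreg s).ne'
  have hγ : ∀ᶠ ξ in 𝓝 (0 : ℝ), z i s + ξ • unitTangent (z i) s +
      norCoord (z i) s (ψ ξ) • unitNormal (z i) s = z i (s + ψ ξ) := by
    filter_upwards [hψr] with ξ hξ
    have := add_tanCoord_norCoord hreg s (ψ ξ)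
    rwa [hξ] at this
  refine ⟨norCoord (z i) s ∘ ψ, fun ξ => μ (z i (s + ψ ξ)), hN.contDiffAt.comp 0 hψ,
    (hμ i).contDiffAt.comp 0 (contDiffAt_const.add hψ), ?_, ?_, ?_⟩
  · simp [hψ0]
  · filter_upwards [hγ] with ξ hξ
    rw [Function.comp_apply, hξ]
    exact hΩ.mem_frontier i _
  · filter_upwards [hγ] with ξ hξ
    rw [Function.comp_apply, hξ]

/-- Close to a boundary point, the boundary consists of a single arc. -/
lemma IsSmoothBoundary.exists_param_of_near [Finite ι] (hΩ : IsSmoothBoundary Ω z) (i : ι) {s : ℝ}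
    (hs : s ∈ Icc (0 : ℝ) 1) {u₀ : ℝ} (hu₀ : 0 < u₀) :
    ∃ d > 0, ∀ y ∈ frontier Ω, ‖y - z i s‖ < d → ∃ u, |u| < u₀ ∧ y = z i (s + u) := by
  obtain ⟨d, hd, hsep⟩ := hΩ.exists_separation i hu₀
  refine ⟨d, hd, fun y hy hyd => ?_⟩
  rw [hΩ.frontier_eq] at hy
  obtain ⟨j, t, rfl⟩ := mem_iUnion.1 hy
  obtain ⟨h1, h2⟩ := hsep s hs
  have hji : j = i := by
    by_contra hj
    exact absurd (h2 j hj t) (not_le.2 hyd)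
  subst hji
  -- Subtracting the nearest integer puts the parameter difference in [-1/2, 1/2], where the
  -- separation bound applies.
  have e : z j t = z j (s + (t - s - round (t - s))) := by
    rw [show s + (t - s - round (t - s)) = t - (round (t - s) : ℤ) * 1 by ring,
      (hΩ.periodic j).sub_int_mul_eq]
  refine ⟨t - s - round (t - s), ?_, e⟩
  by_contra! hu
  have := h1 _ hu (abs_sub_round _)
  rw [← e] at this
  exact absurd this (not_le.2 hyd)

/-- The functions of a tangent line parametrization, in terms of the parameter of the curve. -/
lemma IsTangentParam.eventually_eq [Finite ι] (hΩ : IsSmoothBoundary Ω z) {μ : Plane → ℝ} {i : ι}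
    {s : ℝ} (hs : s ∈ Icc (0 : ℝ) 1) {γ m : ℝ → ℝ} (h : IsTangentParam Ω (z i) s μ γ m) :
    ∀ᶠ u in 𝓝 (0 : ℝ), γ (tanCoord (z i) s u) = norCoord (z i) s u ∧
      m (tanCoord (z i) s u) = μ (z i (s + u)) := by
  have hz := hΩ.smooth i
  have hreg := hΩ.regular i
  have hdom : ∀ᶠ u in 𝓝 (0 : ℝ), (s, u) ∈ graphDomain (z i) := by
    have hc : ContinuousAt (fun u : ℝ => (s, u)) 0 := by fun_prop
    exact hc.eventually_mem ((isOpen_graphDomain hz hreg).mem_nhds (tanSpeed_zero_pos hreg s))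
  obtain ⟨u₀, hu₀, hball⟩ := Metric.nhds_basis_ball.mem_iff.1 hdom
  rw [Real.ball_eq_Ioo, zero_sub, zero_add] at hball
  have hinj : InjOn (tanCoord (z i) s) (Ioo (-u₀) u₀) := by
    refine StrictMonoOn.injOn (strictMonoOn_of_deriv_pos (convex_Ioo _ _)
      (fun u _ => (hasDerivAt_tanCoord hz s u).continuousAt.continuousWithinAt) fun u hu => ?_)
    rw [(hasDerivAt_tanCoord hz s u).deriv]
    exact hball (interior_subset hu)
  obtain ⟨d, hd, hnear⟩ := hΩ.exists_param_of_near i hs hu₀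
  have hXt : Tendsto (tanCoord (z i) s) (𝓝 0) (𝓝 0) := by
    have := (hasDerivAt_tanCoord hz s 0).continuousAt.tendsto
    rwa [tanCoord_zero] at this
  have hclose : ∀ᶠ ξ in 𝓝 (0 : ℝ),
      ‖z i s + ξ • unitTangent (z i) s + γ ξ • unitNormal (z i) s - z i s‖ < d := by
    have hγc := h.smooth_graph.continuousAt
    have hc : ContinuousAt (fun ξ =>
        ‖z i s + ξ • unitTangent (z i) s + γ ξ • unitNormal (z i) s - z i s‖) 0 := by fun_prop
    refine hc.eventually_lt continuousAt_const ?_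
    simpa [h.graph_zero] using hd
  filter_upwards [hXt.eventually hclose, hXt.eventually h.mem_boundary, hXt.eventually h.density_eq,
    Ioo_mem_nhds (neg_lt_zero.2 hu₀) hu₀] with u hu1 hu2 hu3 hu4
  obtain ⟨w, hw, hp⟩ := hnear _ hu2 hu1
  have hτ := norm_unitTangent (hreg s)
  have hν := norm_unitNormal (hreg s)
  have hτν : inner ℝ (unitTangent (z i) s) (unitNormal (z i) s) = 0 := inner_rot_self _
  have e : z i (s + w) - z i s = tanCoord (z i) s u • unitTangent (z i) s +
      γ (tanCoord (z i) s u) • unitNormal (z i) s := by rw [← hp]; abel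
  have e1 : tanCoord (z i) s w = tanCoord (z i) s u := by
    rw [tanCoord, e, inner_add_left, inner_smul_left, inner_smul_left, real_inner_self_eq_norm_sq,
      hτ, real_inner_comm, hτν]
    simp
  have e2 : norCoord (z i) s w = γ (tanCoord (z i) s u) := by
    rw [norCoord, e, inner_add_left, inner_smul_left, inner_smul_left, real_inner_self_eq_norm_sq,
      hν, hτν]
    simp
  -- The graph point lies on the arc at some parameter w with the same tangential coordinate as u,
  -- and that coordinate is strictly increasing.
  have hwu : w = u := hinj (abs_lt.1 hw) hu4 e1
  subst hwu
  exact ⟨e2.symm, by rw [hu3, hp]⟩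

lemma IsTangentParam.curveDeriv_eq [Finite ι] (hΩ : IsSmoothBoundary Ω z) {μ : Plane → ℝ} {i : ι}
    {s : ℝ} (hs : s ∈ Icc (0 : ℝ) 1) {γ m : ℝ → ℝ} (h : IsTangentParam Ω (z i) s μ γ m) (k : ℕ) :
    curveDeriv (z i) s k 0 = iteratedDeriv k γ 0 :=
  iterate_graphDeriv_eq (hΩ.smooth i) (hΩ.regular i)
    (contDiff_norCoord (hΩ.smooth i) (hΩ.regular i)) h.smooth_graph
    ((h.eventually_eq hΩ hs).mono fun _ hu => hu.1) k

lemma IsTangentParam.densityDeriv_eq [Finite ι] (hΩ : IsSmoothBoundary Ω z) {μ : Plane → ℝ}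
    (hμ : ∀ i, ContDiff ℝ ∞ (fun s => μ (z i s))) {i : ι} {s : ℝ} (hs : s ∈ Icc (0 : ℝ) 1)
    {γ m : ℝ → ℝ} (h : IsTangentParam Ω (z i) s μ γ m) (k : ℕ) :
    densityDeriv (z i) μ s k 0 = iteratedDeriv k m 0 :=
  iterate_graphDeriv_eq (F := fun p => μ (z i (p.1 + p.2))) (hΩ.smooth i) (hΩ.regular i)
    ((hμ i).comp (contDiff_fst.add contDiff_snd)) h.smooth_density
    ((h.eventually_eq hΩ hs).mono fun _ hu => hu.2) k

/-! ### Closest boundary points -/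

lemma IsSmoothBoundary.exists_closest [Finite ι] [Nonempty ι] (hΩ : IsSmoothBoundary Ω z)
    (x : Plane) : ∃ i s, ∀ y ∈ frontier Ω, dist x (z i s) ≤ dist x y := by
  have hc : IsCompact (frontier Ω) := by
    rw [hΩ.frontier_eq]
    exact isCompact_iUnion fun i =>
      (hΩ.periodic i).compact_of_continuous one_ne_zero (hΩ.smooth i).continuous
  have i₀ : ι := Classical.arbitrary ι
  obtain ⟨y, hy, hxy⟩ := hc.exists_infDist_eq_dist ⟨_, hΩ.mem_frontier i₀ 0⟩ x
  have hy' := hy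
  rw [hΩ.frontier_eq] at hy'
  obtain ⟨i, s, rfl⟩ := mem_iUnion.1 hy'
  exact ⟨i, s, fun p hp => hxy ▸ Metric.infDist_le_dist_of_mem hp⟩

/-- A point lies on the normal line through any closest boundary point. -/
lemma IsSmoothBoundary.exists_eq_add_smul (hΩ : IsSmoothBoundary Ω z) {x : Plane} {i : ι} {s : ℝ}
    (h : ∀ y ∈ frontier Ω, dist x (z i s) ≤ dist x y) :
    ∃ ρ : ℝ, x = z i s + ρ • unitNormal (z i) s := by
  have hreg := hΩ.regular i
  have hd : HasDerivAt (z i) (deriv (z i) s) s :=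
    ((hΩ.smooth i).differentiable (by simp)).differentiableAt.hasDerivAt
  have h1 := (hd.const_sub x).norm_sq
  -- The squared distance is smooth even at x = z i s, and its critical point equation makes x - z i
  -- s orthogonal to the tangent.
  have hmin : IsLocalMin (fun u => ‖x - z i u‖ ^ 2) s := Eventually.of_forall fun u => by
    have := h _ (hΩ.mem_frontier i u)
    rw [dist_eq_norm, dist_eq_norm] at this
    beta_reduce
    gcongr
  have h2 := hmin.hasDerivAt_eq_zero h1
  have h3 : inner ℝ (x - z i s) (unitTangent (z i) s) = 0 := by
    rw [inner_neg_right] at h2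
    rw [unitTangent, inner_smul_right, show inner ℝ (x - z i s) (deriv (z i) s) = 0 by linarith,
      mul_zero]
  have h4 := eq_inner_smul_add (norm_unitTangent (hreg s)) (x - z i s)
  rw [h3, zero_smul, zero_add] at h4
  exact ⟨_, sub_eq_iff_eq_add'.1 h4⟩

/-- A connected set that does not meet the frontier of an open set `U` does not leave `U`. -/
lemma subset_of_disjoint_frontier {X : Type*} [TopologicalSpace X] {S U : Set X}
    (hS : IsPreconnected S) (hU : IsOpen U) (hd : Disjoint S (frontier U))
    (hne : (S ∩ U).Nonempty) : S ⊆ U := by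
  refine hS.subset_left_of_subset_union hU isClosed_closure.isOpen_compl
    (disjoint_compl_right.mono_left subset_closure) (fun p hp => ?_) hne
  by_contra h
  rw [mem_union, not_or, mem_compl_iff, not_not] at h
  exact disjoint_left.1 hd hp (hU.frontier_eq ▸ ⟨h.2, h.1⟩)

/-- The open half of the normal segment to a closest boundary point does not meet the boundary. -/
lemma isPreconnected_normal_segment {x b n : Plane} {ρ : ℝ} (hn : ‖n‖ = 1) (hρ : 0 < ρ)
    (hx : x = b + ρ • n) (h : ∀ y ∈ frontier Ω, dist x b ≤ dist x y) :
    IsPreconnected ((fun t : ℝ => b + t • n) '' Ioc 0 ρ) ∧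
      Disjoint ((fun t : ℝ => b + t • n) '' Ioc 0 ρ) (frontier Ω) := by
  refine ⟨isPreconnected_Ioc.image _ (by fun_prop), disjoint_left.2 ?_⟩
  rintro _ ⟨t, ht, rfl⟩ hp
  -- A boundary point at height t in (0, ρ] would be at distance ρ - t < ρ from x, contradicting
  -- minimality.
  have h1 := h _ hp
  rw [hx, dist_eq_norm, dist_eq_norm, add_sub_cancel_left, add_sub_add_left_eq_sub, ← sub_smul,
    norm_smul, norm_smul, hn, mul_one, mul_one, Real.norm_eq_abs, Real.norm_eq_abs,
    abs_of_pos hρ, abs_of_nonneg (by linarith [ht.2])] at h1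
  linarith [ht.1]

/-- A point on the normal line through a closest boundary point lies on the side of the boundary
to which the normal direction points. -/
lemma IsSmoothBoundary.sideSign_eq (hΩ : IsSmoothBoundary Ω z) {x : Plane} {i : ι} {s ρ : ℝ}
    (h : ∀ y ∈ frontier Ω, dist x (z i s) ≤ dist x y)
    (hx : x = z i s + ρ • unitNormal (z i) s) : sideSign Ω x = SignType.sign ρ := by
  have hν := norm_unitNormal (hΩ.regular i s)
  have hdis : ∀ y, y ∈ frontier Ω → y ∉ Ω := fun y hy hyΩ => by
    rw [hΩ.isOpen.frontier_eq] at hy; exact hy.2 hyΩ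
  rcases lt_trichotomy ρ 0 with hρ | hρ | hρ
  · have hx' : x = z i s + (-ρ) • (-unitNormal (z i) s) := by rw [hx, neg_smul_neg]
    obtain ⟨hc, hd⟩ := isPreconnected_normal_segment (by rwa [norm_neg]) (neg_pos.2 hρ) hx' h
    have hxS : x ∈ (fun t : ℝ => z i s + t • -unitNormal (z i) s) '' Ioc 0 (-ρ) :=
      ⟨-ρ, ⟨by linarith, le_rfl⟩, hx'.symm⟩
    -- The local side condition puts a point of the normal segment in Ω; the segment is connected
    -- and misses the boundary, so its endpoint x is in Ω too.
    obtain ⟨t, ht, ht'⟩ := ((hΩ.inside i s).and (Ioc_mem_nhdsGT (neg_pos.2 hρ))).exists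
    have hxΩ : x ∈ Ω := by
      refine subset_of_disjoint_frontier hc hΩ.isOpen hd ⟨_, ⟨t, ht', rfl⟩, ?_⟩ hxS
      simpa [sub_eq_add_neg] using ht
    simp [sideSign, hxΩ, sign_neg hρ]
  · have hxf : x ∈ frontier Ω := by
      rw [hx, hρ, zero_smul, add_zero]; exact hΩ.mem_frontier i s
    simp [sideSign, hxf, hdis x hxf, hρ]
  · obtain ⟨hc, hd⟩ := isPreconnected_normal_segment hν hρ hx h
    have hxS : x ∈ (fun t : ℝ => z i s + t • unitNormal (z i) s) '' Ioc 0 ρ :=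
      ⟨ρ, ⟨hρ, le_rfl⟩, hx.symm⟩
    obtain ⟨t, ht, ht'⟩ := ((hΩ.outside i s).and (Ioc_mem_nhdsGT hρ)).exists
    have hxΩ : x ∉ Ω := fun hxΩ =>
      ht (subset_closure (subset_of_disjoint_frontier hc hΩ.isOpen hd ⟨x, hxS, hxΩ⟩
        ⟨t, ht', rfl⟩))
    simp [sideSign, hxΩ, disjoint_left.1 hd hxS, sign_pos hρ]

lemma IsSmoothBoundary.dist_eq_abs (hΩ : IsSmoothBoundary Ω z) {i : ι} {s ρ : ℝ} :
    dist (z i s + ρ • unitNormal (z i) s) (z i s) = |ρ| := by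
  rw [dist_eq_norm, add_sub_cancel_left, norm_smul, norm_unitNormal (hΩ.regular i s), mul_one,
    Real.norm_eq_abs]

end Boundary

/-! ### The time integral -/

/-- Integration in time of two functions that agree up to `O(t ^ (3 / 2))`. -/
lemma integral_close {f g : ℝ → ℝ} {C δ : ℝ} (hC : 0 ≤ C) (hδ : 0 < δ)
    (hf : ContinuousOn f (Ioi 0)) (hg : ContinuousOn g (Ioi 0))
    (hgi : IntervalIntegrable g volume 0 δ) (h : ∀ t, 0 < t → |f t - g t| ≤ C * √t ^ 3) :
    IntervalIntegrable f volume 0 δ ∧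
      |(∫ t in (0 : ℝ)..δ, f t) - ∫ t in (0 : ℝ)..δ, g t| ≤ C * δ ^ (5 / 2 : ℝ) := by
  have hsub : uIoc 0 δ ⊆ Ioi 0 := by rw [uIoc_of_le hδ.le]; exact fun t ht => ht.1
  have hb : ∀ t ∈ uIoc 0 δ, ‖f t - g t‖ ≤ C * √δ ^ 3 := by
    intro t ht
    have h2 : t ≤ δ := by rw [uIoc_of_le hδ.le] at ht; exact ht.2
    refine (h t (hsub ht)).trans ?_
    gcongr
  have hi : IntervalIntegrable (fun t => f t - g t) volume 0 δ := by
    refine IntervalIntegrable.mono_fun (intervalIntegrable_const (c := C * √δ ^ 3))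
      (((hf.sub hg).mono hsub).aestronglyMeasurable measurableSet_uIoc) ?_
    filter_upwards [ae_restrict_mem measurableSet_uIoc] with t ht
    exact (hb t ht).trans (le_abs_self _)
  have hfi : IntervalIntegrable f volume 0 δ := by simpa using hi.add hgi
  refine ⟨hfi, ?_⟩
  rw [← intervalIntegral.integral_sub hfi hgi]
  refine (intervalIntegral.norm_integral_le_of_norm_le_const hb).trans_eq ?_
  rw [sub_zero, abs_of_pos hδ, show (5 / 2 : ℝ) = 3 / 2 + 1 by norm_num, rpow_add hδ, rpow_one,
    sqrt_rpow_three hδ, mul_assoc]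

section Boundary

variable {ι : Type*} {Ω : Set Plane} {z : ι → ℝ → Plane}

lemma continuousOn_doubleLayerAt [Fintype ι] (hΩ : IsSmoothBoundary Ω z) {μ : Plane → ℝ}
    (hμ : ∀ i, ContDiff ℝ ∞ (fun s => μ (z i s))) (x : Plane) :
    ContinuousOn (fun t => doubleLayerAt z μ x t) (Ioi 0) := by
  have h := continuous_doubleLayerAt_exp hΩ.smooth hΩ.regular hμ
  have h2 : ContinuousOn (fun t => doubleLayerAt z μ x (exp (log t))) (Ioi 0) :=
    h.comp_continuousOn (f := fun t => (x, log t))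
      (continuousOn_const.prodMk (continuousOn_log.mono fun t ht => ne_of_gt ht))
  exact h2.congr fun t ht => by beta_reduce; rw [exp_log ht]

lemma continuous_doubleLayerAt_target [Fintype ι] (hΩ : IsSmoothBoundary Ω z) {μ : Plane → ℝ}
    (hμ : ∀ i, ContDiff ℝ ∞ (fun s => μ (z i s))) {t : ℝ} (ht : 0 < t) :
    Continuous (fun x => doubleLayerAt z μ x t) := by
  have h := (continuous_doubleLayerAt_exp hΩ.smooth hΩ.regular hμ).comp
    (by fun_prop : Continuous fun x : Plane => (x, log t))
  simpa only [Function.comp_def, exp_log ht] using h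

lemma continuousOn_model_sqrt (J : ArcJet) (ρ : ℝ) :
    ContinuousOn (fun t => J.model √t ρ) (Ioi 0) :=
  (J.continuousOn_model ρ).comp continuous_sqrt.continuousOn fun _ ht => sqrt_pos.2 ht

/-- Uniform approximation of the inner integral in terms of the closest boundary point. -/
lemma exists_closest_approx [Fintype ι] (hΩ : IsSmoothBoundary Ω z) {μ : Plane → ℝ}
    (hμ : ∀ i, ContDiff ℝ ∞ (fun s => μ (z i s))) : ∃ C : ℝ, 0 < C ∧
      ∀ i, ∀ s ∈ Icc (0 : ℝ) 1, ∀ x, (∀ y ∈ frontier Ω, dist x (z i s) ≤ dist x y) →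
        ∀ t, 0 < t → |doubleLayerAt z μ x t -
          (boundaryJet (z i) μ s).model √t (sideSign Ω x * dist x (z i s))| ≤ C * √t ^ 3 := by
  obtain ⟨C, r, hC, hr, h⟩ := exists_model_approx hΩ hμ
  refine ⟨C, hC, fun i s hs x hx t ht => ?_⟩
  obtain ⟨ρ, hρ⟩ := hΩ.exists_eq_add_smul hx
  have hdist : dist x (z i s) = |ρ| := by rw [hρ]; exact hΩ.dist_eq_abs
  rw [hΩ.sideSign_eq hx hρ, hdist, sign_mul_abs]
  have ht2 : √t ^ 2 = t := sq_sqrt ht.le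
  rcases le_total |ρ| r with hr' | hr'
  · have := (h i s hs).1 ρ hr' √t (sqrt_pos.2 ht)
    rwa [ht2, ← hρ] at this
  -- Since the base point is a closest one, |ρ| ≥ r keeps the entire boundary at distance at least r
  -- from x.
  · have := (h i s hs).2 x (fun j u => ?_) ρ hr' √t (sqrt_pos.2 ht)
    · rwa [ht2] at this
    · rw [← dist_eq_norm]
      exact hr'.trans (hdist ▸ hx _ (hΩ.mem_frontier j u))

lemma closest_fract (hΩ : IsSmoothBoundary Ω z) {x : Plane} {i : ι} {s : ℝ}
    (h : ∀ y ∈ frontier Ω, dist x (z i s) ≤ dist x y) :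
    ∀ y ∈ frontier Ω, dist x (z i (Int.fract s)) ≤ dist x y := by
  rwa [periodic_map_fract (hΩ.periodic i)]

lemma fract_mem_Icc (s : ℝ) : Int.fract s ∈ Icc (0 : ℝ) 1 :=
  ⟨Int.fract_nonneg s, (Int.fract_lt_one s).le⟩

/-- The time integral that defines the local double layer potential converges. -/
lemma intervalIntegrable_doubleLayerAt [Fintype ι] (hΩ : IsSmoothBoundary Ω z) {μ : Plane → ℝ}
    (hμ : ∀ i, ContDiff ℝ ∞ (fun s => μ (z i s))) (x : Plane) {δ : ℝ} (hδ : 0 < δ) :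
    IntervalIntegrable (fun t => doubleLayerAt z μ x t) volume 0 δ := by
  cases isEmpty_or_nonempty ι with
  -- Without boundary curves there is no closest point, but the integrand is an empty sum.
  | inl h => simp [doubleLayerAt]
  | inr h =>
    obtain ⟨C, hC, happ⟩ := exists_closest_approx hΩ hμ
    obtain ⟨i, s, hx⟩ := hΩ.exists_closest x
    exact (integral_close hC.le hδ (continuousOn_doubleLayerAt hΩ hμ x)
      (continuousOn_model_sqrt _ _) (ArcJet.intervalIntegrable_model _ _ hδ)
      (happ i _ (fract_mem_Icc s) x (closest_fract hΩ hx))).1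

/-- The local double layer potential is the integral of the model up to `O(δ ^ (5 / 2))`. -/
lemma exists_expansion [Fintype ι] (hΩ : IsSmoothBoundary Ω z) {μ : Plane → ℝ}
    (hμ : ∀ i, ContDiff ℝ ∞ (fun s => μ (z i s))) : ∃ C > 0, ∀ δ : ℝ, 0 < δ →
      ∀ (x : Plane) (i : ι), ∀ s ∈ Icc (0 : ℝ) 1,
      (∀ y ∈ frontier Ω, dist x (z i s) ≤ dist x y) →
      ∀ γ m : ℝ → ℝ, IsTangentParam Ω (z i) s μ γ m →
        |localDoubleLayer z μ δ x -
            doubleLayerExpansion δ (sideSign Ω x) (dist x (z i s) / √δ) (curvature (z i) s)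
              (iteratedDeriv 3 γ 0) (iteratedDeriv 4 γ 0)
              (μ (z i s)) (iteratedDeriv 1 m 0) (iteratedDeriv 2 m 0) (iteratedDeriv 4 m 0)|
          ≤ C * δ ^ (5 / 2 : ℝ) := by
  obtain ⟨C, hC, happ⟩ := exists_closest_approx hΩ hμ
  refine ⟨C, hC, fun δ hδ x i s hs hx γ m hT => ?_⟩
  have h1 := (integral_close hC.le hδ (continuousOn_doubleLayerAt hΩ hμ x)
    (continuousOn_model_sqrt _ _) (ArcJet.intervalIntegrable_model _ _ hδ)
    (happ i s hs x hx)).2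
  have hside : (dist x (z i s) = 0 ∧ sideSign Ω x = 0) ∨
      (dist x (z i s) ≠ 0 ∧ sideSign Ω x ^ 2 = 1) := by
    obtain ⟨ρ, hρ⟩ := hΩ.exists_eq_add_smul hx
    rw [hΩ.sideSign_eq hx hρ, hρ, hΩ.dist_eq_abs]
    rcases lt_trichotomy ρ 0 with h | h | h
    · right; simp [sign_neg h, h.ne]
    · left; simp [h]
    · right; simp [sign_pos h, h.ne']
  rw [ArcJet.integral_model _ hδ dist_nonneg hside] at h1
  simp only [boundaryJet, curveDeriv_two_zero (hΩ.smooth i) (hΩ.regular i),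
    densityDeriv_zero_zero, hT.curveDeriv_eq hΩ hs, hT.densityDeriv_eq hΩ hμ hs 1,
    hT.densityDeriv_eq hΩ hμ hs 2, hT.densityDeriv_eq hΩ hμ hs 4] at h1
  exact h1

/-- The jump relation on either side, `ε = 1` or `ε = -1`, of the boundary. -/
lemma tendsto_localDoubleLayer [Fintype ι] (hΩ : IsSmoothBoundary Ω z) {μ : Plane → ℝ}
    (hμ : ∀ i, ContDiff ℝ ∞ (fun s => μ (z i s))) {δ : ℝ} (hδ : 0 < δ) (i : ι) (s : ℝ) {ε : ℝ}
    (hε : ε ^ 2 = 1) :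
    Tendsto (fun r : ℝ => localDoubleLayer z μ δ (z i s + (ε * r) • unitNormal (z i) s)) (𝓝[>] 0)
      (𝓝 (localDoubleLayer z μ δ (z i s) + ε * (μ (z i s) / 2))) := by
  wlog hs : s ∈ Icc (0 : ℝ) 1 generalizing s
  · have := this (Int.fract s) (fract_mem_Icc s)
    rwa [periodic_map_fract (hΩ.periodic i), unitNormal_fract (hΩ.periodic i)] at this
  have hε1 : |ε| = 1 := by rw [← sq_eq_sq₀ (abs_nonneg _) zero_le_one, sq_abs, hε, one_pow]
  obtain ⟨C, r₀, hC, hr₀, h⟩ := exists_model_approx hΩ hμ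
  have happ : ∀ ρ, |ρ| ≤ r₀ → ∀ t, 0 < t →
      |doubleLayerAt z μ (z i s + ρ • unitNormal (z i) s) t -
        (boundaryJet (z i) μ s).model √t ρ| ≤ C * √t ^ 3 := fun ρ hρ t ht => by
    have := (h i s hs).1 ρ hρ √t (sqrt_pos.2 ht)
    rwa [sq_sqrt ht.le] at this
  set J := boundaryJet (z i) μ s with hJ
  have hJ0 : J.m₀ = μ (z i s) := densityDeriv_zero_zero _ _ _
  set p : ℝ → Plane := fun r => z i s + (ε * r) • unitNormal (z i) s with hp
  have hp0 : p 0 = z i s := by simp [hp]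
  have hpc : Continuous p := by fun_prop
  have hsub : uIoc 0 δ ⊆ Ioi 0 := by rw [uIoc_of_le hδ.le]; exact fun t ht => ht.1
  have hsmall : ∀ᶠ r in 𝓝[>] (0 : ℝ), 0 < r ∧ |ε * r| ≤ r₀ := by
    filter_upwards [Ioc_mem_nhdsGT hr₀] with r hr
    rw [abs_mul, hε1, one_mul, abs_of_pos hr.1]
    exact hr
  have hdiff : ∀ r, (∫ t in (0 : ℝ)..δ, (doubleLayerAt z μ (p r) t - J.model √t (ε * r))) =
      localDoubleLayer z μ δ (p r) - ∫ t in (0 : ℝ)..δ, J.model √t (ε * r) := fun r =>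
    intervalIntegral.integral_sub (intervalIntegrable_doubleLayerAt hΩ hμ _ hδ)
      (J.intervalIntegrable_model _ hδ)
  -- The error bound C √δ ³ on the difference is uniform in r, so dominated convergence gives a
  -- limit without jump, although neither term alone is dominated this way.
  have hlim : Tendsto
      (fun r => ∫ t in (0 : ℝ)..δ, (doubleLayerAt z μ (p r) t - J.model √t (ε * r))) (𝓝[>] 0)
      (𝓝 (∫ t in (0 : ℝ)..δ, (doubleLayerAt z μ (p 0) t - J.model √t (ε * 0)))) := by
    refine intervalIntegral.tendsto_integral_filter_of_dominated_convergence
      (fun _ => C * √δ ^ 3) (Eventually.of_forall fun r => ?_) ?_ intervalIntegrable_const ?_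
    · exact (((continuousOn_doubleLayerAt hΩ hμ (p r)).sub
        (continuousOn_model_sqrt J _)).mono hsub).aestronglyMeasurable measurableSet_uIoc
    · filter_upwards [hsmall] with r hr
      refine Eventually.of_forall fun t ht => ?_
      have ht2 : t ≤ δ := by rw [uIoc_of_le hδ.le] at ht; exact ht.2
      refine (happ _ hr.2 t (hsub ht)).trans ?_
      gcongr
    · refine Eventually.of_forall fun t ht => ?_
      have hc : Continuous fun r => doubleLayerAt z μ (p r) t - J.model √t (ε * r) :=
        ((continuous_doubleLayerAt_target hΩ hμ (hsub ht)).comp hpc).sub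
          ((J.continuous_model _).comp (by fun_prop))
      exact (hc.tendsto 0).mono_left nhdsWithin_le_nhds
  -- At the boundary point the model is evaluated with σ = 0 and r = 0, consistently with the value
  -- of the closed formula subtracted in the limit.
  have h0 := J.integral_model hδ (le_refl (0 : ℝ)) (Or.inl ⟨rfl, rfl⟩ : _ ∨ (0 : ℝ) ≠ 0 ∧ (0 : ℝ) ^ 2 = 1)
  rw [hdiff 0, hp0, mul_zero] at hlim
  rw [zero_mul, zero_div] at h0
  rw [h0] at hlim
  have hE := tendsto_doubleLayerExpansion δ ε J.κ J.k₃ J.k₄ J.m₀ J.m₁ J.m₂ J.m₄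
  have hsum := hlim.add hE
  rw [hJ0, ← add_assoc, sub_add_cancel] at hsum
  refine hsum.congr' ?_
  filter_upwards [hsmall] with r hr
  rw [hdiff r, J.integral_model hδ hr.1.le (Or.inr ⟨hr.1.ne', hε⟩), ← hJ0, sub_add_cancel]

end Boundary

end HeatLayer

end

theorem lemma4p3 {ι : Type*} [Fintype ι] (Ω : Set Plane) (z : ι → ℝ → Plane)
    (hΩ : IsSmoothBoundary Ω z) (μ : Plane → ℝ)
    (hμ : ∀ i, ContDiff ℝ ∞ (fun s => μ (z i s))) :
    -- the boundary and the density can be written along the tangent line at each boundary point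
    (∀ i s, ∃ γ m : ℝ → ℝ, IsTangentParam Ω (z i) s μ γ m) ∧
    -- the time integral that defines the potential converges
    (∀ (x : Plane) (δ : ℝ), 0 < δ →
      IntervalIntegrable (fun t => doubleLayerAt z μ x t) volume 0 δ) ∧
    -- the expansion, with an error that is uniform in the target `x`
    (∃ C > 0, ∃ δ₀ > 0, ∀ δ : ℝ, 0 < δ → δ ≤ δ₀ → ∀ (x : Plane) (i : ι) (s : ℝ),
      (∀ y ∈ frontier Ω, dist x (z i s) ≤ dist x y) →
      ∀ γ m : ℝ → ℝ, IsTangentParam Ω (z i) s μ γ m →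
        |localDoubleLayer z μ δ x -
            doubleLayerExpansion δ (sideSign Ω x) (dist x (z i s) / √δ) (curvature (z i) s)
              (iteratedDeriv 3 γ 0) (iteratedDeriv 4 γ 0)
              (μ (z i s)) (iteratedDeriv 1 m 0) (iteratedDeriv 2 m 0) (iteratedDeriv 4 m 0)|
          ≤ C * δ ^ (5 / 2 : ℝ)) ∧
    -- the jump relation
    (∀ δ : ℝ, 0 < δ → ∀ (i : ι) (s : ℝ),
      Tendsto (fun r : ℝ => localDoubleLayer z μ δ (z i s + r • unitNormal (z i) s)) (𝓝[>] 0)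
        (𝓝 (localDoubleLayer z μ δ (z i s) + 1 / 2 * μ (z i s))) ∧
      Tendsto (fun r : ℝ => localDoubleLayer z μ δ (z i s - r • unitNormal (z i) s)) (𝓝[>] 0)
        (𝓝 (localDoubleLayer z μ δ (z i s) - 1 / 2 * μ (z i s)))) := by
  refine ⟨fun i s => hΩ.exists_tangentParam hμ i s,
    fun x δ hδ => intervalIntegrable_doubleLayerAt hΩ hμ x hδ, ?_, fun δ hδ i s => ⟨?_, ?_⟩⟩
  · obtain ⟨C, hC, h⟩ := exists_expansion hΩ hμ
    -- The error bound holds for every δ > 0, so the threshold 1 is an arbitrary choice.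
    refine ⟨C, hC, 1, one_pos, fun δ hδ _ x i s hx γ m hT => ?_⟩
    have := h δ hδ x i _ (fract_mem_Icc s) (closest_fract hΩ hx) γ m (hT.fract (hΩ.periodic i))
    rwa [periodic_map_fract (hΩ.periodic i), curvature_fract (hΩ.periodic i)] at this
  · have := tendsto_localDoubleLayer hΩ hμ hδ i s (ε := 1) (by norm_num)
    simp only [one_mul] at this
    convert this using 3
    ring
  · convert tendsto_localDoubleLayer hΩ hμ hδ i s (ε := -1) (by norm_num) using 3
    · rw [neg_one_mul, neg_smul, sub_eq_add_neg]
    · ring
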